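/- Let $G=\mathbb R^2\ltimes\mathbb R^4$ be the six-dimensional, completely solvable Lie group with coordinates $(t,x,y_1,y_2,z_1,z_2)\in\mathbb R^6$ and product $$(t,x,y_1,y_2,z_1,z_2)*(t',x',y_1',y_2',z_1',z_2')=(t+t',\,x+x',\,y_1'e^{t}+xz_1'e^{t}+y_1,\,y_2'e^{-t}+xz_2'e^{-t}+y_2,\,z_1'e^{t}+z_1,\,z_2'e^{-t}+z_2).$$ Let $B\in SL(2,\mathbb Z)$ have distinct eigenvalues $e^{a_0},e^{-a_0}$ ($a_0\in\mathbb R\setminus\{0\}$), let $P\in GL(2,\mathbb R)$ satisfy $PBP^{-1}=\mathrm{diag}(e^{a_0},e^{-a_0})$, let $\Gamma\subset G$ be the lattice of all points with $t\in a_0\mathbb Z$, $x\in\mathbb Z$, $(y_1,y_2)^T\in P\mathbb Z^2$, $(z_1,z_2)^T\in P\mathbb Z^2$, and let $X=\Gamma\backslash G$, a compact $\mathbb T^4$-bundle over $\mathbb T^2$. Consider on $G$ the left-invariant coframe $e^1=dt$, $e^2=dx$, $e^3=e^{-t}dy_1-xe^{-t}dz_1$, $e^4=e^{t}dy_2-xe^{t}dz_2$,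 $e^5=e^{-t}dz_1$, $e^6=e^{t}dz_2$, with dual frame $e_1,\dots,e_6$. For $a,b,c\in\mathbb R$ with $a\neq0$, $c\neq0$, let $(J_{a,b,c},\omega_{a,b,c})$ be the almost-Kähler structure on $X$ induced by $$\omega_{a,b,c}=a\,e^{1}\wedge e^2+b\,e^{5}\wedge e^6+c\,(e^{3}\wedge e^6+e^{4}\wedge e^5),$$ $$Je_1=ae_2,\quad Je_2=-\tfrac1a e_1,\quad Je_3=ce_6,\quad Je_4=ce_5-be_3,\quad Je_5=-\tfrac1c e_4+be_6,\quad Je_6=-\tfrac1c e_3,$$ with Hermitian metric $g(\cdot,\cdot)=\omega_{a,b,c}(\cdot,J_{a,b,c}\,\cdot)$. Let $A^{p,q}(X)$ be the space of smooth complex-valued forms of type $(p,q)$ on $X$, let $\bar\partial:A^{p,q}(X)\to A^{p,q+1}(X)$ be the component of type $(p,q+1)$ of the exterior derivative, let $\bar\partial^*$ be its formal adjoint with respect to the $L^2$ product given by $g$, let $\Delta_{\bar\partial}=\bar\partial\bar\partial^*+\bar\partial^*\bar\partial$, and let $h^{p,q}_{\bar\partial}=\dim_{\mathbb C}\ker\bigl(\Delta_{\bar\partial}|_{A^{p,q}(X)}\bigr)$.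 Then, for all such $B,P,a_0,a,b,c$: * $h^{1,0}_{\bar\partial}=1$; * $h^{2,0}_{\bar\partial}=0$ if $c\notin4\pi\mathbb Z$, and $h^{2,0}_{\bar\partial}=2$ if $c\in4\pi\mathbb Z$; * $h^{3,0}_{\bar\partial}=1$. -/

import Mathlib

noncomputable section

namespace Solvmanifold

open scoped ContDiff
open MeasureTheory

/-- The coordinate space of `G`; the coordinates `0, …, 5` are `t, x, y₁, y₂, z₁, z₂`. It is also
the tangent space at every point. -/
abbrev E : Type := Fin 6 → ℝ

/-! ### The solvable Lie group `G` -/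

/-- The Lie group `G = ℝ² ⋉ ℝ⁴`, in the global coordinates `(t, x, y₁, y₂, z₁, z₂)`. -/
def G : Type := E

/-- The group law of `G` in coordinates. -/
def gmul (g h : E) : E :=
  ![g 0 + h 0, g 1 + h 1,
    h 2 * Real.exp (g 0) + g 1 * h 4 * Real.exp (g 0) + g 2,
    h 3 * Real.exp (-g 0) + g 1 * h 5 * Real.exp (-g 0) + g 3,
    h 4 * Real.exp (g 0) + g 4,
    h 5 * Real.exp (-g 0) + g 5]

/-- Inversion of `G` in coordinates. -/
def ginv (g : E) : E :=
  ![-g 0, -g 1,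
    (g 1 * g 4 - g 2) * Real.exp (-g 0),
    (g 1 * g 5 - g 3) * Real.exp (g 0),
    -g 4 * Real.exp (-g 0),
    -g 5 * Real.exp (g 0)]

instance : Group G where
  mul := gmul
  one := (0 : E)
  inv := ginv
  mul_assoc f g h := by
    change gmul (gmul f g) h = gmul f (gmul g h)
    ext i
    fin_cases i <;> simp [gmul, Real.exp_add] <;> ring
  one_mul g := by
    change gmul 0 g = g
    ext i
    fin_cases i <;> simp [gmul]
  mul_one g := by
    change gmul g 0 = g
    ext i
    fin_cases i <;> simp [gmul]
  inv_mul_cancel g := by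
    change gmul (ginv g) g = 0
    ext i
    fin_cases i <;> simp [gmul, ginv] <;> ring

/-- The coordinates of an element of `G`. -/
def G.coords (g : G) : E := g

/-- The left translation `x ↦ γ * x` of `G`, in coordinates. -/
def leftTrans (γ : G) : E → E := gmul γ.coords

/-- The realization of `G` as a group of real matrices. -/
def toMatrix (g : E) : Matrix (Fin 6) (Fin 6) ℝ :=
  !![Real.exp (g 0), 0, g 1 * Real.exp (g 0), 0, 0, g 2;
     0, Real.exp (-g 0), 0, g 1 * Real.exp (-g 0), 0, g 3;
     0, 0, Real.exp (g 0), 0, 0, g 4;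
     0, 0, 0, Real.exp (-g 0), 0, g 5;
     0, 0, 0, 0, 1, g 0;
     0, 0, 0, 0, 0, 1]

theorem toMatrix_gmul (g h : E) : toMatrix (gmul g h) = toMatrix g * toMatrix h := by
  ext i j
  fin_cases i <;> fin_cases j <;>
    simp [toMatrix, gmul, Matrix.mul_apply, Fin.sum_univ_succ, Real.exp_add] <;> ring

/-! ### The lattice -/

/-- The data defining the lattice: `B ∈ SL(2, ℤ)` with distinct eigenvalues `e^{a₀}, e^{-a₀}`,
and a real invertible matrix `P` that diagonalizes it. -/
structure LatticeData where
  a₀ : ℝ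
  B : Matrix.SpecialLinearGroup (Fin 2) ℤ
  P : GL (Fin 2) ℝ
  a₀_ne_zero : a₀ ≠ 0
  conj_eq : (P : Matrix (Fin 2) (Fin 2) ℝ) * (B : Matrix (Fin 2) (Fin 2) ℤ).map (fun z => (z : ℝ))
    * ((P⁻¹ : GL (Fin 2) ℝ) : Matrix (Fin 2) (Fin 2) ℝ)
      = !![Real.exp a₀, 0; 0, Real.exp (-a₀)]

/-- The vector `P m` of the planar lattice `P ℤ²`. -/
def LatticeData.vec (D : LatticeData) (m : Fin 2 → ℤ) : Fin 2 → ℝ :=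
  (D.P : Matrix (Fin 2) (Fin 2) ℝ).mulVec (fun i => (m i : ℝ))

theorem LatticeData.P_mul_B (D : LatticeData) :
    (D.P : Matrix (Fin 2) (Fin 2) ℝ) * (D.B : Matrix (Fin 2) (Fin 2) ℤ).map (fun z => (z : ℝ))
      = !![Real.exp D.a₀, 0; 0, Real.exp (-D.a₀)] * (D.P : Matrix (Fin 2) (Fin 2) ℝ) := by
  rw [← D.conj_eq, Matrix.mul_assoc, ← Units.val_mul, inv_mul_cancel, Units.val_one,
    Matrix.mul_one]

theorem LatticeData.vec_mulVec (D : LatticeData) (m : Fin 2 → ℤ) :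
    D.vec ((D.B : Matrix (Fin 2) (Fin 2) ℤ).mulVec m)
      = ![Real.exp D.a₀ * D.vec m 0, Real.exp (-D.a₀) * D.vec m 1] := by
  have h : (fun i => (((D.B : Matrix (Fin 2) (Fin 2) ℤ).mulVec m i : ℤ) : ℝ))
      = ((D.B : Matrix (Fin 2) (Fin 2) ℤ).map (fun z => (z : ℝ))).mulVec (fun i => (m i : ℝ)) := by
    ext i
    simp [Matrix.mulVec, dotProduct]
  unfold LatticeData.vec
  rw [h, Matrix.mulVec_mulVec, D.P_mul_B, ← Matrix.mulVec_mulVec]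
  ext i
  fin_cases i <;> simp [Matrix.mulVec, dotProduct, Fin.sum_univ_succ]

theorem LatticeData.exists_vec_zpow (D : LatticeData) (k : ℤ) (m : Fin 2 → ℤ) :
    ∃ m' : Fin 2 → ℤ, D.vec m'
      = ![Real.exp (D.a₀ * k) * D.vec m 0, Real.exp (-(D.a₀ * k)) * D.vec m 1] := by
  induction k using Int.induction_on generalizing m with
  | zero =>
    refine ⟨m, ?_⟩
    ext i
    fin_cases i <;> simp
  | succ k ih =>
    obtain ⟨m', h⟩ := ih m
    refine ⟨_, (D.vec_mulVec m').trans ?_⟩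
    rw [h]
    ext i
    fin_cases i <;> simp [mul_add, Real.exp_add] <;> ring
  | pred k ih =>
    obtain ⟨m', h⟩ := ih m
    refine ⟨((D.B⁻¹ : Matrix.SpecialLinearGroup (Fin 2) ℤ) : Matrix (Fin 2) (Fin 2) ℤ).mulVec m',
      ?_⟩
    have h2 := D.vec_mulVec
      (((D.B⁻¹ : Matrix.SpecialLinearGroup (Fin 2) ℤ) : Matrix (Fin 2) (Fin 2) ℤ).mulVec m')
    rw [Matrix.mulVec_mulVec, ← Matrix.SpecialLinearGroup.coe_mul, mul_inv_cancel,
      Matrix.SpecialLinearGroup.coe_one, Matrix.one_mulVec, h] at h2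
    have h0 := congrFun h2 0
    have h1 := congrFun h2 1
    simp only [Matrix.cons_val_zero, Matrix.cons_val_one] at h0 h1
    ext i
    fin_cases i
    · simp only [Fin.zero_eta, Matrix.cons_val_zero]
      have : Real.exp (D.a₀ * ((-(k : ℤ) - 1 : ℤ) : ℝ))
          = Real.exp (-D.a₀) * Real.exp (D.a₀ * ((-(k : ℤ) : ℤ) : ℝ)) := by
        rw [← Real.exp_add]; congr 1; push_cast; ring
      rw [this, mul_assoc, h0, ← mul_assoc, ← Real.exp_add]
      simp
    · simp only [Fin.mk_one, Matrix.cons_val_one, Matrix.cons_val_zero]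
      have : Real.exp (-(D.a₀ * ((-(k : ℤ) - 1 : ℤ) : ℝ)))
          = Real.exp (D.a₀) * Real.exp (-(D.a₀ * ((-(k : ℤ) : ℤ) : ℝ))) := by
        rw [← Real.exp_add]; congr 1; push_cast; ring
      rw [this, mul_assoc, h1, ← mul_assoc, ← Real.exp_add]
      simp

theorem LatticeData.vec_add (D : LatticeData) (m n : Fin 2 → ℤ) :
    D.vec (m + n) = D.vec m + D.vec n := by
  unfold LatticeData.vec
  rw [← Matrix.mulVec_add]
  congr 1
  ext i
  simp

theorem LatticeData.vec_smul (D : LatticeData) (u : ℤ) (n : Fin 2 → ℤ) :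
    D.vec (u • n) = (u : ℝ) • D.vec n := by
  unfold LatticeData.vec
  rw [← Matrix.mulVec_smul]
  congr 1
  ext i
  simp

/-- The points of `Γ = (a₀ℤ × ℤ) ⋉ (Pℤ² × Pℤ²)`. -/
def LatticeData.IsLatticePoint (D : LatticeData) (g : E) : Prop :=
  ∃ (k u : ℤ) (m n : Fin 2 → ℤ), g 0 = D.a₀ * k ∧ g 1 = u ∧
    ![g 2, g 3] = D.vec m ∧ ![g 4, g 5] = D.vec n

/-- The lattice `Γ` of `G`. -/
def LatticeData.lattice (D : LatticeData) : Subgroup G where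
  carrier := {g | D.IsLatticePoint g}
  one_mem' := by
    refine ⟨0, 0, 0, 0, ?_, ?_, ?_, ?_⟩
    · change (0 : E) 0 = _; simp
    · change (0 : E) 1 = _; simp
    · change ![(0 : E) 2, (0 : E) 3] = _
      ext i; fin_cases i <;> simp [LatticeData.vec, Matrix.mulVec, dotProduct]
    · change ![(0 : E) 4, (0 : E) 5] = _
      ext i; fin_cases i <;> simp [LatticeData.vec, Matrix.mulVec, dotProduct]
  mul_mem' := by
    rintro g h ⟨k, u, m, n, h0, h1, hm, hn⟩ ⟨k', u', m', n', h0', h1', hm', hn'⟩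
    obtain ⟨p, hp⟩ := D.exists_vec_zpow k m'
    obtain ⟨q, hq⟩ := D.exists_vec_zpow k n'
    change D.IsLatticePoint (gmul g h)
    refine ⟨k + k', u + u', p + u • q + m, q + n, ?_, ?_, ?_, ?_⟩
    · simp [gmul, h0, h0', mul_add]
    · simp [gmul, h1, h1']
    · rw [D.vec_add, D.vec_add, D.vec_smul, hp, hq, ← hm, ← hm', ← hn']
      ext i
      fin_cases i <;> simp [gmul, h0, h1] <;> ring
    · rw [D.vec_add, hq, ← hn, ← hn']
      ext i
      fin_cases i <;> simp [gmul, h0] <;> ring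
  inv_mem' := by
    rintro g ⟨k, u, m, n, h0, h1, hm, hn⟩
    obtain ⟨p, hp⟩ := D.exists_vec_zpow (-k) m
    obtain ⟨q, hq⟩ := D.exists_vec_zpow (-k) n
    change D.IsLatticePoint (ginv g)
    refine ⟨-k, -u, u • q + (-1 : ℤ) • p, (-1 : ℤ) • q, ?_, ?_, ?_, ?_⟩
    · simp [ginv, h0]
    · simp [ginv, h1]
    · rw [D.vec_add, D.vec_smul, D.vec_smul, hp, hq, ← hm, ← hn]
      ext i
      fin_cases i <;> simp [ginv, h0, h1] <;> ring
    · rw [D.vec_smul, hq, ← hn]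
      ext i
      fin_cases i <;> simp [ginv, h0] <;> ring

/-- A fundamental domain for the left translations by `Γ`. -/
def LatticeData.fundDomain (D : LatticeData) : Set E :=
  {g | ∃ s : Fin 6 → ℝ, (∀ i, s i ∈ Set.Ico (0 : ℝ) 1) ∧ g 0 = D.a₀ * s 0 ∧ g 1 = s 1 ∧
    ![g 2, g 3] = (D.P : Matrix (Fin 2) (Fin 2) ℝ).mulVec ![s 2, s 3] ∧
    ![g 4, g 5] = (D.P : Matrix (Fin 2) (Fin 2) ℝ).mulVec ![s 4, s 5]}

theorem LatticeData.existsUnique_planar (D : LatticeData) (y : Fin 2 → ℝ) :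
    ∃! m : Fin 2 → ℤ, ∃ s : Fin 2 → ℝ, (∀ i, s i ∈ Set.Ico (0 : ℝ) 1) ∧
      D.vec m + y = (D.P : Matrix (Fin 2) (Fin 2) ℝ).mulVec s := by
  have hinv : ((D.P⁻¹ : GL (Fin 2) ℝ) : Matrix (Fin 2) (Fin 2) ℝ)
      * (D.P : Matrix (Fin 2) (Fin 2) ℝ) = 1 := by
    rw [← Units.val_mul, inv_mul_cancel, Units.val_one]
  have hinv' : (D.P : Matrix (Fin 2) (Fin 2) ℝ)
      * ((D.P⁻¹ : GL (Fin 2) ℝ) : Matrix (Fin 2) (Fin 2) ℝ) = 1 := by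
    rw [← Units.val_mul, mul_inv_cancel, Units.val_one]
  set w : Fin 2 → ℝ := ((D.P⁻¹ : GL (Fin 2) ℝ) : Matrix (Fin 2) (Fin 2) ℝ).mulVec y with hw
  have hy : y = (D.P : Matrix (Fin 2) (Fin 2) ℝ).mulVec w := by
    rw [hw, Matrix.mulVec_mulVec, hinv', Matrix.one_mulVec]
  refine ⟨fun i => -⌊w i⌋, ⟨fun i => Int.fract (w i), ?_, ?_⟩, ?_⟩
  · exact fun i => ⟨Int.fract_nonneg _, Int.fract_lt_one _⟩
  · rw [hy]
    unfold LatticeData.vec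
    rw [← Matrix.mulVec_add]
    congr 1
    ext i
    simp only [Pi.add_apply, Int.cast_neg, Int.fract]
    ring
  · rintro m ⟨s, hs, h⟩
    rw [hy] at h
    unfold LatticeData.vec at h
    rw [← Matrix.mulVec_add] at h
    have h2 := congrArg
      (((D.P⁻¹ : GL (Fin 2) ℝ) : Matrix (Fin 2) (Fin 2) ℝ).mulVec) h
    rw [Matrix.mulVec_mulVec, Matrix.mulVec_mulVec, hinv, Matrix.one_mulVec,
      Matrix.one_mulVec] at h2
    ext i
    have h3 := congrFun h2 i
    simp only [Pi.add_apply] at h3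
    have h4 : ⌊w i⌋ = -m i := by
      rw [Int.floor_eq_iff]
      push_cast
      constructor
      · linarith [(hs i).1]
      · linarith [(hs i).2]
    simp [h4]

/-- Every `Γ`-orbit meets `fundDomain` in exactly one point, for exactly one element of `Γ`; so an
integral over `fundDomain` of a `Γ`-invariant density is the integral over `X`. -/
theorem LatticeData.existsUnique_mem_fundDomain (D : LatticeData) (g : G) :
    ∃! γ : G, γ ∈ D.lattice ∧ (γ * g : G) ∈ D.fundDomain := by
  obtain ⟨a₀, ha₀⟩ : ∃ a₀, a₀ = D.a₀ := ⟨_, rfl⟩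
  have hne : a₀ ≠ 0 := ha₀ ▸ D.a₀_ne_zero
  obtain ⟨x, hx⟩ : ∃ x : E, x = g := ⟨g, rfl⟩
  set k : ℤ := -⌊x 0 / a₀⌋ with hk
  set u : ℤ := -⌊x 1⌋ with hu
  obtain ⟨m, ⟨s, hs, hm⟩, hm'⟩ := D.existsUnique_planar
    ![x 2 * Real.exp (a₀ * k) + u * x 4 * Real.exp (a₀ * k),
      x 3 * Real.exp (-(a₀ * k)) + u * x 5 * Real.exp (-(a₀ * k))]
  obtain ⟨n, ⟨r, hr, hn⟩, hn'⟩ := D.existsUnique_planar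
    ![x 4 * Real.exp (a₀ * k), x 5 * Real.exp (-(a₀ * k))]
  have eta : ∀ v : Fin 2 → ℝ, ![v 0, v 1] = v := fun v => by
    ext i; fin_cases i <;> rfl
  refine ⟨(![a₀ * k, u, D.vec m 0, D.vec m 1, D.vec n 0, D.vec n 1] : E), ⟨?_, ?_⟩, ?_⟩
  · exact ⟨k, u, m, n, by simp [ha₀], by simp, by ext i; fin_cases i <;> simp,
      by ext i; fin_cases i <;> simp⟩
  · change gmul _ g ∈ D.fundDomain
    rw [← hx]
    refine ⟨![Int.fract (x 0 / a₀), Int.fract (x 1), s 0, s 1, r 0, r 1], ?_, ?_, ?_, ?_, ?_⟩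
    · intro i
      fin_cases i
      · exact ⟨Int.fract_nonneg _, Int.fract_lt_one _⟩
      · exact ⟨Int.fract_nonneg _, Int.fract_lt_one _⟩
      · exact hs 0
      · exact hs 1
      · exact hr 0
      · exact hr 1
    · simp only [gmul, Matrix.cons_val_zero, hk, ← ha₀, Int.fract]
      push_cast
      field_simp
      ring
    · simp only [gmul, Matrix.cons_val_one, Matrix.cons_val_zero, hu, Int.fract]
      push_cast
      ring
    · have : ![(![Int.fract (x 0 / a₀), Int.fract (x 1), s 0, s 1, r 0, r 1] : E) 2,
          (![Int.fract (x 0 / a₀), Int.fract (x 1), s 0, s 1, r 0, r 1] : E) 3] = s := eta s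
      rw [this, ← hm]
      ext i
      fin_cases i <;> simp [gmul] <;> ring
    · have : ![(![Int.fract (x 0 / a₀), Int.fract (x 1), s 0, s 1, r 0, r 1] : E) 4,
          (![Int.fract (x 0 / a₀), Int.fract (x 1), s 0, s 1, r 0, r 1] : E) 5] = r := eta r
      rw [this, ← hn]
      ext i
      fin_cases i <;> simp [gmul] <;> ring
  · rintro γ ⟨⟨k₁, u₁, m₁, n₁, h0, h1, h2, h3⟩, ⟨w, hw, w0, w1, w2, w3⟩⟩
    obtain ⟨y, hy⟩ : ∃ y : E, y = γ := ⟨γ, rfl⟩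
    have hmul : (γ * g : G) = gmul y x := by rw [hy, hx]; rfl
    rw [hmul] at w0 w1 w2 w3
    rw [← hy] at h0 h1 h2 h3 ⊢
    have hk₁ : k₁ = k := by
      have : ⌊x 0 / a₀⌋ = -k₁ := by
        have e : x 0 / a₀ = w 0 - k₁ := by
          simp only [gmul, Matrix.cons_val_zero] at w0
          rw [h0, ← ha₀] at w0
          field_simp
          linarith
        rw [Int.floor_eq_iff]
        push_cast
        constructor <;> linarith [(hw 0).1, (hw 0).2]
      rw [hk, this, neg_neg]
    have hu₁ : u₁ = u := by
      have : ⌊x 1⌋ = -u₁ := by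
        simp only [gmul, Matrix.cons_val_zero, Matrix.cons_val_one] at w1
        rw [Int.floor_eq_iff]
        push_cast
        constructor <;> linarith [(hw 1).1, (hw 1).2]
      rw [hu, this, neg_neg]
    subst hk₁ hu₁
    have hm₁ : m₁ = m := by
      apply hm'
      refine ⟨![w 2, w 3], ?_, ?_⟩
      · intro i
        fin_cases i
        · exact hw 2
        · exact hw 3
      · rw [← w2, ← h2]
        ext i
        fin_cases i <;> simp [gmul, h0, h1, ha₀] <;> ring
    have hn₁ : n₁ = n := by
      apply hn'
      refine ⟨![w 4, w 5], ?_, ?_⟩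
      · intro i
        fin_cases i
        · exact hw 4
        · exact hw 5
      · rw [← w3, ← h3]
        ext i
        fin_cases i <;> simp [gmul, h0, ha₀] <;> ring
    subst hm₁ hn₁
    rw [← h2, ← h3]
    refine @funext (Fin 6) (fun _ => ℝ) y _ fun i => ?_
    fin_cases i <;> simp [h0, h1, ha₀]

/-! ### The left-invariant frame and the almost-Kähler structure -/

/-- The left-invariant coframe `e¹, …, e⁶` at the point `x` of `G`. -/
def coframe (x : E) : Fin 6 → (E →L[ℝ] ℝ) :=
  let d : Fin 6 → (E →L[ℝ] ℝ) := fun i => ContinuousLinearMap.proj i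
  ![d 0, d 1,
    Real.exp (-x 0) • d 2 - (x 1 * Real.exp (-x 0)) • d 4,
    Real.exp (x 0) • d 3 - (x 1 * Real.exp (x 0)) • d 5,
    Real.exp (-x 0) • d 4,
    Real.exp (x 0) • d 5]

/-- The dual left-invariant frame `e₁, …, e₆` at the point `x` of `G`. -/
def frame (x : E) : Fin 6 → E :=
  ![![1, 0, 0, 0, 0, 0],
    ![0, 1, 0, 0, 0, 0],
    ![0, 0, Real.exp (x 0), 0, 0, 0],
    ![0, 0, 0, Real.exp (-x 0), 0, 0],
    ![0, 0, x 1 * Real.exp (x 0), 0, Real.exp (x 0), 0],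
    ![0, 0, 0, x 1 * Real.exp (-x 0), 0, Real.exp (-x 0)]]

theorem coframe_frame (x : E) (i j : Fin 6) :
    coframe x i (frame x j) = if i = j then 1 else 0 := by
  fin_cases i <;> fin_cases j <;>
    simp [coframe, frame, Real.exp_neg] <;> field_simp <;> simp

/-- The almost-complex structure `J_{a,b,c}` at `x`: `J e₁ = a e₂`, `J e₂ = -a⁻¹ e₁`, `J e₃ = c e₆`,
`J e₄ = c e₅ - b e₃`, `J e₅ = -c⁻¹ e₄ + b e₆`, `J e₆ = -c⁻¹ e₃`. -/
def J (a b c : ℝ) (x : E) : E →L[ℝ] E :=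
  ∑ i, (coframe x i).smulRight
    ((![a • frame x 1,
      -(1 / a) • frame x 0,
      c • frame x 5,
      c • frame x 4 - b • frame x 2,
      -(1 / c) • frame x 3 + b • frame x 5,
      -(1 / c) • frame x 2] : Fin 6 → E) i)

/-- `e^{ij} = eⁱ ∧ eʲ` at `x`. -/
def wedge₂ (x : E) (i j : Fin 6) (v w : E) : ℝ :=
  coframe x i v * coframe x j w - coframe x j v * coframe x i w

/-- The symplectic form `ω_{a,b,c} = a e¹² + b e⁵⁶ + c (e³⁶ + e⁴⁵)`. -/
def omega (a b c : ℝ) (x v w : E) : ℝ :=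
  a * wedge₂ x 0 1 v w + b * wedge₂ x 4 5 v w + c * (wedge₂ x 2 5 v w + wedge₂ x 3 4 v w)

/-- The Riemannian metric `g(v, w) = ω(v, J w)`. -/
def metric (a b c : ℝ) (x v w : E) : ℝ := omega a b c x v (J a b c x w)

theorem J_frame (a b c : ℝ) (x : E) (j : Fin 6) :
    J a b c x (frame x j) = (![a • frame x 1,
      -(1 / a) • frame x 0,
      c • frame x 5,
      c • frame x 4 - b • frame x 2,
      -(1 / c) • frame x 3 + b • frame x 5,
      -(1 / c) • frame x 2] : Fin 6 → E) j := by
  simp only [J, sum_apply, ContinuousLinearMap.smulRight_apply, coframe_frame,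
    ite_smul, one_smul, zero_smul, Finset.sum_ite_eq', Finset.mem_univ, if_true]

theorem sum_coframe_smul_frame (x v : E) : ∑ i, coframe x i v • frame x i = v := by
  ext i
  fin_cases i <;>
    simp [Fin.sum_univ_succ, coframe, frame, Real.exp_neg] <;> field_simp <;> ring

theorem J_J {a b c : ℝ} (ha : a ≠ 0) (hc : c ≠ 0) (x v : E) :
    J a b c x (J a b c x v) = -v := by
  have key : ∀ j, J a b c x (J a b c x (frame x j)) = -frame x j := by
    intro j
    rw [J_frame]
    fin_cases j <;> simp [J_frame, smul_smul, smul_sub, ha, hc]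
    all_goals abel_nf
    all_goals simp [mul_comm]
  conv_lhs => rw [← sum_coframe_smul_frame x v]
  conv_rhs => rw [← sum_coframe_smul_frame x v]
  simp only [map_sum, map_smul, key, smul_neg, Finset.sum_neg_distrib]

/-- A `g`-orthonormal left-invariant frame at `x`. -/
def orthoFrame (a b c : ℝ) (x : E) : Fin 6 → E :=
  ![(1 / a) • frame x 0, frame x 1, (1 / c) • frame x 2, (1 / c) • frame x 3,
    frame x 4 - (b / c) • frame x 2, frame x 5]

theorem metric_orthoFrame {a b c : ℝ} (ha : a ≠ 0) (hc : c ≠ 0) (x : E) (i j : Fin 6) :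
    metric a b c x (orthoFrame a b c x i) (orthoFrame a b c x j) = if i = j then 1 else 0 := by
  fin_cases i <;> fin_cases j <;>
    simp [metric, omega, wedge₂, orthoFrame, J_frame, coframe_frame, ha, hc]
  all_goals field_simp
  all_goals ring

/-! ### Differential forms on `X = Γ \ G` and their bigrading -/

/-- Complex-valued `k`-forms on `G` (no regularity required yet). -/
abbrev Form (k : ℕ) : Type := E → E [⋀^Fin k]→L[ℝ] ℂ

/-- For a complex structure `J` on the vector space `E`, the space `Λ^{p,q}` of complex-valued
`k`-covectors: the span of the `φ¹ ∧ ⋯ ∧ φᵏ` with `φ¹, …, φᵖ` of type `(1,0)` and the other `q`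
factors of type `(0,1)`. It is zero if `p + q ≠ k`. -/
def bigraded (J : E →L[ℝ] E) (k p q : ℕ) : Submodule ℂ (E [⋀^Fin k]→L[ℝ] ℂ) :=
  Submodule.span ℂ {α | p + q = k ∧ ∃ φ : Fin k → (E →L[ℝ] ℂ),
    (∀ i : Fin k, (i : ℕ) < p → ∀ v, φ i (J v) = Complex.I * φ i v) ∧
    (∀ i : Fin k, p ≤ (i : ℕ) → ∀ v, φ i (J v) = -Complex.I * φ i v) ∧
    ∀ v, α v = Matrix.det (Matrix.of fun i j => φ i (v j))}

/-- `A^{p,q}(X)`: the smooth `Γ`-invariant complex-valued forms on `G` of type `(p,q)` for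
`J_{a,b,c}`. Pull-back along the covering `G → X = Γ \ G` identifies forms on `X` with these. -/
def forms (D : LatticeData) (a b c : ℝ) (p q : ℕ) : Submodule ℂ (Form (p + q)) where
  carrier := {ψ | ContDiff ℝ ∞ ψ ∧
    (∀ γ ∈ D.lattice, ∀ x : E,
      (ψ (leftTrans γ x)).compContinuousLinearMap (fderiv ℝ (leftTrans γ) x) = ψ x) ∧
    ∀ x, ψ x ∈ bigraded (J a b c x) (p + q) p q}
  zero_mem' := ⟨contDiff_const, fun _ _ _ => by ext; simp, fun _ => Submodule.zero_mem _⟩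
  add_mem' := by
    rintro α β ⟨h1, h2, h3⟩ ⟨h1', h2', h3'⟩
    refine ⟨h1.add h1', fun γ hγ x => ?_, fun x => Submodule.add_mem _ (h3 x) (h3' x)⟩
    exact congrArg₂ (· + ·) (h2 γ hγ x) (h2' γ hγ x)
  smul_mem' := by
    rintro r α ⟨h1, h2, h3⟩
    refine ⟨h1.const_smul r, fun γ hγ x => ?_, fun x => Submodule.smul_mem _ _ (h3 x)⟩
    exact congrArg (r • ·) (h2 γ hγ x)

/-- The projection of `k`-covectors, `k = p + q`, onto the component of type `(p,q)`. The rotation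
`cos θ + sin θ J` acts on the component of type `(r,s)` by `e^{i(r-s)θ}`, so that the average below
over `θ = πj/(k+1)`, `0 ≤ j ≤ k`, singles out the type `(p,q)`; see `typeProj_of_mem`
and `typeProj_of_mem_ne`. -/
def typeProj (J : E →L[ℝ] E) {k : ℕ} (p q : ℕ) (α : E [⋀^Fin k]→L[ℝ] ℂ) : E [⋀^Fin k]→L[ℝ] ℂ :=
  (1 / ((k : ℂ) + 1)) • ∑ j ∈ Finset.range (k + 1),
    Complex.exp (-(((p : ℂ) - q) * (Real.pi * j / (k + 1) : ℝ) * Complex.I)) •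
      α.compContinuousLinearMap
        (Real.cos (Real.pi * j / (k + 1)) • ContinuousLinearMap.id ℝ E
          + Real.sin (Real.pi * j / (k + 1)) • J)

theorem typeProj_add (J : E →L[ℝ] E) {k : ℕ} (p q : ℕ) (α β : E [⋀^Fin k]→L[ℝ] ℂ) :
    typeProj J p q (α + β) = typeProj J p q α + typeProj J p q β := by
  ext v
  simp only [typeProj, ContinuousAlternatingMap.smul_apply, ContinuousAlternatingMap.sum_apply,
    ContinuousAlternatingMap.add_apply, ContinuousAlternatingMap.compContinuousLinearMap_apply,
    smul_eq_mul, mul_add, Finset.sum_add_distrib]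

theorem typeProj_smul (J : E →L[ℝ] E) {k : ℕ} (p q : ℕ) (r : ℂ) (α : E [⋀^Fin k]→L[ℝ] ℂ) :
    typeProj J p q (r • α) = r • typeProj J p q α := by
  ext v
  simp only [typeProj, ContinuousAlternatingMap.smul_apply, ContinuousAlternatingMap.sum_apply,
    ContinuousAlternatingMap.compContinuousLinearMap_apply, smul_eq_mul, Finset.mul_sum]
  refine Finset.sum_congr rfl fun j _ => ?_
  ring

theorem rotation_apply {J : E →L[ℝ] E} {k r s : ℕ} {α : E [⋀^Fin k]→L[ℝ] ℂ}
    (hα : α ∈ bigraded J k r s) (θ : ℝ) :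
    α.compContinuousLinearMap (Real.cos θ • ContinuousLinearMap.id ℝ E + Real.sin θ • J)
      = Complex.exp (((r : ℂ) - s) * θ * Complex.I) • α := by
  induction hα using Submodule.span_induction with
  | mem α h =>
    obtain ⟨hk, φ, h10, h01, hdet⟩ := h
    ext v
    rw [ContinuousAlternatingMap.compContinuousLinearMap_apply, ContinuousAlternatingMap.smul_apply,
      hdet, hdet]
    have hrow : (Matrix.of fun i j => φ i (((Real.cos θ • ContinuousLinearMap.id ℝ E
        + Real.sin θ • J) ∘ v) j)) = Matrix.of fun (i j : Fin k) =>
          (if (i : ℕ) < r then Complex.exp (θ * Complex.I) else Complex.exp (-(θ * Complex.I)))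
            * (Matrix.of fun (i j : Fin k) => φ i (v j)) i j := by
      ext i j
      simp only [Matrix.of_apply, Function.comp_apply, add_apply,
        smul_apply, ContinuousLinearMap.id_apply, map_add, map_smul,
        Complex.real_smul, Complex.ofReal_cos, Complex.ofReal_sin]
      split_ifs with h
      · rw [h10 i h, Complex.exp_mul_I]; ring
      · rw [h01 i (not_lt.mp h), ← neg_mul, Complex.exp_mul_I, Complex.cos_neg, Complex.sin_neg]
        ring
    rw [hrow, Matrix.det_mul_column, smul_eq_mul]
    congr 1
    subst hk
    rw [Fin.prod_univ_add]
    simp only [Fin.val_castAdd, Fin.is_lt, if_true, Fin.val_natAdd, Finset.prod_const,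
      Finset.card_univ, Fintype.card_fin, ← Complex.exp_nat_mul,
      show ∀ x : ℕ, ¬ (r + x < r) from fun x => by omega, if_false, ← Complex.exp_add]
    congr 1
    ring
  | zero => ext; simp
  | add x y _ _ hx hy => rw [smul_add, ← hx, ← hy]; rfl
  | smul t x _ hx => rw [smul_comm, ← hx]; rfl

/-- `typeProj` is the identity on `Λ^{p,q}`. -/
theorem typeProj_of_mem {J : E →L[ℝ] E} {k p q : ℕ} {α : E [⋀^Fin k]→L[ℝ] ℂ}
    (hα : α ∈ bigraded J k p q) : typeProj J p q α = α := by
  unfold typeProj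
  simp only [rotation_apply hα, smul_smul, ← Complex.exp_add]
  simp only [neg_add_cancel, Complex.exp_zero, one_smul, Finset.sum_const, Finset.card_range]
  rw [← Nat.cast_smul_eq_nsmul ℂ, smul_smul]
  have : ((k : ℂ) + 1) ≠ 0 := Nat.cast_add_one_ne_zero k
  push_cast
  rw [one_div, inv_mul_cancel₀ this, one_smul]

/-- `typeProj` annihilates the other summands of the bigrading. -/
theorem typeProj_of_mem_ne {J : E →L[ℝ] E} {k p q r s : ℕ} {α : E [⋀^Fin k]→L[ℝ] ℂ}
    (hpq : p + q = k) (hrs : r + s = k) (hne : r ≠ p)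
    (hα : α ∈ bigraded J k r s) : typeProj J p q α = 0 := by
  unfold typeProj
  simp only [rotation_apply hα, smul_smul, ← Complex.exp_add]
  rw [← Finset.sum_smul]
  have hk : ((k : ℂ) + 1) ≠ 0 := Nat.cast_add_one_ne_zero k
  set z : ℂ := Complex.exp (2 * Real.pi * Complex.I * (((r : ℂ) - p) / (k + 1))) with hz
  have hterm : ∀ j ∈ Finset.range (k + 1),
      Complex.exp (-(((p : ℂ) - q) * (Real.pi * j / (k + 1) : ℝ) * Complex.I)
        + ((r : ℂ) - s) * (Real.pi * j / (k + 1) : ℝ) * Complex.I) = z ^ j := by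
    intro j _
    rw [hz, ← Complex.exp_nat_mul]
    congr 1
    have e1 : (q : ℂ) = k - p := by rw [← hpq]; push_cast; ring
    have e2 : (s : ℂ) = k - r := by rw [← hrs]; push_cast; ring
    rw [e1, e2]
    push_cast
    field_simp
    ring
  rw [Finset.sum_congr rfl hterm]
  have hz1 : z ≠ 1 := by
    intro h
    rw [hz, Complex.exp_eq_one_iff] at h
    obtain ⟨n, hn⟩ := h
    have hpi : (2 * Real.pi * Complex.I : ℂ) ≠ 0 := Complex.two_pi_I_ne_zero
    have h1 : (((r : ℂ) - p) / (k + 1)) = n := by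
      apply mul_left_cancel₀ hpi
      rw [hn]; ring
    rw [div_eq_iff hk] at h1
    have h2 : ((r : ℤ) - p) = n * (k + 1) := by exact_mod_cast h1
    have h3 : |((r : ℤ) - p)| < k + 1 := by
      rw [abs_lt]; omega
    rw [h2, abs_mul] at h3
    have h4 : |(k : ℤ) + 1| = k + 1 := abs_of_nonneg (by omega)
    rw [h4] at h3
    have h5 : |n| < 1 := by
      by_contra hcon
      push Not at hcon
      nlinarith
    have h6 : n = 0 := Int.abs_lt_one_iff.mp h5
    rw [h6] at h2
    omega
  have hzk : z ^ (k + 1) = 1 := by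
    rw [hz, ← Complex.exp_nat_mul, Complex.exp_eq_one_iff]
    refine ⟨(r : ℤ) - p, ?_⟩
    push_cast
    field_simp
  have hsum : ∑ j ∈ Finset.range (k + 1), z ^ j = 0 := by
    rw [geom_sum_eq hz1, hzk]; simp
  rw [hsum, zero_smul, smul_zero]

/-- `∂̄ : A^{p,q} → A^{p,q+1}`, the component of type `(p, q+1)` of the exterior derivative. -/
def dbar (a b c : ℝ) (p q : ℕ) (ψ : Form (p + q)) : Form (p + (q + 1)) :=
  fun x => typeProj (J a b c x) p (q + 1) (extDeriv ψ x)

/-! ### The `L²` product, the Laplacian `Δ_∂̄` and the Hodge numbers -/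

/-- The Hermitian product induced by `g` on complex-valued `k`-covectors at `x`:
`∑_{i₁ < ⋯ < i_k} α(u_{i₁}, …, u_{i_k}) · conj β(u_{i₁}, …, u_{i_k})` for a `g`-orthonormal
frame `u`. -/
def hermProd (a b c : ℝ) (x : E) {k : ℕ} (α β : E [⋀^Fin k]→L[ℝ] ℂ) : ℂ :=
  (1 / (k.factorial : ℂ)) * ∑ I : Fin k → Fin 6,
    α (fun i => orthoFrame a b c x (I i)) *
      (starRingEnd ℂ) (β (fun i => orthoFrame a b c x (I i)))

/-- The density of the Riemannian volume of `g` with respect to Lebesgue measure in coordinates. -/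
def volDensity (a b c : ℝ) (x : E) : ℝ :=
  Real.sqrt (Matrix.det (Matrix.of fun i j : Fin 6 =>
    metric a b c x (Pi.single i 1) (Pi.single j 1)))

/-- The `L²` Hermitian product of forms on `X`. -/
def l2Prod (D : LatticeData) (a b c : ℝ) {k : ℕ} (α β : Form k) : ℂ :=
  ∫ x in D.fundDomain, hermProd a b c x (α x) (β x) * (volDensity a b c x : ℂ)

/-- `ξ = ∂̄* η` for a form `η` of type `(p, q+1)`: `ξ` is the form of type `(p,q)` with
`⟨∂̄β, η⟩ = ⟨β, ξ⟩` for every `β ∈ A^{p,q}(X)`. -/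
def IsDbarStar (D : LatticeData) (a b c : ℝ) (p q : ℕ)
    (η : Form (p + (q + 1))) (ξ : Form (p + q)) : Prop :=
  ξ ∈ forms D a b c p q ∧
    ∀ β ∈ forms D a b c p q, l2Prod D a b c (dbar a b c p q β) η = l2Prod D a b c β ξ

/-- `θ = Δ_∂̄ ψ = ∂̄ ∂̄* ψ + ∂̄* ∂̄ ψ` for `ψ ∈ A^{p,q}(X)`. For `q = 0` the first term is absent,
since `∂̄* ψ` lies in `A^{p,-1}(X) = 0`. -/
def IsLaplacian (D : LatticeData) (a b c : ℝ) (p : ℕ) :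
    (q : ℕ) → Form (p + q) → Form (p + q) → Prop
  | 0, ψ, θ => IsDbarStar D a b c p 0 (dbar a b c p 0 ψ) θ
  | q + 1, ψ, θ => ∃ (ξ : Form (p + q)) (ζ : Form (p + (q + 1))),
      IsDbarStar D a b c p q ψ ξ ∧ IsDbarStar D a b c p (q + 1) (dbar a b c p (q + 1) ψ) ζ ∧
        θ = dbar a b c p q ξ + ζ

/-- Auxiliary: continuity of all the coefficients of a form. -/
def EvalCont {k : ℕ} (α : Form k) : Prop :=
  ∀ v : Fin k → E → E, (∀ i, Continuous (v i)) → Continuous fun x => α x (fun i => v i x)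

theorem EvalCont.of_continuous {k : ℕ} {α : Form k} (h : Continuous α) : EvalCont α :=
  fun _ hv => h.eval (continuous_pi hv)

theorem continuous_frame (i : Fin 6) : Continuous fun x => frame x i := by
  refine continuous_pi fun j => ?_
  fin_cases i <;> fin_cases j <;> simp [frame] <;> fun_prop

theorem continuous_coframe (i : Fin 6) {v : E → E} (hv : Continuous v) :
    Continuous fun x => coframe x i (v x) := by
  fin_cases i <;> simp [coframe] <;> fun_prop

theorem continuous_J (a b c : ℝ) {v : E → E} (hv : Continuous v) :
    Continuous fun x => J a b c x (v x) := by
  have hf := continuous_frame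
  simp only [J, sum_apply, ContinuousLinearMap.smulRight_apply]
  refine continuous_finsetSum _ fun i _ => (continuous_coframe i hv).smul ?_
  fin_cases i <;> simp <;> fun_prop

theorem continuous_orthoFrame (a b c : ℝ) (i : Fin 6) :
    Continuous fun x => orthoFrame a b c x i := by
  have hf := continuous_frame
  fin_cases i <;> simp [orthoFrame] <;> fun_prop

theorem continuous_volDensity (a b c : ℝ) : Continuous (volDensity a b c) := by
  refine Real.continuous_sqrt.comp (Continuous.matrix_det ?_)
  refine continuous_pi fun i => continuous_pi fun j => ?_
  have h1 : ∀ l, Continuous fun x => coframe x l (Pi.single i 1) :=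
    fun l => continuous_coframe l continuous_const
  have h2 : ∀ l, Continuous fun x => coframe x l (J a b c x (Pi.single j 1)) :=
    fun l => continuous_coframe l (continuous_J a b c continuous_const)
  simp only [Matrix.of_apply, metric, omega, wedge₂]
  fun_prop

theorem LatticeData.exists_isCompact_fundDomain (D : LatticeData) :
    ∃ K : Set E, IsCompact K ∧ D.fundDomain ⊆ K := by
  let f : E → E := fun s => ![D.a₀ * s 0, s 1,
    (D.P : Matrix (Fin 2) (Fin 2) ℝ).mulVec ![s 2, s 3] 0,
    (D.P : Matrix (Fin 2) (Fin 2) ℝ).mulVec ![s 2, s 3] 1,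
    (D.P : Matrix (Fin 2) (Fin 2) ℝ).mulVec ![s 4, s 5] 0,
    (D.P : Matrix (Fin 2) (Fin 2) ℝ).mulVec ![s 4, s 5] 1]
  have hf : Continuous f := by
    refine continuous_pi fun i => ?_
    fin_cases i <;> simp [f, Matrix.mulVec, dotProduct] <;> fun_prop
  refine ⟨f '' Set.Icc 0 1, isCompact_Icc.image hf, ?_⟩
  rintro g ⟨s, hs, h0, h1, h2, h3⟩
  refine ⟨s, ⟨fun i => (hs i).1, fun i => (hs i).2.le⟩, ?_⟩
  have e2 := congrFun h2 0
  have e3 := congrFun h2 1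
  have e4 := congrFun h3 0
  have e5 := congrFun h3 1
  ext i
  fin_cases i
  · exact h0.symm
  · exact h1.symm
  · exact e2.symm
  · exact e3.symm
  · exact e4.symm
  · exact e5.symm

theorem integrable_hermProd (D : LatticeData) (a b c : ℝ) {k : ℕ} {α β : Form k}
    (hα : EvalCont α) (hβ : EvalCont β) :
    IntegrableOn (fun x => hermProd a b c x (α x) (β x) * (volDensity a b c x : ℂ))
      D.fundDomain := by
  obtain ⟨K, hK, hDK⟩ := D.exists_isCompact_fundDomain
  refine IntegrableOn.mono_set (ContinuousOn.integrableOn_compact hK ?_) hDK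
  refine Continuous.continuousOn ?_
  refine Continuous.mul ?_ (Complex.continuous_ofReal.comp (continuous_volDensity a b c))
  refine continuous_const.mul (continuous_finsetSum _ fun I _ => ?_)
  exact (hα _ fun i => continuous_orthoFrame a b c (I i)).mul
    (Complex.continuous_conj.comp (hβ _ fun i => continuous_orthoFrame a b c (I i)))

theorem l2Prod_add_right (D : LatticeData) (a b c : ℝ) {k : ℕ} {α β β' : Form k}
    (hα : EvalCont α) (hβ : EvalCont β) (hβ' : EvalCont β') :
    l2Prod D a b c α (β + β') = l2Prod D a b c α β + l2Prod D a b c α β' := by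
  unfold l2Prod
  rw [← integral_add (integrable_hermProd D a b c hα hβ) (integrable_hermProd D a b c hα hβ')]
  congr 1
  ext x
  simp only [hermProd, Pi.add_apply, ContinuousAlternatingMap.add_apply, map_add, mul_add,
    Finset.sum_add_distrib, add_mul]

theorem l2Prod_smul_right (D : LatticeData) (a b c : ℝ) {k : ℕ} (r : ℂ) (α β : Form k) :
    l2Prod D a b c α (r • β) = (starRingEnd ℂ) r * l2Prod D a b c α β := by
  unfold l2Prod
  rw [← integral_const_mul]
  congr 1
  ext x
  simp only [hermProd, Pi.smul_apply, ContinuousAlternatingMap.smul_apply, smul_eq_mul, map_mul,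
    Finset.mul_sum, Finset.sum_mul]
  refine Finset.sum_congr rfl fun I _ => ?_
  ring

theorem EvalCont.of_mem {D : LatticeData} {a b c : ℝ} {p q : ℕ} {ψ : Form (p + q)}
    (h : ψ ∈ forms D a b c p q) : EvalCont ψ := .of_continuous h.1.continuous

theorem EvalCont.dbar {D : LatticeData} {a b c : ℝ} {p q : ℕ} {ψ : Form (p + q)}
    (h : ψ ∈ forms D a b c p q) : EvalCont (dbar a b c p q ψ) := by
  have h1 : Continuous (extDeriv ψ) :=
    (ContinuousAlternatingMap.alternatizeUncurryFinCLM ℝ E ℂ).continuous.comp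
      (h.1.continuous_fderiv (by simp))
  intro v hv
  simp only [Solvmanifold.dbar, typeProj, ContinuousAlternatingMap.smul_apply,
    ContinuousAlternatingMap.sum_apply, ContinuousAlternatingMap.compContinuousLinearMap_apply]
  refine Continuous.const_smul (continuous_finsetSum _ fun j _ => ?_) (_ : ℂ)
  refine Continuous.const_smul ?_ (_ : ℂ)
  have h2 : EvalCont (extDeriv ψ) := EvalCont.of_continuous h1
  exact h2 (fun i x => Real.cos (Real.pi * j / ((p + (q + 1) : ℕ) + 1)) • v i x
      + Real.sin (Real.pi * j / ((p + (q + 1) : ℕ) + 1)) • J a b c x (v i x))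
    fun i => Continuous.fun_add ((hv i).fun_const_smul _)
      ((continuous_J a b c (hv i)).fun_const_smul _)

theorem dbar_add {D : LatticeData} {a b c : ℝ} {p q : ℕ} {ψ χ : Form (p + q)}
    (hψ : ψ ∈ forms D a b c p q) (hχ : χ ∈ forms D a b c p q) :
    dbar a b c p q (ψ + χ) = dbar a b c p q ψ + dbar a b c p q χ := by
  funext x
  have h1 : DifferentiableAt ℝ ψ x := (hψ.1.differentiable (by simp)) x
  have h2 : DifferentiableAt ℝ χ x := (hχ.1.differentiable (by simp)) x
  simp only [dbar, Pi.add_apply]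
  rw [extDeriv_add h1 h2, typeProj_add]

theorem dbar_smul {D : LatticeData} {a b c : ℝ} {p q : ℕ} (r : ℂ) {ψ : Form (p + q)}
    (hψ : ψ ∈ forms D a b c p q) :
    dbar a b c p q (r • ψ) = r • dbar a b c p q ψ := by
  funext x
  have h1 : DifferentiableAt ℝ ψ x := (hψ.1.differentiable (by simp)) x
  have h2 : extDeriv (r • ψ) x = r • extDeriv ψ x := by
    have h3 : DifferentiableAt ℝ (r • ψ) x := h1.const_smul r
    ext v
    rw [extDeriv_apply h3, ContinuousAlternatingMap.smul_apply, extDeriv_apply h1,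
      Finset.smul_sum]
    refine Finset.sum_congr rfl fun i _ => ?_
    have h4 : DifferentiableAt ℝ (fun x => ψ x (i.removeNth v)) x :=
      (ContinuousAlternatingMap.apply ℝ E ℂ (i.removeNth v)).differentiableAt.comp x h1
    have h5 : (fun x => (r • ψ) x (i.removeNth v)) = r • fun x => ψ x (i.removeNth v) := rfl
    rw [h5, fderiv_const_smul h4, smul_comm]
    rfl
  simp only [dbar, Pi.smul_apply]
  rw [h2, typeProj_smul]

theorem IsDbarStar.add {D : LatticeData} {a b c : ℝ} {p q : ℕ} {η η' : Form (p + (q + 1))}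
    {ξ ξ' : Form (p + q)} (hη : EvalCont η) (hη' : EvalCont η')
    (h : IsDbarStar D a b c p q η ξ) (h' : IsDbarStar D a b c p q η' ξ') :
    IsDbarStar D a b c p q (η + η') (ξ + ξ') := by
  refine ⟨Submodule.add_mem _ h.1 h'.1, fun β hβ => ?_⟩
  rw [l2Prod_add_right D a b c (.dbar hβ) hη hη',
    l2Prod_add_right D a b c (.of_mem hβ) (.of_mem h.1) (.of_mem h'.1), h.2 β hβ, h'.2 β hβ]

theorem IsDbarStar.smul {D : LatticeData} {a b c : ℝ} {p q : ℕ} {η : Form (p + (q + 1))}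
    {ξ : Form (p + q)} (r : ℂ) (h : IsDbarStar D a b c p q η ξ) :
    IsDbarStar D a b c p q (r • η) (r • ξ) := by
  refine ⟨Submodule.smul_mem _ _ h.1, fun β hβ => ?_⟩
  rw [l2Prod_smul_right, l2Prod_smul_right, h.2 β hβ]

theorem IsLaplacian.add {D : LatticeData} {a b c : ℝ} {p q : ℕ} {ψ ψ' θ θ' : Form (p + q)}
    (hψ : ψ ∈ forms D a b c p q) (hψ' : ψ' ∈ forms D a b c p q)
    (h : IsLaplacian D a b c p q ψ θ) (h' : IsLaplacian D a b c p q ψ' θ') :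
    IsLaplacian D a b c p q (ψ + ψ') (θ + θ') := by
  cases q with
  | zero =>
    have := IsDbarStar.add (.dbar hψ) (.dbar hψ') h h'
    rw [← dbar_add hψ hψ'] at this
    exact this
  | succ q =>
    obtain ⟨ξ, ζ, h1, h2, h3⟩ := h
    obtain ⟨ξ', ζ', h1', h2', h3'⟩ := h'
    have := IsDbarStar.add (.dbar hψ) (.dbar hψ') h2 h2'
    rw [← dbar_add hψ hψ'] at this
    refine ⟨ξ + ξ', ζ + ζ', IsDbarStar.add (.of_mem hψ) (.of_mem hψ') h1 h1', this, ?_⟩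
    rw [h3, h3', dbar_add h1.1 h1'.1]
    exact add_add_add_comm _ _ _ _

theorem IsLaplacian.smul {D : LatticeData} {a b c : ℝ} {p q : ℕ} {ψ θ : Form (p + q)} (r : ℂ)
    (hψ : ψ ∈ forms D a b c p q) (h : IsLaplacian D a b c p q ψ θ) :
    IsLaplacian D a b c p q (r • ψ) (r • θ) := by
  cases q with
  | zero =>
    have := IsDbarStar.smul r h
    rw [← dbar_smul r hψ] at this
    exact this
  | succ q =>
    obtain ⟨ξ, ζ, h1, h2, h3⟩ := h
    have := IsDbarStar.smul r h2
    rw [← dbar_smul r hψ] at this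
    refine ⟨r • ξ, r • ζ, IsDbarStar.smul r h1, this, ?_⟩
    rw [h3, dbar_smul r h1.1]
    exact smul_add r _ _

/-- `ℋ^{p,q}_∂̄(X)`, the kernel of `Δ_∂̄` on `A^{p,q}(X)`. -/
def harmonic (D : LatticeData) (a b c : ℝ) (p q : ℕ) : Submodule ℂ (Form (p + q)) where
  carrier := {ψ | ψ ∈ forms D a b c p q ∧ IsLaplacian D a b c p q ψ 0}
  zero_mem' := by
    have hd : ∀ q, dbar a b c p q 0 = 0 := fun q => by
      have := dbar_smul (D := D) (a := a) (b := b) (c := c) 0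
        (Submodule.zero_mem (forms D a b c p q))
      have e : (0 : ℂ) • (0 : Form (p + q)) = 0 := by ext; simp
      have e' : (0 : ℂ) • dbar a b c p q 0 = 0 := by ext; simp
      rwa [e, e'] at this
    have h0 : ∀ q, IsDbarStar D a b c p q 0 0 := fun q =>
      ⟨Submodule.zero_mem _, fun β hβ => by simp [l2Prod, hermProd]⟩
    refine ⟨Submodule.zero_mem _, ?_⟩
    cases q with
    | zero =>
      change IsDbarStar D a b c p 0 (dbar a b c p 0 0) 0
      rw [hd]
      exact h0 0
    | succ q =>
      refine ⟨0, 0, h0 q, ?_, ?_⟩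
      · rw [hd]
        exact h0 (q + 1)
      · rw [hd]
        exact (add_zero _).symm
  add_mem' := by
    rintro ψ χ ⟨h1, h2⟩ ⟨h1', h2'⟩
    refine ⟨Submodule.add_mem _ h1 h1', ?_⟩
    have := IsLaplacian.add h1 h1' h2 h2'
    rwa [add_zero] at this
  smul_mem' := by
    rintro r ψ ⟨h1, h2⟩
    refine ⟨Submodule.smul_mem _ r h1, ?_⟩
    have := IsLaplacian.smul r h1 h2
    have e : r • (0 : Form (p + q)) = 0 := by ext; simp
    rwa [e] at this

/-- The Hodge number `h^{p,q}_∂̄`, the complex dimension of `ℋ^{p,q}_∂̄(X)`, as a cardinal. -/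
def hodgeNumber (D : LatticeData) (a b c : ℝ) (p q : ℕ) : Cardinal :=
  Module.rank ℂ (harmonic D a b c p q)

end Solvmanifold

end

/-! For `q = 0` the Laplacian has no `∂̄ ∂̄*` term, and pairing `Δψ = 0` with `ψ` gives `‖∂̄ψ‖² =
0`. So the harmonic `(p,0)`-forms are the solutions of `∂̄ψ = 0` in `A^{p,0}(X)`
(`mem_harmonic_iff`). Expand `ψ` in the left-invariant `(1,0)`-coframe dual to `Z₁, Z₂, Z₃` (indices
`0, 1, 2` in the code). Its coefficients `f_I` are `Γ`-invariant functions, bounded because `X` is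
compact. Cartan's formula turns `∂̄ψ = 0` into a first-order system: each `Z̄_j f_I` is a
constant-coefficient combination of the coefficients of `ψ`, the constants being the `(1,0)`-parts
of the brackets `[Z̄_j, Z_i]` (`dbar_eq_zero_iff`).

The system is solved by Liouville's theorem on planes in `G`. Up to a factor, `Z̄₂` and `Z̄₃` are
Cauchy–Riemann operators on affine planes in the fibres `t, x = const`, and `Z̄₁` is one on the
`(t,x)`-plane. If a bounded function on a plane has constant `∂/∂z̄`, then that constant is zero and
the function is constant (`eq_zero_and_const_of_bounded`).

For `p = 3` the system is `Z̄_j f = 0`, so `f` is constant. For `p = 1`, `f₂` and `f₃` are constant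
on the fibres, so `Z̄₂ f₁` and `Z̄₃ f₁` are too, and hence vanish; this is an invertible linear
system for `f₂, f₃`, so only a constant `f₁` survives.

For `p = 2`, `f₂₃` is constant, and `Z̄₂ f₁₂ = (c/4) f₂₃` forces it to vanish. Then `f₁₂` and `f₁₃`
live on the base, where `f₁₂ ± f₁₃` are eigenfunctions of `Z̄₁` with eigenvalues `± c/4`. A
unimodular integrating factor and Liouville show that they are multiples of `exp(∓ i c x / 2)`
(`base_eigenfunction`). Invariance under `x ↦ x + 1` allows nonzero multiples exactly when `c ∈
4πℤ`, and then both amplitudes are free. -/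

noncomputable section

namespace Solvmanifold

open scoped ContDiff
open MeasureTheory

/-! ### Complexified evaluation of covectors -/

/-- The `ℂ`-multilinear extension of a covector, in the coordinates given by the frame at `x`. -/
def cx (x : E) {k : ℕ} (α : E [⋀^Fin k]→L[ℝ] ℂ) :
    MultilinearMap ℂ (fun _ : Fin k => Fin 6 → ℂ) ℂ :=
  ∑ I : Fin k → Fin 6, α (fun m => frame x (I m)) •
    (MultilinearMap.mkPiAlgebra ℂ (Fin k) ℂ).compLinearMap (fun m => LinearMap.proj (I m))

theorem cx_apply (x : E) {k : ℕ} (α : E [⋀^Fin k]→L[ℝ] ℂ) (w : Fin k → Fin 6 → ℂ) :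
    cx x α w = ∑ I : Fin k → Fin 6, α (fun m => frame x (I m)) * ∏ m, w m (I m) := by
  simp [cx]

theorem cx_add (x : E) {k : ℕ} (α β : E [⋀^Fin k]→L[ℝ] ℂ) (w : Fin k → Fin 6 → ℂ) :
    cx x (α + β) w = cx x α w + cx x β w := by
  simp only [cx_apply, ContinuousAlternatingMap.add_apply, add_mul, Finset.sum_add_distrib]

theorem cx_smul (x : E) {k : ℕ} (r : ℂ) (α : E [⋀^Fin k]→L[ℝ] ℂ) (w : Fin k → Fin 6 → ℂ) :
    cx x (r • α) w = r * cx x α w := by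
  simp only [cx_apply, ContinuousAlternatingMap.smul_apply, smul_eq_mul, Finset.mul_sum, mul_assoc]

theorem cx_zero (x : E) {k : ℕ} (w : Fin k → Fin 6 → ℂ) :
    cx x (0 : E [⋀^Fin k]→L[ℝ] ℂ) w = 0 := by
  simp [cx_apply]

theorem cx_sum (x : E) {k : ℕ} {ι : Type*} (s : Finset ι) (α : ι → E [⋀^Fin k]→L[ℝ] ℂ)
    (w : Fin k → Fin 6 → ℂ) :
    cx x (∑ i ∈ s, α i) w = ∑ i ∈ s, cx x (α i) w := by
  classical
  induction s using Finset.induction_on with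
  | empty => simp [cx_zero]
  | insert i s hi ih => rw [Finset.sum_insert hi, Finset.sum_insert hi, cx_add, ih]

/-- Permuting the arguments amounts to reindexing the sum over multi-indices, and the sign comes
from `α` being alternating on the real frame. -/
theorem cx_comp_perm (x : E) {k : ℕ} (α : E [⋀^Fin k]→L[ℝ] ℂ) (w : Fin k → Fin 6 → ℂ)
    (σ : Equiv.Perm (Fin k)) :
    cx x α (fun m => w (σ m)) = (Equiv.Perm.sign σ : ℤ) • cx x α w := by
  rw [cx_apply, cx_apply, Finset.smul_sum]
  conv_rhs => rw [← (Equiv.arrowCongr σ (Equiv.refl (Fin 6))).sum_comp]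
  refine Finset.sum_congr rfl fun I _ => ?_
  have h1 : α (fun m => frame x (I m)) = (Equiv.Perm.sign σ : ℤ) •
      α (fun m => frame x (Equiv.arrowCongr σ (Equiv.refl (Fin 6)) I m)) := by
    have := α.toAlternatingMap.map_perm
      (fun m => frame x (Equiv.arrowCongr σ (Equiv.refl (Fin 6)) I m)) σ
    simpa [Function.comp_def, Units.smul_def] using this
  rw [h1, ← smul_mul_assoc]
  congr 1
  conv_rhs => rw [← Equiv.prod_comp σ]
  simp

theorem cx_swap (x : E) {k : ℕ} (α : E [⋀^Fin k]→L[ℝ] ℂ) (w : Fin k → Fin 6 → ℂ)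
    {i j : Fin k} (hij : i ≠ j) : cx x α (fun m => w (Equiv.swap i j m)) = -cx x α w := by
  rw [cx_comp_perm, Equiv.Perm.sign_swap hij]
  simp

theorem cx_eq_zero_of_eq (x : E) {k : ℕ} (α : E [⋀^Fin k]→L[ℝ] ℂ) {w : Fin k → Fin 6 → ℂ}
    {i j : Fin k} (hij : i ≠ j) (h : w i = w j) : cx x α w = 0 := by
  have h1 := cx_swap x α w hij
  have h2 : (fun m => w (Equiv.swap i j m)) = w := by
    funext m
    rcases eq_or_ne m i with rfl | hi
    · rw [Equiv.swap_apply_left, h]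
    rcases eq_or_ne m j with rfl | hj
    · rw [Equiv.swap_apply_right, h]
    rw [Equiv.swap_apply_of_ne_of_ne hi hj]
  rw [h2] at h1
  linear_combination h1 / 2

/-- Expansion of a covector in the frame. -/
theorem apply_eq_sum_frame (x : E) {k : ℕ} (α : E [⋀^Fin k]→L[ℝ] ℂ) (v : Fin k → E) :
    α v = ∑ I : Fin k → Fin 6, ((∏ m, coframe x (I m) (v m) : ℝ) : ℂ) *
      α (fun m => frame x (I m)) := by
  conv_lhs => rw [show v = fun m => ∑ i, coframe x i (v m) • frame x i from
    funext fun m => (sum_coframe_smul_frame x (v m)).symm]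
  have := α.toContinuousMultilinearMap.toMultilinearMap.map_sum
    (fun m i => coframe x i (v m) • frame x i)
  refine this.trans (Finset.sum_congr rfl fun I _ => ?_)
  have := α.toContinuousMultilinearMap.toMultilinearMap.map_smul_univ
    (fun m => coframe x (I m) (v m)) (fun m => frame x (I m))
  refine this.trans ?_
  rw [Complex.real_smul]
  rfl

theorem cx_eq_apply (x : E) {k : ℕ} (α : E [⋀^Fin k]→L[ℝ] ℂ) (v : Fin k → E) :
    cx x α (fun m i => (coframe x i (v m) : ℂ)) = α v := by
  rw [cx_apply, apply_eq_sum_frame x α v]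
  refine Finset.sum_congr rfl fun I _ => ?_
  push_cast
  ring

theorem eq_zero_of_cx_eq_zero (x : E) {k : ℕ} {α : E [⋀^Fin k]→L[ℝ] ℂ}
    (h : ∀ w, cx x α w = 0) : α = 0 := by
  ext v
  rw [← cx_eq_apply x α v, h]
  rfl

/-- Pull-back by a real endomorphism acts on complex coordinates through its matrix in the frame.
This makes it possible to evaluate the rotations in `typeProj` on eigenvectors of `J`. -/
theorem cx_comp (x : E) {k : ℕ} (α : E [⋀^Fin k]→L[ℝ] ℂ) (T : E →L[ℝ] E)
    (w : Fin k → Fin 6 → ℂ) :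
    cx x (α.compContinuousLinearMap T) w
      = cx x α (fun m j => ∑ i, (coframe x j (T (frame x i)) : ℂ) * w m i) := by
  rw [cx_apply, cx_apply]
  simp only [ContinuousAlternatingMap.compContinuousLinearMap_apply, Finset.prod_univ_sum,
    Fintype.piFinset_univ, Finset.mul_sum]
  rw [Finset.sum_comm]
  refine Finset.sum_congr rfl fun I _ => ?_
  rw [apply_eq_sum_frame x α, Finset.sum_mul]
  refine Finset.sum_congr rfl fun K _ => ?_
  simp only [Function.comp_apply, Finset.prod_mul_distrib, Complex.ofReal_prod]
  ring

/-- The `ℂ`-linear extension of a `1`-covector, in the coordinates given by the frame at `x`. -/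
def ext₁ (x : E) (φ : E →L[ℝ] ℂ) (v : Fin 6 → ℂ) : ℂ := ∑ i, φ (frame x i) * v i

theorem cx_of_det (x : E) {k : ℕ} {α : E [⋀^Fin k]→L[ℝ] ℂ} {φ : Fin k → (E →L[ℝ] ℂ)}
    (h : ∀ v, α v = Matrix.det (Matrix.of fun i j => φ i (v j))) (w : Fin k → Fin 6 → ℂ) :
    cx x α w = Matrix.det (Matrix.of fun i j => ext₁ x (φ i) (w j)) := by
  rw [cx_apply, Matrix.det_apply']
  simp only [h, Matrix.det_apply', Finset.sum_mul, Matrix.of_apply, ext₁, Finset.prod_univ_sum,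
    Fintype.piFinset_univ, Finset.mul_sum]
  rw [Finset.sum_comm]
  refine Finset.sum_congr rfl fun σ _ => Finset.sum_congr rfl fun I _ => ?_
  rw [Finset.prod_mul_distrib]
  ring

/-! ### The almost-complex structure in complex coordinates -/

/-- The `ℂ`-linear extension of `J_{a,b,c}`, in the coordinates given by the frame. -/
def Jcx (a b c : ℝ) (v : Fin 6 → ℂ) : Fin 6 → ℂ :=
  ![-(1 / a) * v 1, a * v 0, -b * v 3 - (1 / c) * v 5, -(1 / c) * v 4, c * v 3,
    c * v 2 + b * v 4]

/-- Since `J` is left-invariant, its matrix in the frame does not depend on the point; hence `Jcx`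
has no argument `x`. -/
theorem sum_coframe_J (a b c : ℝ) (x : E) (v : Fin 6 → ℂ) (j : Fin 6) :
    ∑ i, (coframe x j (J a b c x (frame x i)) : ℂ) * v i = Jcx a b c v j := by
  fin_cases j <;> simp [J_frame, coframe_frame, Fin.sum_univ_six, Jcx]
  ring

theorem ext₁_Jcx (a b c : ℝ) (x : E) {φ : E →L[ℝ] ℂ} {r : ℂ}
    (h : ∀ v, φ (J a b c x v) = r * φ v) (v : Fin 6 → ℂ) :
    ext₁ x φ (Jcx a b c v) = r * ext₁ x φ v := by
  have h' := fun i => h (frame x i)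
  simp only [J_frame, Fin.forall_fin_succ] at h'
  obtain ⟨h0, h1, h2, h3, h4, h5, -⟩ := h'
  simp at h0 h1 h2 h3 h4 h5
  simp only [ext₁, Fin.sum_univ_six, mul_add, Jcx]
  simp
  linear_combination v 0 * h0 + v 1 * h1 + v 2 * h2 + v 3 * h3 + v 4 * h4 + v 5 * h5

/-- The coefficients of the frame `Z₁, Z₂, Z₃` of vector fields of type `(1,0)`. -/
def Z (a b c : ℝ) : Fin 3 → Fin 6 → ℂ :=
  ![![1 / (2 * a), -Complex.I / 2, 0, 0, 0, 0],
    ![0, 0, 1 / 2, 0, 0, -Complex.I * c / 2],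
    ![0, 0, Complex.I * b / 2, 1 / 2, -Complex.I * c / 2, 0]]

/-- The coefficients of the conjugate frame, of type `(0,1)`. -/
def Zbar (a b c : ℝ) : Fin 3 → Fin 6 → ℂ :=
  ![![1 / (2 * a), Complex.I / 2, 0, 0, 0, 0],
    ![0, 0, 1 / 2, 0, 0, Complex.I * c / 2],
    ![0, 0, -Complex.I * b / 2, 1 / 2, Complex.I * c / 2, 0]]

theorem Jcx_Z {a b c : ℝ} (ha : a ≠ 0) (hc : c ≠ 0) (j : Fin 3) :
    Jcx a b c (Z a b c j) = Complex.I • Z a b c j := by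
  have ha' : (a : ℂ) ≠ 0 := by exact_mod_cast ha
  have hc' : (c : ℂ) ≠ 0 := by exact_mod_cast hc
  ext i
  fin_cases j <;> fin_cases i <;> simp [Jcx, Z] <;> field_simp <;> simp

theorem Jcx_Zbar {a b c : ℝ} (ha : a ≠ 0) (hc : c ≠ 0) (j : Fin 3) :
    Jcx a b c (Zbar a b c j) = (-Complex.I) • Zbar a b c j := by
  have ha' : (a : ℂ) ≠ 0 := by exact_mod_cast ha
  have hc' : (c : ℂ) ≠ 0 := by exact_mod_cast hc
  ext i
  fin_cases j <;> fin_cases i <;> simp [Jcx, Zbar] <;> field_simp <;> simp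

/-! ### Types in complex coordinates -/

/-- The frame of complex vector fields `Z₁, Z₂, Z₃` (index `true`) and `Z̄₁, Z̄₂, Z̄₃`
(index `false`). -/
def Zt (a b c : ℝ) (τ : Bool × Fin 3) : Fin 6 → ℂ := if τ.1 then Z a b c τ.2 else Zbar a b c τ.2

/-- The first three coefficients are the dual `(1,0)`-coframe (later `Phi`) evaluated on `v`; the
other three arise by replacing `i` with `-i`. -/
theorem eq_sum_Z_Zbar {a b c : ℝ} (ha : a ≠ 0) (hc : c ≠ 0) (v : Fin 6 → ℂ) :
    v = (a * v 0 + Complex.I * v 1) • Z a b c 0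
      + (v 2 + b / c * v 4 + Complex.I / c * v 5) • Z a b c 1
      + (v 3 + Complex.I / c * v 4) • Z a b c 2
      + (a * v 0 - Complex.I * v 1) • Zbar a b c 0
      + (v 2 + b / c * v 4 - Complex.I / c * v 5) • Zbar a b c 1
      + (v 3 - Complex.I / c * v 4) • Zbar a b c 2 := by
  have ha' : (a : ℂ) ≠ 0 := by exact_mod_cast ha
  have hc' : (c : ℂ) ≠ 0 := by exact_mod_cast hc
  have hI : Complex.I ^ 2 = -1 := Complex.I_sq
  ext i
  fin_cases i <;> simp [Z, Zbar] <;> field_simp <;> ring_nf <;> simp only [hI] <;> ring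

theorem top_le_span_Zt {a b c : ℝ} (ha : a ≠ 0) (hc : c ≠ 0) :
    ⊤ ≤ Submodule.span ℂ (Set.range (Zt a b c)) := by
  have h1 : ∀ j, Z a b c j ∈ Submodule.span ℂ (Set.range (Zt a b c)) :=
    fun j => Submodule.subset_span ⟨(true, j), by simp [Zt]⟩
  have h2 : ∀ j, Zbar a b c j ∈ Submodule.span ℂ (Set.range (Zt a b c)) :=
    fun j => Submodule.subset_span ⟨(false, j), by simp [Zt]⟩
  intro v _
  rw [eq_sum_Z_Zbar ha hc v]
  refine Submodule.add_mem _ (Submodule.add_mem _ (Submodule.add_mem _ (Submodule.add_mem _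
    (Submodule.add_mem _ ?_ ?_) ?_) ?_) ?_) ?_
  all_goals first
    | exact Submodule.smul_mem _ _ (h1 _)
    | exact Submodule.smul_mem _ _ (h2 _)

theorem cx_eq_zero_of_Zt {a b c : ℝ} (ha : a ≠ 0) (hc : c ≠ 0) (x : E) {k : ℕ}
    {α : E [⋀^Fin k]→L[ℝ] ℂ}
    (h : ∀ τ : Fin k → Bool × Fin 3, cx x α (fun m => Zt a b c (τ m)) = 0) :
    α = 0 := by
  let B := basisOfTopLeSpanOfCardEqFinrank (Zt a b c) (top_le_span_Zt ha hc) (by simp)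
  have hB : ∀ τ, B τ = Zt a b c τ := fun τ => by simp [B]
  have h0 : cx x α = 0 := by
    refine Module.Basis.ext_multilinear (fun _ => B) fun τ => ?_
    simp only [hB]
    exact h τ
  exact eq_zero_of_cx_eq_zero x fun w => by rw [h0]; rfl

theorem cx_rotation (a b c : ℝ) (x : E) {k : ℕ} (α : E [⋀^Fin k]→L[ℝ] ℂ) (θ : ℝ)
    (w : Fin k → Fin 6 → ℂ) :
    cx x (α.compContinuousLinearMap
        (Real.cos θ • ContinuousLinearMap.id ℝ E + Real.sin θ • J a b c x)) w
      = cx x α (fun m => Complex.cos θ • w m + Complex.sin θ • Jcx a b c (w m)) := by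
  rw [cx_comp]
  congr 1
  funext m j
  simp only [add_apply, smul_apply, ContinuousLinearMap.id_apply,
    map_add, map_smul, coframe_frame, smul_eq_mul, Pi.add_apply, Pi.smul_apply,
    ← sum_coframe_J a b c x,
    Finset.mul_sum]
  push_cast
  simp only [add_mul, Finset.sum_add_distrib, mul_assoc]
  simp [apply_ite (fun r : ℝ => (r : ℂ))]

/-- The vectors `Zt` are eigenvectors of `cos θ + sin θ J` with eigenvalues `e^{±iθ}`, so by
multilinearity each `(1,0)` argument contributes `e^{iθ}` and each `(0,1)` argument `e^{-iθ}`. -/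
theorem cx_rotation_Zt {a b c : ℝ} (ha : a ≠ 0) (hc : c ≠ 0) (x : E) {k r s : ℕ}
    (α : E [⋀^Fin k]→L[ℝ] ℂ) (θ : ℝ) (τ : Fin k → Bool × Fin 3)
    (hr : (Finset.univ.filter fun m => (τ m).1 = true).card = r)
    (hs : (Finset.univ.filter fun m => ¬ (τ m).1 = true).card = s) :
    cx x (α.compContinuousLinearMap
        (Real.cos θ • ContinuousLinearMap.id ℝ E + Real.sin θ • J a b c x))
        (fun m => Zt a b c (τ m))
      = Complex.exp (((r : ℂ) - s) * θ * Complex.I) * cx x α (fun m => Zt a b c (τ m)) := by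
  rw [cx_rotation]
  have h : ∀ m, Complex.cos θ • Zt a b c (τ m) + Complex.sin θ • Jcx a b c (Zt a b c (τ m))
      = (if (τ m).1 = true then Complex.exp (θ * Complex.I) else Complex.exp (-(θ * Complex.I)))
        • Zt a b c (τ m) := by
    intro m
    unfold Zt
    split_ifs with hm
    · rw [Jcx_Z ha hc, Complex.exp_mul_I, smul_smul, ← add_smul]
    · rw [Jcx_Zbar ha hc, ← neg_mul, Complex.exp_mul_I, smul_smul, ← add_smul, Complex.cos_neg,
        Complex.sin_neg]
      congr 1
      ring
  simp only [h]
  rw [MultilinearMap.map_smul_univ, smul_eq_mul, Finset.prod_ite, Finset.prod_const,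
    Finset.prod_const, hr, hs, ← Complex.exp_nat_mul, ← Complex.exp_nat_mul, ← Complex.exp_add]
  congr 2
  ring

/-- The base is a `(k+1)`-th root of unity, different from `1` because `0 < |r - p| < k + 1`; the
geometric sum over a full period vanishes. -/
theorem sum_exp_eq_zero {k p r : ℕ} (hp : p ≤ k) (hr : r ≤ k) (hne : r ≠ p) :
    ∑ j ∈ Finset.range (k + 1),
      Complex.exp (2 * Real.pi * Complex.I * (((r : ℂ) - p) / (k + 1))) ^ j = 0 := by
  have hk : ((k : ℂ) + 1) ≠ 0 := Nat.cast_add_one_ne_zero k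
  set z : ℂ := Complex.exp (2 * Real.pi * Complex.I * (((r : ℂ) - p) / (k + 1))) with hz
  have hz1 : z ≠ 1 := by
    intro h
    rw [hz, Complex.exp_eq_one_iff] at h
    obtain ⟨n, hn⟩ := h
    have h1 : (((r : ℂ) - p) / (k + 1)) = n := by
      apply mul_left_cancel₀ Complex.two_pi_I_ne_zero
      rw [hn]; ring
    rw [div_eq_iff hk] at h1
    have h2 : ((r : ℤ) - p) = n * (k + 1) := by exact_mod_cast h1
    have h3 : |((r : ℤ) - p)| < |(k : ℤ) + 1| := by
      rw [abs_of_nonneg (by omega : (0 : ℤ) ≤ (k : ℤ) + 1), abs_lt]; omega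
    have h4 := Int.eq_zero_of_abs_lt_dvd (m := (k : ℤ) + 1) ⟨n, by rw [h2, mul_comm]⟩
      (h3.trans_eq (abs_of_nonneg (by omega)))
    omega
  have hzk : z ^ (k + 1) = 1 := by
    rw [hz, ← Complex.exp_nat_mul, Complex.exp_eq_one_iff]
    refine ⟨(r : ℤ) - p, ?_⟩
    push_cast
    field_simp
  rw [geom_sum_eq hz1, hzk, sub_self, zero_div]

/-- As `r + s = p + q`, the phase `(r - s) - (p - q)` equals `2(r - p)`. At the angles `πj/(k+1)`
this yields the powers of a `(k+1)`-th root of unity, whose average is `1` for `r = p` and `0`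
otherwise. -/
theorem cx_typeProj_Zt {a b c : ℝ} (ha : a ≠ 0) (hc : c ≠ 0) (x : E) {k p q : ℕ} (hpq : p + q = k)
    (α : E [⋀^Fin k]→L[ℝ] ℂ) (τ : Fin k → Bool × Fin 3) :
    cx x (typeProj (J a b c x) p q α) (fun m => Zt a b c (τ m))
      = if (Finset.univ.filter fun m => (τ m).1 = true).card = p
        then cx x α (fun m => Zt a b c (τ m)) else 0 := by
  obtain ⟨r, hr⟩ : ∃ r, (Finset.univ.filter fun m => (τ m).1 = true).card = r := ⟨_, rfl⟩
  obtain ⟨s, hs⟩ : ∃ s, (Finset.univ.filter fun m => ¬ (τ m).1 = true).card = s := ⟨_, rfl⟩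
  have hrs : r + s = k := by
    rw [← hr, ← hs, Finset.card_filter_add_card_filter_not]
    simp
  have hk : ((k : ℂ) + 1) ≠ 0 := Nat.cast_add_one_ne_zero k
  unfold typeProj
  rw [cx_smul, cx_sum]
  simp only [cx_smul, cx_rotation_Zt ha hc x α _ τ hr hs, ← mul_assoc, ← Complex.exp_add]
  rw [← Finset.sum_mul, hr, ← mul_assoc]
  have hterm : ∀ j ∈ Finset.range (k + 1),
      Complex.exp (-(((p : ℂ) - q) * (Real.pi * j / (k + 1) : ℝ) * Complex.I)
        + ((r : ℂ) - s) * (Real.pi * j / (k + 1) : ℝ) * Complex.I)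
        = Complex.exp (2 * Real.pi * Complex.I * (((r : ℂ) - p) / (k + 1))) ^ j := by
    intro j _
    rw [← Complex.exp_nat_mul]
    congr 1
    have e1 : (q : ℂ) = k - p := by rw [← hpq]; push_cast; ring
    have e2 : (s : ℂ) = k - r := by rw [← hrs]; push_cast; ring
    rw [e1, e2]
    push_cast
    field_simp
    ring
  rw [Finset.sum_congr rfl hterm]
  split_ifs with h
  · subst h
    simp [hk]
  · rw [sum_exp_eq_zero (by omega) (by omega) h, mul_zero, zero_mul]

/-- A covector has no component of type `(p,1)` if and only if it vanishes on one `(0,1)`-vector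
and `p` vectors of type `(1,0)` of the frame. -/
theorem typeProj_one_eq_zero_iff {a b c : ℝ} (ha : a ≠ 0) (hc : c ≠ 0) (x : E) {p : ℕ}
    (α : E [⋀^Fin (p + 1)]→L[ℝ] ℂ) :
    typeProj (J a b c x) p 1 α = 0 ↔ ∀ (j : Fin 3) (I : Fin p → Fin 3),
      cx x α (Matrix.vecCons (Zbar a b c j) fun m => Z a b c (I m)) = 0 := by
  constructor
  · intro h j I
    have h1 := cx_typeProj_Zt (b := b) ha hc x (q := 1) rfl α
      (Matrix.vecCons (false, j) fun m => (true, I m))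
    rw [h, cx_zero, if_pos] at h1
    · rw [h1]
      congr 1
      funext m
      refine Fin.cases ?_ (fun m => ?_) m <;> simp [Zt]
    · rw [Fin.univ_succ, Finset.filter_cons]
      simp [Finset.filter_map]
  · intro h
    refine cx_eq_zero_of_Zt (b := b) ha hc x fun τ => ?_
    rw [cx_typeProj_Zt ha hc x rfl]
    split_ifs with hτ
    · have hs : (Finset.univ.filter fun m => ¬ (τ m).1 = true).card = 1 := by
        have := Finset.card_filter_add_card_filter_not (s := (Finset.univ : Finset (Fin (p + 1))))
          (p := fun m => (τ m).1 = true)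
        simp only [Finset.card_univ, Fintype.card_fin] at this
        omega
      obtain ⟨m₀, hm₀⟩ := Finset.card_eq_one.mp hs
      have hm : ∀ m, (τ m).1 = false ↔ m = m₀ := fun m => by
        have := Finset.ext_iff.mp hm₀ m
        simpa using this
      -- Transposing slots `0` and `m₀` brings the unique `(0,1)` argument to the front, at the cost
      -- of a sign.
      have h1 := cx_comp_perm x α (fun m => Zt a b c (τ m)) (Equiv.swap 0 m₀)
      have h2 : (fun m => Zt a b c (τ (Equiv.swap 0 m₀ m)))
          = Matrix.vecCons (Zbar a b c (τ m₀).2)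
            (fun m => Z a b c (τ (Equiv.swap 0 m₀ m.succ)).2) := by
        funext m
        refine Fin.cases ?_ (fun m => ?_) m
        · have := (hm m₀).2 rfl
          simp [Zt, this]
        · have h3 : (τ (Equiv.swap 0 m₀ m.succ)).1 = true := by
            rw [← Bool.not_eq_false, hm]
            intro h4
            have := (Equiv.swap 0 m₀).injective (h4.trans (Equiv.swap_apply_left 0 m₀).symm)
            exact Fin.succ_ne_zero _ this
          simp [Zt, h3]
      rw [h2, h] at h1
      rcases Int.units_eq_one_or (Equiv.Perm.sign (Equiv.swap 0 m₀)) with h5 | h5 <;>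
        simpa [h5] using h1.symm
    · rfl

/-- A covector of type `(p,0)` vanishes as soon as one argument is of type `(0,1)`. -/
theorem cx_eq_zero_of_Zbar {a b c : ℝ} (ha : a ≠ 0) (hc : c ≠ 0) (x : E) {p : ℕ}
    {α : E [⋀^Fin p]→L[ℝ] ℂ} (hα : α ∈ bigraded (J a b c x) p p 0) {w : Fin p → Fin 6 → ℂ}
    {m : Fin p} {j : Fin 3} (hw : w m = Zbar a b c j) : cx x α w = 0 := by
  induction hα using Submodule.span_induction with
  | mem α h =>
    obtain ⟨-, φ, h10, -, hdet⟩ := h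
    rw [cx_of_det x hdet]
    refine Matrix.det_eq_zero_of_column_eq_zero m fun i => ?_
    -- `φ(J Z̄)` is `i φ(Z̄)` by the type of `φ` and `-i φ(Z̄)` by the type of `Z̄`, so a column of
    -- the determinant vanishes.
    have h1 := ext₁_Jcx a b c x (h10 i i.2) (Zbar a b c j)
    have h2 : ext₁ x (φ i) ((-Complex.I) • Zbar a b c j)
        = -Complex.I * ext₁ x (φ i) (Zbar a b c j) := by
      simp only [ext₁, Pi.smul_apply, smul_eq_mul, Finset.mul_sum]
      exact Finset.sum_congr rfl fun _ _ => by ring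
    rw [Jcx_Zbar ha hc, h2] at h1
    rw [Matrix.of_apply, hw]
    have h3 : (2 * Complex.I) * ext₁ x (φ i) (Zbar a b c j) = 0 := by linear_combination -h1
    exact (mul_eq_zero.mp h3).resolve_left (by simp)
  | zero => exact cx_zero x w
  | add α β _ _ h1 h2 => rw [cx_add, h1, h2, add_zero]
  | smul r α _ h1 => rw [cx_smul, h1, mul_zero]

/-- A covector of type `(p,0)` is determined by its values on the `(1,0)`-frame. -/
theorem eq_zero_of_bigraded {a b c : ℝ} (ha : a ≠ 0) (hc : c ≠ 0) (x : E) {p : ℕ}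
    {α : E [⋀^Fin p]→L[ℝ] ℂ} (hα : α ∈ bigraded (J a b c x) p p 0)
    (h : ∀ I : Fin p → Fin 3, cx x α (fun m => Z a b c (I m)) = 0) : α = 0 := by
  refine cx_eq_zero_of_Zt (b := b) ha hc x fun τ => ?_
  by_cases hτ : ∀ m, (τ m).1 = true
  · rw [← h fun m => (τ m).2]
    congr 1
    funext m
    simp [Zt, hτ m]
  · push Not at hτ
    obtain ⟨m, hm⟩ := hτ
    exact cx_eq_zero_of_Zbar ha hc x hα (m := m) (j := (τ m).2) (by simp [Zt, hm])

/-! ### The exterior derivative in the frame -/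

/-- The Lie bracket of the Lie algebra of `G`, in the coordinates given by the frame. -/
def bracket {R : Type*} [CommRing R] (v w : Fin 6 → R) : Fin 6 → R :=
  ![0, 0, v 0 * w 2 + v 1 * w 4 - (w 0 * v 2 + w 1 * v 4),
    -(v 0 * w 3) + v 1 * w 5 - (-(w 0 * v 3) + w 1 * v 5),
    v 0 * w 4 - w 0 * v 4, -(v 0 * w 5) + w 0 * v 5]

/-- The derivative of the frame. -/
def frameDeriv (x : E) (i : Fin 6) : E →L[ℝ] E :=
  (ContinuousLinearMap.proj 0 : E →L[ℝ] ℝ).smulRight ((![0, 0, 1, -1, 1, -1] : E) i • frame x i)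
    + (ContinuousLinearMap.proj 1 : E →L[ℝ] ℝ).smulRight
      ((![0, 0, 0, 0, frame x 2, frame x 3] : Fin 6 → E) i)

theorem hasFDerivAt_frame (x : E) (i : Fin 6) :
    HasFDerivAt (fun y => frame y i) (frameDeriv x i) x := by
  have h0 : HasFDerivAt (fun y : E => y 0) (ContinuousLinearMap.proj 0 : E →L[ℝ] ℝ) x :=
    hasFDerivAt_apply 0 x
  have h1 : HasFDerivAt (fun y : E => y 1) (ContinuousLinearMap.proj 1 : E →L[ℝ] ℝ) x :=
    hasFDerivAt_apply 1 x
  have he := h0.exp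
  have hf := h0.neg.exp
  have key : ∀ (f : E → ℝ) (f' : E →L[ℝ] ℝ) (L : E →L[ℝ] ℝ), HasFDerivAt f f' x →
      (∀ v, L v = f' v) → HasFDerivAt f L x := fun f f' L h hL => by
    rwa [ContinuousLinearMap.ext hL]
  refine hasFDerivAt_pi'' fun j => ?_
  fin_cases i <;> fin_cases j <;> simp only [frame] <;> simp
  all_goals first
    | exact key _ _ _ (hasFDerivAt_const _ x) (fun v => by simp [frameDeriv, frame])
    | exact key _ _ _ he (fun v => by simp [frameDeriv, frame]; ring)
    | exact key _ _ _ hf (fun v => by simp [frameDeriv, frame]; ring)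
    | exact key _ _ _ (h1.mul he) (fun v => by simp [frameDeriv, frame]; ring)
    | exact key _ _ _ (h1.mul hf) (fun v => by simp [frameDeriv, frame]; ring)

/-- Identifies `bracket` over `ℝ` with the commutators of the frame fields. With
`sum_bracket_single`, `bracket` over `ℂ` is their bilinear extension. -/
theorem lieBracket_frame (x : E) (i j : Fin 6) :
    VectorField.lieBracket ℝ (fun y => frame y i) (fun y => frame y j) x
      = ∑ l, bracket (Pi.single i (1 : ℝ)) (Pi.single j 1) l • frame x l := by
  rw [VectorField.lieBracket, (hasFDerivAt_frame x i).fderiv, (hasFDerivAt_frame x j).fderiv]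
  have h0 : ∀ i, frame x i 0 = (Pi.single i 1 : Fin 6 → ℝ) 0 := fun i => by
    fin_cases i <;> simp [frame]
  have h1 : ∀ i, frame x i 1 = (Pi.single i 1 : Fin 6 → ℝ) 1 := fun i => by
    fin_cases i <;> simp [frame]
  simp only [frameDeriv, add_apply, ContinuousLinearMap.smulRight_apply,
    ContinuousLinearMap.proj_apply, h0, h1, bracket, Fin.sum_univ_six]
  fin_cases i <;> fin_cases j <;> simp

theorem sum_bracket_single (v w : Fin 6 → ℂ) (l : Fin 6) :
    ∑ i, ∑ j, ((bracket (Pi.single i 1) (Pi.single j 1) l : ℝ) : ℂ) * (v i * w j)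
      = bracket v w l := by
  fin_cases l <;> simp [bracket, Fin.sum_univ_six, Pi.single_apply] <;> ring

/-- The derivative of a function along a complex combination of the frame. -/
def cderiv (v : Fin 6 → ℂ) (f : E → ℂ) (x : E) : ℂ := ∑ i, v i * fderiv ℝ f x (frame x i)

theorem differentiableAt_apply_frame {k : ℕ} {ψ : Form k} {x : E} (hψ : DifferentiableAt ℝ ψ x)
    (I : Fin k → Fin 6) : DifferentiableAt ℝ (fun y => ψ y (fun m => frame y (I m))) x :=
  hψ.continuousAlternatingMap_apply fun m => (hasFDerivAt_frame x (I m)).differentiableAt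

/-- The coordinates `w` are constants, so only the coefficients of `ψ` in the moving frame are
differentiated. -/
theorem cderiv_cx {k : ℕ} {ψ : Form k} {x : E} (hψ : DifferentiableAt ℝ ψ x) (v : Fin 6 → ℂ)
    (w : Fin k → Fin 6 → ℂ) :
    cderiv v (fun y => cx y (ψ y) w) x
      = ∑ i, ∑ I : Fin k → Fin 6, v i * ((∏ m, w m (I m)) *
        fderiv ℝ (fun y => ψ y (fun m => frame y (I m))) x (frame x i)) := by
  have h : HasFDerivAt (fun y => cx y (ψ y) w) (∑ I : Fin k → Fin 6,
      (∏ m, w m (I m)) • fderiv ℝ (fun y => ψ y (fun m => frame y (I m))) x) x := by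
    simp only [cx_apply]
    refine HasFDerivAt.fun_sum fun I _ => ?_
    exact (differentiableAt_apply_frame hψ I).hasFDerivAt.mul_const _
  simp only [cderiv, h.fderiv, sum_apply, smul_apply, smul_eq_mul, Finset.mul_sum]

theorem sum_eq_sum_insertNth {k : ℕ} (i : Fin (k + 1)) (g : (Fin (k + 1) → Fin 6) → ℂ) :
    ∑ I, g I = ∑ l, ∑ I : Fin k → Fin 6, g (i.insertNth l I) := by
  rw [← (Fin.insertNthEquiv (fun _ => Fin 6) i).sum_comp, Fintype.sum_prod_type]
  rfl

theorem cx_vecCons (x : E) {k : ℕ} (α : E [⋀^Fin (k + 1)]→L[ℝ] ℂ) (v : Fin 6 → ℂ)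
    (w : Fin k → Fin 6 → ℂ) :
    cx x α (Matrix.vecCons v w) = ∑ l, ∑ I : Fin k → Fin 6,
      α (Matrix.vecCons (frame x l) fun m => frame x (I m)) * (v l * ∏ m, w m (I m)) := by
  rw [cx_apply, sum_eq_sum_insertNth 0]
  refine Finset.sum_congr rfl fun l _ => Finset.sum_congr rfl fun I _ => ?_
  rw [Fin.prod_univ_succ]
  congr 2
  funext m
  refine Fin.cases ?_ (fun m => ?_) m <;> simp

/-- Cartan's formula for the exterior derivative, in the coordinates given by the frame. -/
theorem cx_extDeriv {n : ℕ} {ψ : Form (n + 1)} {x : E} (hψ : DifferentiableAt ℝ ψ x)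
    (w : Fin (n + 2) → Fin 6 → ℂ) :
    cx x (extDeriv ψ x) w
      = ∑ i, (-1) ^ i.val * cderiv (w i) (fun y => cx y (ψ y) (i.removeNth w)) x
        - ∑ i : Fin (n + 1), ∑ j ≥ i, (-1) ^ (i + j : ℕ) *
          cx x (ψ x) (Matrix.vecCons (bracket (w i.castSucc) (w j.succ))
            (j.removeNth (i.castSucc.removeNth w))) := by
  have hV : ∀ I : Fin (n + 2) → Fin 6, ∀ m, DifferentiableAt ℝ (fun y => frame y (I m)) x :=
    fun I m => (hasFDerivAt_frame x (I m)).differentiableAt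
  rw [cx_apply]
  -- Cartan's formula is applied to the frame fields for every multi-index `I`; the claim is the sum
  -- of these identities with the constant weights `∏ w m (I m)`.
  have h := fun I : Fin (n + 2) → Fin 6 => extDeriv_apply_vectorField hψ (hV I)
  simp only [h, sub_mul, Finset.sum_sub_distrib, Finset.sum_mul]
  congr 1
  · rw [Finset.sum_comm]
    refine Finset.sum_congr rfl fun i _ => ?_
    rw [cderiv_cx hψ, sum_eq_sum_insertNth i, Finset.mul_sum]
    refine Finset.sum_congr rfl fun l _ => ?_
    rw [Finset.mul_sum]
    refine Finset.sum_congr rfl fun I _ => ?_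
    rw [Fin.prod_univ_succAbove _ i]
    have e : (fun y => ψ y (i.removeNth fun m => frame y (i.insertNth (α := fun _ => Fin 6) l I m)))
        = fun y => ψ y fun m => frame y (I m) := by
      funext y
      congr 1
      funext m
      simp [Fin.removeNth]
    rw [e]
    simp [Fin.removeNth]
    ring
  · rw [Finset.sum_comm]
    refine Finset.sum_congr rfl fun i _ => ?_
    rw [Finset.sum_comm]
    refine Finset.sum_congr rfl fun j hj => ?_
    -- After slot `i` is removed, index `j ≥ i` stands for the original slot `j + 1`. So the pairs
    -- are `i < j + 1`, and this shift is what makes the bracket term carry a minus sign with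
    -- `(-1)^(i+j)`.
    have hij : i.castSucc.succAbove j = j.succ :=
      Fin.succAbove_of_le_castSucc _ _ (by simpa using hj)
    rw [cx_vecCons, sum_eq_sum_insertNth i.castSucc]
    have comm : ∀ F : Fin 6 → Fin 6 → (Fin n → Fin 6) → Fin 6 → ℂ,
        ∑ l, ∑ m, ∑ I, ∑ t, F l m I t = ∑ t, ∑ I, ∑ l, ∑ m, F l m I t := fun F => calc
      _ = ∑ l, ∑ m, ∑ t, ∑ I, F l m I t :=
        Finset.sum_congr rfl fun l _ => Finset.sum_congr rfl fun m _ => Finset.sum_comm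
      _ = ∑ l, ∑ t, ∑ m, ∑ I, F l m I t := Finset.sum_congr rfl fun l _ => Finset.sum_comm
      _ = ∑ t, ∑ l, ∑ m, ∑ I, F l m I t := Finset.sum_comm
      _ = ∑ t, ∑ l, ∑ I, ∑ m, F l m I t :=
        Finset.sum_congr rfl fun t _ => Finset.sum_congr rfl fun l _ => Finset.sum_comm
      _ = ∑ t, ∑ I, ∑ l, ∑ m, F l m I t := Finset.sum_congr rfl fun t _ => Finset.sum_comm
    have e : ∀ (l m : Fin 6) (I : Fin n → Fin 6), ψ x (Matrix.vecCons (∑ t,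
          bracket (Pi.single l (1 : ℝ)) (Pi.single m 1) t • frame x t) fun r => frame x (I r))
        = ∑ t, ((bracket (Pi.single l 1) (Pi.single m 1) t : ℝ) : ℂ) *
          ψ x (Matrix.vecCons (frame x t) fun r => frame x (I r)) := by
      intro l m I
      change (ψ x).toContinuousMultilinearMap.toMultilinearMap.curryLeft
        (∑ t, bracket (Pi.single l (1 : ℝ)) (Pi.single m 1) t • frame x t) (fun r => frame x (I r)) = _
      rw [map_sum, sum_apply]
      refine Finset.sum_congr rfl fun t _ => ?_
      rw [map_smul, smul_apply, Complex.real_smul]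
      rfl
    have rem : ∀ f : Fin (n + 2) → E, j.removeNth (i.castSucc.removeNth f)
        = fun r => f (i.castSucc.succAbove (j.succAbove r)) := fun f => rfl
    simp only [sum_eq_sum_insertNth j, rem, Fin.removeNth, hij.symm, Fin.insertNth_apply_same,
      Fin.insertNth_apply_succAbove, lieBracket_frame, Fin.prod_univ_succAbove _ i.castSucc,
      Fin.prod_univ_succAbove _ j, e, ← sum_bracket_single, Finset.mul_sum, Finset.sum_mul,
      Finset.smul_sum]
    rw [comm]
    refine Finset.sum_congr rfl fun t _ => Finset.sum_congr rfl fun I _ =>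
      Finset.sum_congr rfl fun l _ => Finset.sum_congr rfl fun m _ => ?_
    simp only [zsmul_eq_mul]
    push_cast
    ring

/-! ### The equation `∂̄ψ = 0` for forms of type `(p,0)` -/

theorem cderiv_const (v : Fin 6 → ℂ) (r : ℂ) (x : E) : cderiv v (fun _ => r) x = 0 := by
  simp [cderiv]

/-- A `(p,0)`-form vanishes once a `Z̄_j` remains among its arguments. In Cartan's formula this
leaves only the derivative along `Z̄_j` itself and the brackets that absorb `Z̄_j`. -/
theorem cx_extDeriv_Zbar {a b c : ℝ} (ha : a ≠ 0) (hc : c ≠ 0) {n : ℕ} {ψ : Form (n + 1)} {x : E}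
    (hψ : DifferentiableAt ℝ ψ x) (hJ : ∀ y, ψ y ∈ bigraded (J a b c y) (n + 1) (n + 1) 0)
    (j : Fin 3) (w : Fin (n + 1) → Fin 6 → ℂ) :
    cx x (extDeriv ψ x) (Matrix.vecCons (Zbar a b c j) w)
      = cderiv (Zbar a b c j) (fun y => cx y (ψ y) w) x
        - ∑ m : Fin (n + 1), (-1) ^ (m : ℕ) * cx x (ψ x)
          (Matrix.vecCons (bracket (Zbar a b c j) (w m)) (m.removeNth w)) := by
  rw [cx_extDeriv hψ, Fin.sum_univ_succ]
  have h1 : ∀ i : Fin (n + 1), (fun y => cx y (ψ y)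
      (i.succ.removeNth (Matrix.vecCons (Zbar a b c j) w))) = fun _ => 0 := by
    intro i
    funext y
    exact cx_eq_zero_of_Zbar ha hc y (hJ y) (m := 0) (j := j) (by simp [Fin.removeNth])
  have h2 : Fin.removeNth (0 : Fin (n + 2)) (Matrix.vecCons (Zbar a b c j) w) = w := by
    funext m
    simp [Fin.removeNth]
  simp only [h1, h2, cderiv_const, mul_zero, Finset.sum_const_zero, add_zero]
  rw [Fin.sum_univ_succ]
  -- These brackets do not involve slot `0`, so `Z̄_j` survives, moved to slot `1` behind the
  -- prepended bracket.
  have h3 : ∀ (i : Fin n) (m : Fin (n + 1)), m ≥ i.succ →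
      cx x (ψ x) (Matrix.vecCons (bracket (Matrix.vecCons (Zbar a b c j) w i.succ.castSucc)
        (Matrix.vecCons (Zbar a b c j) w m.succ))
        (m.removeNth (i.succ.castSucc.removeNth (Matrix.vecCons (Zbar a b c j) w)))) = 0 := by
    intro i m hm
    obtain ⟨n, rfl⟩ : ∃ n', n = n' + 1 := ⟨n - 1, by have := i.2; omega⟩
    have hm0 : m ≠ 0 := fun h => by
      rw [h] at hm
      exact absurd hm (by simp)
    refine cx_eq_zero_of_Zbar ha hc x (hJ x) (m := 1) (j := j) ?_
    change (m.removeNth (i.succ.castSucc.removeNth (Matrix.vecCons (Zbar a b c j) w))) 0 = _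
    simp only [Fin.removeNth, Fin.succAbove_ne_zero_zero hm0]
    rw [Fin.succAbove_ne_zero_zero (Fin.castSucc_ne_zero_iff.mpr (Fin.succ_ne_zero i))]
    rfl
  rw [Finset.sum_eq_zero (s := (Finset.univ : Finset (Fin n))) (fun i _ => Finset.sum_eq_zero
    fun m hm => by rw [h3 i m (Finset.mem_Ici.mp hm), mul_zero]), add_zero]
  congr 1
  · simp
  · refine Finset.sum_congr (by ext; simp) fun m _ => ?_
    simp only [Fin.castSucc_zero, h2]
    simp

/-- The coefficients of the `(1,0)`-part of the brackets `[Z̄_j, Z_i]`. -/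
def structZ (a c : ℝ) : Fin 3 → Fin 3 → Fin 3 → ℂ :=
  ![![![0, 0, 0], ![0, 0, c / 4], ![0, c / 4, 0]],
    ![![0, -1 / (2 * a), -c / 4], ![0, 0, 0], ![0, 0, 0]],
    ![![0, -c / 4, 1 / (2 * a)], ![0, 0, 0], ![0, 0, 0]]]

/-- The coefficients of the `(0,1)`-part of the brackets `[Z̄_j, Z_i]`. -/
def structZbar (a c : ℝ) : Fin 3 → Fin 3 → Fin 3 → ℂ :=
  ![![![0, 0, 0], ![0, 1 / (2 * a), c / 4], ![0, c / 4, -1 / (2 * a)]],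
    ![![0, 0, -c / 4], ![0, 0, 0], ![0, 0, 0]],
    ![![0, -c / 4, 0], ![0, 0, 0], ![0, 0, 0]]]

/-- The `(0,1)`-part is recorded only to state the identity: it is invisible to `(p,0)`-forms, so
`structZ` alone governs `∂̄` on them. -/
theorem bracket_Zbar_Z {a : ℝ} (ha : a ≠ 0) (b c : ℝ) (j i : Fin 3) :
    bracket (Zbar a b c j) (Z a b c i)
      = ∑ l, structZ a c j i l • Z a b c l + ∑ l, structZbar a c j i l • Zbar a b c l := by
  have ha' : (a : ℂ) ≠ 0 := by exact_mod_cast ha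
  have hI : Complex.I ^ 2 = -1 := Complex.I_sq
  ext r
  simp only [Fin.sum_univ_three]
  fin_cases j <;> fin_cases i <;> fin_cases r <;>
    simp [bracket, Zbar, Z, structZ, structZbar] <;> field_simp <;> ring_nf <;>
    simp only [hI] <;> ring

/-- The coefficients of a form of type `(p,0)` in the coframe dual to `Z₁, Z₂, Z₃`. -/
def coef (a b c : ℝ) {k : ℕ} (ψ : Form k) (I : Fin k → Fin 3) (y : E) : ℂ :=
  cx y (ψ y) (fun m => Z a b c (I m))

theorem coef_swap (a b c : ℝ) {k : ℕ} (ψ : Form k) (I : Fin k → Fin 3) {i j : Fin k} (hij : i ≠ j)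
    (y : E) : coef a b c ψ (fun m => I (Equiv.swap i j m)) y = -coef a b c ψ I y :=
  cx_swap y (ψ y) (fun m => Z a b c (I m)) hij

theorem coef_eq_zero (a b c : ℝ) {k : ℕ} (ψ : Form k) {I : Fin k → Fin 3} {i j : Fin k}
    (hij : i ≠ j) (h : I i = I j) (y : E) : coef a b c ψ I y = 0 :=
  cx_eq_zero_of_eq y (ψ y) hij (congrArg (Z a b c) h)

theorem coef_add (a b c : ℝ) {k : ℕ} (ψ χ : Form k) (I : Fin k → Fin 3) (y : E) :
    coef a b c (ψ + χ) I y = coef a b c ψ I y + coef a b c χ I y := cx_add _ _ _ _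

theorem coef_smul (a b c : ℝ) {k : ℕ} (r : ℂ) (ψ : Form k) (I : Fin k → Fin 3) (y : E) :
    coef a b c (r • ψ) I y = r * coef a b c ψ I y := cx_smul _ _ _ _

/-- An alternating family is determined by its values at increasing indices. -/
theorem eq_zero_of_strictMono {k : ℕ} {T : (Fin k → Fin 3) → ℂ}
    (hT : ∀ I (σ : Equiv.Perm (Fin k)), T (I ∘ σ) = (Equiv.Perm.sign σ : ℤ) • T I)
    (h0 : ∀ I, StrictMono I → T I = 0) (I : Fin k → Fin 3) : T I = 0 := by
  by_cases hI : Function.Injective I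
  · have h1 := hT I (Tuple.sort I)
    rw [h0 _ ((Tuple.monotone_sort I).strictMono_of_injective
      (hI.comp (Tuple.sort I).injective))] at h1
    rcases Int.units_eq_one_or (Equiv.Perm.sign (Tuple.sort I)) with h2 | h2 <;>
      simpa [h2] using h1.symm
  · simp only [Function.Injective, not_forall] at hI
    obtain ⟨i, j, hij, hne⟩ := hI
    have h1 := hT I (Equiv.swap i j)
    have h2 : I ∘ Equiv.swap i j = I := by
      funext m
      rw [Function.comp_apply, Equiv.swap_apply_def]
      split_ifs with h3 h4
      · rw [h3, hij]
      · rw [h4, hij]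
      · rfl
    rw [h2, Equiv.Perm.sign_swap hne] at h1
    simp at h1
    linear_combination h1 / 2

theorem cx_vecCons_perm (x : E) {k : ℕ} (α : E [⋀^Fin (k + 1)]→L[ℝ] ℂ) (v : Fin 6 → ℂ)
    (w : Fin k → Fin 6 → ℂ) (σ : Equiv.Perm (Fin k)) :
    cx x α (Matrix.vecCons v fun m => w (σ m))
      = (Equiv.Perm.sign σ : ℤ) • cx x α (Matrix.vecCons v w) := by
  -- This permutation fixes slot `0` and acts as `σ` on the others, so its sign is that of `σ`.
  have h := cx_comp_perm x α (Matrix.vecCons v w) (Equiv.Perm.decomposeFin.symm (0, σ))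
  rw [Equiv.Perm.decomposeFin.symm_sign, if_pos rfl, one_mul] at h
  rw [← h]
  congr 1
  funext m
  refine Fin.cases ?_ (fun m => ?_) m <;> simp

theorem typeProj_one_eq_zero_iff_strictMono {a b c : ℝ} (ha : a ≠ 0) (hc : c ≠ 0) (x : E) {p : ℕ}
    (α : E [⋀^Fin (p + 1)]→L[ℝ] ℂ) :
    typeProj (J a b c x) p 1 α = 0 ↔ ∀ (j : Fin 3) (I : Fin p → Fin 3), StrictMono I →
      cx x α (Matrix.vecCons (Zbar a b c j) fun m => Z a b c (I m)) = 0 := by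
  rw [typeProj_one_eq_zero_iff ha hc]
  refine forall_congr' fun j => ⟨fun h I _ => h I, fun h => ?_⟩
  exact eq_zero_of_strictMono
    (T := fun I => cx x α (Matrix.vecCons (Zbar a b c j) fun m => Z a b c (I m)))
    (fun I σ => cx_vecCons_perm x α _ (fun m => Z a b c (I m)) σ) h

/-- The first-order system behind all three Hodge numbers. It combines `cx_extDeriv_Zbar` with the
splitting of `[Z̄_j, Z_i]`, whose `(0,1)`-part contributes nothing. -/
theorem dbar_eq_zero_iff {a b c : ℝ} (ha : a ≠ 0) (hc : c ≠ 0) {n : ℕ} {ψ : Form (n + 1)} {x : E}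
    (hψ : DifferentiableAt ℝ ψ x) (hJ : ∀ y, ψ y ∈ bigraded (J a b c y) (n + 1) (n + 1) 0) :
    dbar a b c (n + 1) 0 ψ x = 0 ↔ ∀ (j : Fin 3) (I : Fin (n + 1) → Fin 3), StrictMono I →
      cderiv (Zbar a b c j) (coef a b c ψ I) x = ∑ m : Fin (n + 1), (-1) ^ (m : ℕ) *
        ∑ l, structZ a c j (I m) l * coef a b c ψ (Matrix.vecCons l (m.removeNth I)) x := by
  refine (typeProj_one_eq_zero_iff_strictMono ha hc x (p := n + 1) (extDeriv ψ x)).trans ?_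
  refine forall_congr' fun j => forall_congr' fun I => forall_congr' fun _ => ?_
  rw [cx_extDeriv_Zbar ha hc hψ hJ, sub_eq_zero]
  have h : ∀ m : Fin (n + 1), cx x (ψ x) (Matrix.vecCons (bracket (Zbar a b c j) (Z a b c (I m)))
      (m.removeNth fun m => Z a b c (I m)))
      = ∑ l, structZ a c j (I m) l * coef a b c ψ (Matrix.vecCons l (m.removeNth I)) x := by
    intro m
    rw [bracket_Zbar_Z ha]
    change (cx x (ψ x)).curryLeft _ _ = _
    rw [map_add, map_sum, map_sum, add_apply, sum_apply, sum_apply]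
    have h0 : ∀ l, (cx x (ψ x)).curryLeft (structZbar a c j (I m) l • Zbar a b c l)
        (m.removeNth fun m => Z a b c (I m)) = 0 := fun l => by
      rw [map_smul, smul_apply, MultilinearMap.curryLeft_apply,
        cx_eq_zero_of_Zbar ha hc x (hJ x) (m := 0) (j := l) rfl, smul_zero]
    rw [Finset.sum_eq_zero fun l _ => h0 l, add_zero]
    refine Finset.sum_congr rfl fun l _ => ?_
    rw [map_smul, smul_apply, smul_eq_mul, MultilinearMap.curryLeft_apply, coef]
    congr 2
    funext r
    refine Fin.cases rfl (fun r => rfl) r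
  simp only [h]
  rfl

theorem eq_zero_of_coef_eq_zero {a b c : ℝ} (ha : a ≠ 0) (hc : c ≠ 0) {p : ℕ} {ψ : Form p} {x : E}
    (hJ : ψ x ∈ bigraded (J a b c x) p p 0)
    (h : ∀ I : Fin p → Fin 3, StrictMono I → coef a b c ψ I x = 0) : ψ x = 0 :=
  eq_zero_of_bigraded ha hc x hJ (eq_zero_of_strictMono
    (fun I σ => cx_comp_perm x (ψ x) (fun m => Z a b c (I m)) σ) h)

/-! ### Liouville's theorem along real planes -/

theorem differentiableAt_of_cauchyRiemann {h : ℂ → ℂ} {z : ℂ} (hd : DifferentiableAt ℝ h z)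
    (hcr : fderiv ℝ h z 1 + Complex.I * fderiv ℝ h z Complex.I = 0) : DifferentiableAt ℂ h z := by
  rw [differentiableAt_complex_iff_differentiableAt_real]
  refine ⟨hd, ?_⟩
  rw [smul_eq_mul]
  linear_combination -Complex.I * hcr + fderiv ℝ h z Complex.I * Complex.I_mul_I

/-- A bounded function on the plane whose `∂/∂z̄` is constant is itself constant. -/
theorem eq_zero_and_const_of_bounded {h : ℂ → ℂ} (hd : Differentiable ℝ h) {M : ℝ}
    (hM : ∀ z, ‖h z‖ ≤ M) {C : ℂ}
    (hcr : ∀ z, fderiv ℝ h z 1 + Complex.I * fderiv ℝ h z Complex.I = C) :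
    C = 0 ∧ ∀ z, h z = h 0 := by
  have hC : C = 0 := by
    -- The operator `∂₁ + i ∂_i` sends `z̄` to `2`, so subtracting `(C/2) z̄` from `h` makes it
    -- entire.
    let F : ℂ → ℂ := fun z => h z - C / 2 * (starRingEnd ℂ) z
    have hF : Differentiable ℂ F := by
      intro z
      have h1 : HasFDerivAt (fun z : ℂ => C / 2 * (starRingEnd ℂ) z)
          ((C / 2) • (Complex.conjCLE : ℂ →L[ℝ] ℂ)) z :=
        Complex.conjCLE.hasFDerivAt.const_mul (C / 2)
      have h2 := (hd z).hasFDerivAt.sub h1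
      refine differentiableAt_of_cauchyRiemann h2.differentiableAt ?_
      have h3 : fderiv ℝ F z = fderiv ℝ h z - (C / 2) • (Complex.conjCLE : ℂ →L[ℝ] ℂ) := h2.fderiv
      rw [h3]
      simp
      linear_combination hcr z + C / 2 * Complex.I_mul_I
    -- On the circle of radius `R`, Cauchy's theorem equates `∮ h` with `(C/2) ∮ z̄ dz = πi C R²`,
    -- while boundedness of `h` gives at most `2πRM`.
    have key : ∀ R : ℝ, 0 < R → ‖C‖ * R ≤ 2 * M := by
      intro R hR
      have h1 : (∮ z in C(0, R), F z) = 0 :=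
        hF.diffContOnCl.circleIntegral_eq_zero hR.le
      have h2 : (∮ z in C(0, R), C / 2 * (starRingEnd ℂ) z)
          = C / 2 * R ^ 2 * (2 * Real.pi * Complex.I) := by
        rw [← circleIntegral.integral_sub_center_inv 0 hR.ne', ← smul_eq_mul,
          ← circleIntegral.integral_smul]
        refine circleIntegral.integral_congr hR.le fun z hz => ?_
        have hz' : ‖z‖ = R := by simpa using hz
        have hz0 : z ≠ 0 := by
          rintro rfl
          simp at hz'
          exact hR.ne hz'
        have h3 : z * (starRingEnd ℂ) z = (R : ℂ) ^ 2 := by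
          rw [Complex.mul_conj, Complex.normSq_eq_norm_sq, hz']
          push_cast
          rfl
        simp only [sub_zero, smul_eq_mul]
        rw [← h3]
        field_simp
      have h4 : (∮ z in C(0, R), F z)
          = (∮ z in C(0, R), h z) - ∮ z in C(0, R), C / 2 * (starRingEnd ℂ) z := by
        refine circleIntegral.integral_sub ?_ ?_
        · exact hd.continuous.continuousOn.circleIntegrable hR.le
        · exact (continuous_const.mul Complex.continuous_conj).continuousOn.circleIntegrable hR.le
      have h5 : ‖∮ z in C(0, R), h z‖ ≤ 2 * Real.pi * R * M :=
        circleIntegral.norm_integral_le_of_norm_le_const hR.le fun z _ => hM z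
      rw [h1, h2] at h4
      rw [sub_eq_zero.mp h4.symm] at h5
      simp only [norm_mul, norm_div, Complex.norm_I, norm_pow, Complex.norm_real,
        Complex.norm_ofNat, mul_one, Real.norm_eq_abs, abs_of_pos hR, abs_of_pos Real.pi_pos] at h5
      have hpos : 0 < Real.pi * R := by positivity
      have h6 : (Real.pi * R) * (‖C‖ * R) ≤ (Real.pi * R) * (2 * M) := by linarith
      exact le_of_mul_le_mul_left h6 hpos
    by_contra hne
    have hpos : 0 < ‖C‖ := norm_pos_iff.mpr hne
    have hM0 : 0 ≤ M := (norm_nonneg _).trans (hM 0)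
    -- For this radius the estimate would read `2M + 1 ≤ 2M`.
    have h7 := key ((2 * M + 1) / ‖C‖) (by positivity)
    rw [mul_div_cancel₀ _ hpos.ne'] at h7
    linarith
  refine ⟨hC, fun z => ?_⟩
  have hF : Differentiable ℂ h := fun z =>
    differentiableAt_of_cauchyRiemann (hd z) ((hcr z).trans hC)
  refine hF.apply_eq_apply_of_bounded ?_ z 0
  exact (Metric.isBounded_closedBall (x := (0 : ℂ)) (r := M)).subset
    (Set.range_subset_iff.mpr fun z => by simpa using hM z)

/-- The parametrized plane through `p` spanned by `u` and `v`. -/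
def plane (p u v : E) (z : ℂ) : E := p + z.re • u + z.im • v

theorem hasFDerivAt_plane (p u v : E) (z : ℂ) :
    HasFDerivAt (plane p u v) (Complex.reCLM.smulRight u + Complex.imCLM.smulRight v) z := by
  have h1 := (Complex.reCLM.smulRight u).hasFDerivAt (x := z)
  have h2 := (Complex.imCLM.smulRight v).hasFDerivAt (x := z)
  exact (h1.const_add p).add h2

/-- A bounded function with constant `∂/∂z̄` along a plane is constant there. -/
theorem eq_zero_and_const_on_plane {f : E → ℂ} (hf : Differentiable ℝ f) {M : ℝ}
    (hM : ∀ y, ‖f y‖ ≤ M) (p u v : E) {C : ℂ}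
    (hcr : ∀ z, fderiv ℝ f (plane p u v z) u + Complex.I * fderiv ℝ f (plane p u v z) v = C) :
    C = 0 ∧ ∀ s r : ℝ, f (p + s • u + r • v) = f p := by
  have hd : ∀ z, HasFDerivAt (fun z => f (plane p u v z)) ((fderiv ℝ f (plane p u v z)).comp
      (Complex.reCLM.smulRight u + Complex.imCLM.smulRight v)) z := fun z =>
    (hf (plane p u v z)).hasFDerivAt.comp z (hasFDerivAt_plane p u v z)
  obtain ⟨h1, h2⟩ := eq_zero_and_const_of_bounded (fun z => (hd z).differentiableAt)
    (fun z => hM (plane p u v z)) (C := C) (fun z => by rw [(hd z).fderiv]; simpa using hcr z)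
  refine ⟨h1, fun s r => ?_⟩
  have := h2 ⟨s, r⟩
  simpa [plane] using this

/-! ### `Γ`-invariant functions -/

/-- The linear part of the left translation by `g`. -/
def leftLin (g : E) : E →L[ℝ] E :=
  LinearMap.toContinuousLinearMap
    { toFun := fun v => ![v 0, v 1,
        v 2 * Real.exp (g 0) + g 1 * v 4 * Real.exp (g 0),
        v 3 * Real.exp (-g 0) + g 1 * v 5 * Real.exp (-g 0),
        v 4 * Real.exp (g 0), v 5 * Real.exp (-g 0)]
      map_add' := fun v w => by
        ext i
        fin_cases i <;> simp <;> ring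
      map_smul' := fun r v => by
        ext i
        fin_cases i <;> simp <;> ring }

theorem leftLin_apply (g v : E) : leftLin g v = ![v 0, v 1,
    v 2 * Real.exp (g 0) + g 1 * v 4 * Real.exp (g 0),
    v 3 * Real.exp (-g 0) + g 1 * v 5 * Real.exp (-g 0),
    v 4 * Real.exp (g 0), v 5 * Real.exp (-g 0)] := rfl

theorem gmul_eq_leftLin (g v : E) : gmul g v = leftLin g v + g := by
  ext i
  fin_cases i <;> simp [gmul, leftLin_apply] <;> ring

theorem hasFDerivAt_leftTrans (γ : G) (x : E) :
    HasFDerivAt (leftTrans γ) (leftLin γ.coords) x := by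
  have h : leftTrans γ = fun v => leftLin γ.coords v + γ.coords :=
    funext fun v => gmul_eq_leftLin _ _
  rw [h]
  exact (leftLin γ.coords).hasFDerivAt.add_const _

theorem contDiff_leftTrans (γ : G) : ContDiff ℝ ∞ (leftTrans γ) := by
  have h : leftTrans γ = fun v => leftLin γ.coords v + γ.coords :=
    funext fun v => gmul_eq_leftLin _ _
  rw [h]
  exact (leftLin γ.coords).contDiff.add contDiff_const

theorem leftLin_frame (g x : E) (i : Fin 6) : leftLin g (frame x i) = frame (gmul g x) i := by
  ext j
  fin_cases i <;> fin_cases j <;> simp [leftLin_apply, frame, gmul, Real.exp_add] <;> ring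

theorem fderiv_leftTrans_frame (γ : G) (x : E) (i : Fin 6) :
    fderiv ℝ (leftTrans γ) x (frame x i) = frame (leftTrans γ x) i := by
  rw [(hasFDerivAt_leftTrans γ x).fderiv, leftLin_frame]
  rfl

/-- The invariance of a function on `G` under the lattice. -/
def IsLatticeInvariant (D : LatticeData) (f : E → ℂ) : Prop :=
  ∀ γ ∈ D.lattice, ∀ x, f (leftTrans γ x) = f x

/-- Compactness of `X`: every value of an invariant function is attained on the relatively compact
fundamental domain. -/
theorem IsLatticeInvariant.exists_bound {D : LatticeData} {f : E → ℂ}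
    (h : IsLatticeInvariant D f) (hf : Continuous f) : ∃ M, ∀ x, ‖f x‖ ≤ M := by
  obtain ⟨K, hK, hDK⟩ := D.exists_isCompact_fundDomain
  obtain ⟨M, hM⟩ := hK.exists_bound_of_continuousOn hf.continuousOn
  refine ⟨M, fun x => ?_⟩
  obtain ⟨γ, ⟨hγ, hx⟩, -⟩ := D.existsUnique_mem_fundDomain x
  rw [← h γ hγ x]
  exact hM _ (hDK hx)

/-- Left translations preserve the frame, so an invariant form has invariant coefficients. The bound
needed for Liouville follows. -/
theorem isLatticeInvariant_coef {D : LatticeData} {a b c : ℝ} {p : ℕ} {ψ : Form (p + 0)}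
    (hψ : ψ ∈ forms D a b c p 0) (I : Fin p → Fin 3) :
    IsLatticeInvariant D (coef a b c (k := p) ψ I) := by
  intro γ hγ x
  have h := hψ.2.1 γ hγ x
  unfold coef
  rw [cx_apply, cx_apply]
  refine Finset.sum_congr rfl fun K _ => ?_
  congr 1
  simp only [← fderiv_leftTrans_frame]
  exact congrArg (fun α => α fun m => frame x (K m)) h

theorem differentiable_coef {a b c : ℝ} {k : ℕ} {ψ : Form k} (hψ : Differentiable ℝ ψ)
    (I : Fin k → Fin 3) : Differentiable ℝ (coef a b c ψ I) := by
  intro x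
  unfold coef
  simp only [cx_apply]
  exact DifferentiableAt.fun_sum fun K _ =>
    (differentiableAt_apply_frame (hψ x) K).mul_const _

/-! ### Cauchy–Riemann equations in the fibres and in the base -/

/-- Here and in the next two lemmas `Z̄_j = (u + i v)/2` with real fields `u` and `v = J u`, the
shape of a Cauchy–Riemann operator on the plane spanned by `u` and `v`. -/
theorem cderiv_Zbar_zero (a b c : ℝ) (f : E → ℂ) (x : E) :
    cderiv (Zbar a b c 0) f x = (fderiv ℝ f x ((1 / a) • frame x 0)
      + Complex.I * fderiv ℝ f x (frame x 1)) / 2 := by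
  simp [cderiv, Fin.sum_univ_six, Zbar]
  ring

theorem cderiv_Zbar_one (a b c : ℝ) (f : E → ℂ) (x : E) :
    cderiv (Zbar a b c 1) f x = (fderiv ℝ f x (frame x 2)
      + Complex.I * fderiv ℝ f x (c • frame x 5)) / 2 := by
  simp [cderiv, Fin.sum_univ_six, Zbar]
  ring

theorem cderiv_Zbar_two (a b c : ℝ) (f : E → ℂ) (x : E) :
    cderiv (Zbar a b c 2) f x = (fderiv ℝ f x (frame x 3)
      + Complex.I * fderiv ℝ f x (c • frame x 4 - b • frame x 2)) / 2 := by
  simp [cderiv, Fin.sum_univ_six, Zbar]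
  ring

/-- The frame depends on `t` and `x` only. Along a fibre it is constant, so the planes tangent to
`Z̄₂` or `Z̄₃` are affine. -/
theorem frame_congr {p q : E} (h0 : q 0 = p 0) (h1 : q 1 = p 1) : frame q = frame p := by
  simp only [frame, h0, h1]

theorem const_of_cderiv_Zbar_one {a b c : ℝ} {f : E → ℂ} (hf : Differentiable ℝ f) {M : ℝ}
    (hM : ∀ y, ‖f y‖ ≤ M) (p : E) {C : ℂ}
    (h : ∀ q : E, q 0 = p 0 → q 1 = p 1 → cderiv (Zbar a b c 1) f q = C) :
    C = 0 ∧ ∀ s r : ℝ, f (p + s • frame p 2 + r • (c • frame p 5)) = f p := by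
  -- The constant is `2 * C` because `Z̄₂` carries a factor `1/2`.
  have h1 := eq_zero_and_const_on_plane hf hM p (frame p 2) (c • frame p 5) (C := 2 * C) ?_
  · exact ⟨by simpa using h1.1, h1.2⟩
  · intro z
    have e0 : plane p (frame p 2) (c • frame p 5) z 0 = p 0 := by
      simp [plane, frame, Matrix.vecHead, Matrix.vecTail]
    have e1 : plane p (frame p 2) (c • frame p 5) z 1 = p 1 := by
      simp [plane, frame, Matrix.vecHead, Matrix.vecTail]
    have := h _ e0 e1
    rw [cderiv_Zbar_one, frame_congr e0 e1] at this
    rw [← this]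
    ring

theorem const_of_cderiv_Zbar_two {a b c : ℝ} {f : E → ℂ} (hf : Differentiable ℝ f) {M : ℝ}
    (hM : ∀ y, ‖f y‖ ≤ M) (p : E) {C : ℂ}
    (h : ∀ q : E, q 0 = p 0 → q 1 = p 1 → cderiv (Zbar a b c 2) f q = C) :
    C = 0 ∧ ∀ s r : ℝ, f (p + s • frame p 3 + r • (c • frame p 4 - b • frame p 2)) = f p := by
  have h1 := eq_zero_and_const_on_plane hf hM p (frame p 3) (c • frame p 4 - b • frame p 2)
    (C := 2 * C) ?_
  · exact ⟨by simpa using h1.1, h1.2⟩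
  · intro z
    have e0 : plane p (frame p 3) (c • frame p 4 - b • frame p 2) z 0 = p 0 := by
      simp [plane, frame, Matrix.vecHead, Matrix.vecTail]
    have e1 : plane p (frame p 3) (c • frame p 4 - b • frame p 2) z 1 = p 1 := by
      simp [plane, frame, Matrix.vecHead, Matrix.vecTail]
    have := h _ e0 e1
    rw [cderiv_Zbar_two, frame_congr e0 e1] at this
    rw [← this]
    ring

/-- A bounded function that is holomorphic along the fibres is constant along the fibres. -/
theorem fibre_const {a b c : ℝ} (hc : c ≠ 0) {f : E → ℂ} (hf : Differentiable ℝ f) {M : ℝ}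
    (hM : ∀ y, ‖f y‖ ≤ M) (h1 : ∀ q, cderiv (Zbar a b c 1) f q = 0)
    (h2 : ∀ q, cderiv (Zbar a b c 2) f q = 0) {p q : E} (e0 : q 0 = p 0) (e1 : q 1 = p 1) :
    f q = f p := by
  set κ : Fin 6 → ℝ := fun i => coframe p i (q - p) with hκ
  -- An intermediate point: move from `p` to `r` in the plane of `Z̄₂`, then from `r` to `q` in the
  -- plane of `Z̄₃`. The term `b κ₅ / c`, with `κ₅ = κ 4`, cancels the `-b e₃` picked up in the
  -- second move.
  obtain ⟨r, hr⟩ : ∃ r : E, r = p + (κ 2 + b * κ 4 / c) • frame p 2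
    + (κ 5 / c) • (c • frame p 5) := ⟨_, rfl⟩
  have r0 : r 0 = p 0 := by simp [hr, frame, Matrix.vecHead, Matrix.vecTail]
  have r1 : r 1 = p 1 := by simp [hr, frame, Matrix.vecHead, Matrix.vecTail]
  have hfr : frame r = frame p := frame_congr r0 r1
  have k0 : κ 0 = 0 := by simp [hκ, coframe, e0]
  have k1 : κ 1 = 0 := by simp [hκ, coframe, e1]
  have hq : q = r + κ 3 • frame r 3 + (κ 4 / c) • (c • frame r 4 - b • frame r 2) := by
    have h := sum_coframe_smul_frame p (q - p)
    have h' : q = p + ∑ i, κ i • frame p i := by rw [hκ]; simp only [h]; abel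
    conv_lhs => rw [h']
    rw [hfr, hr, Fin.sum_univ_six, k0, k1]
    ext i
    simp
    field_simp
    ring
  have f1 := (const_of_cderiv_Zbar_one hf hM p fun q _ _ => h1 q).2
    (κ 2 + b * κ 4 / c) (κ 5 / c)
  have f2 := (const_of_cderiv_Zbar_two hf hM r fun q _ _ => h2 q).2 (κ 3) (κ 4 / c)
  rw [hq, f2, hr, f1]

/-- A bounded function on the base on which `Z̄₁` acts by the real scalar `κ`. -/
theorem base_eigenfunction {a b c : ℝ} (ha : a ≠ 0) {f : E → ℂ} (hf : Differentiable ℝ f) {M : ℝ}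
    (hM : ∀ y, ‖f y‖ ≤ M) (hfib : ∀ p q : E, q 0 = p 0 → q 1 = p 1 → f q = f p) (κ : ℝ)
    (h : ∀ q, cderiv (Zbar a b c 0) f q = κ * f q) (q : E) :
    f q = f 0 * Complex.exp (-(2 * κ * q 1) * Complex.I) := by
  -- An integrating factor: `Z̄₁ e = (i/2)(2iκ) e = -κ e`, so `Z̄₁` kills `f e`. As `κ` is real,
  -- `|e| = 1` and `f e` stays bounded.
  let e : E → ℂ := fun y => Complex.exp ((2 * κ * y 1 : ℝ) * Complex.I)
  have he : ∀ y, HasFDerivAt e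
      ((e y * (2 * κ * Complex.I)) • (Complex.ofRealCLM.comp
        (ContinuousLinearMap.proj 1 : E →L[ℝ] ℝ))) y := by
    intro y
    have h1 : HasFDerivAt (fun y : E => ((y 1 : ℝ) : ℂ)) (Complex.ofRealCLM.comp
        (ContinuousLinearMap.proj 1 : E →L[ℝ] ℝ)) y :=
      (Complex.ofRealCLM.comp (ContinuousLinearMap.proj 1 : E →L[ℝ] ℝ)).hasFDerivAt
    have h2 := (h1.const_mul (2 * κ * Complex.I)).cexp
    have h3 : e = fun y : E => Complex.exp (2 * κ * Complex.I * ((y 1 : ℝ) : ℂ)) := by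
      funext y
      simp only [e]
      congr 1
      push_cast
      ring
    rw [h3]
    refine h2.congr_fderiv ?_
    rw [smul_smul]
  have hn : ∀ y, ‖e y‖ = 1 := fun y => Complex.norm_exp_ofReal_mul_I _
  have hd : ∀ y, HasFDerivAt (fun y => f y * e y) _ y := fun y => (hf y).hasFDerivAt.mul (he y)
  obtain ⟨-, hconst⟩ := eq_zero_and_const_on_plane (fun y => (hd y).differentiableAt) (M := M)
    (fun y => by rw [norm_mul, hn, mul_one]; exact hM y) 0 ((1 / a) • frame 0 0) (frame 0 1)
    (C := 0) (fun z => by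
      set y := plane 0 ((1 / a) • frame 0 0) (frame 0 1) z
      have h1 := h y
      rw [cderiv_Zbar_zero] at h1
      have e0 : frame y 0 = frame 0 0 := by simp [frame]
      have e1 : frame y 1 = frame 0 1 := by simp [frame]
      rw [e0, e1] at h1
      rw [(hd y).fderiv]
      have u0 : (((1 / a) • frame 0 0 : E) 1) = 0 := by simp [frame]
      have u1 : ((frame 0 1 : E) 1) = 1 := by simp [frame]
      simp only [add_apply, smul_apply, smul_eq_mul, ContinuousLinearMap.comp_apply,
        ContinuousLinearMap.proj_apply, Complex.ofRealCLM_apply, u0, u1]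
      push_cast
      linear_combination 2 * e y * h1 + 2 * κ * e y * f y * Complex.I_mul_I)
  have h1 := hconst (a * q 0) (q 1)
  -- Liouville applies to the `(t,x)`-plane through the origin; constancy on fibres carries the
  -- value at the point of that plane with the same `t, x` over to `q`.
  have h2 : f q = f (0 + (a * q 0) • ((1 / a) • frame 0 0) + q 1 • frame 0 1) :=
    hfib _ _ (by simp [frame]; field_simp) (by simp [frame])
  have h3 : e (0 + (a * q 0) • ((1 / a) • frame 0 0) + q 1 • frame 0 1)
      = Complex.exp (2 * κ * q 1 * Complex.I) := by
    simp [e, frame]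
  have h4 : e 0 = 1 := by simp [e]
  rw [← h2, h3, h4, mul_one] at h1
  rw [← h1, mul_assoc, ← Complex.exp_add]
  ring_nf
  simp

/-- The translation of the `x`-coordinate by one period. -/
def unitShift : G := (![0, 1, 0, 0, 0, 0] : E)

theorem unitShift_mem (D : LatticeData) : unitShift ∈ D.lattice := by
  refine ⟨0, 1, 0, 0, ?_, ?_, ?_, ?_⟩
  · change (![0, 1, 0, 0, 0, 0] : E) 0 = _; simp
  · change (![0, 1, 0, 0, 0, 0] : E) 1 = _; simp
  · change ![(![0, 1, 0, 0, 0, 0] : E) 2, (![0, 1, 0, 0, 0, 0] : E) 3] = _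
    ext i; fin_cases i <;> simp [LatticeData.vec, Matrix.mulVec, dotProduct]
  · change ![(![0, 1, 0, 0, 0, 0] : E) 4, (![0, 1, 0, 0, 0, 0] : E) 5] = _
    ext i; fin_cases i <;> simp [LatticeData.vec, Matrix.mulVec, dotProduct]

theorem leftTrans_unitShift_zero : leftTrans unitShift 0 = ![0, 1, 0, 0, 0, 0] := by
  ext i
  fin_cases i <;> simp [leftTrans, gmul, unitShift, G.coords]

/-! ### Positivity of the `L²` product -/

theorem top_le_span_orthoFrame {a c : ℝ} (ha : a ≠ 0) (b : ℝ) (hc : c ≠ 0) (x : E) :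
    ⊤ ≤ Submodule.span ℝ (Set.range (orthoFrame a b c x)) := by
  have h : ∀ i, orthoFrame a b c x i ∈ Submodule.span ℝ (Set.range (orthoFrame a b c x)) :=
    fun i => Submodule.subset_span ⟨i, rfl⟩
  have hf : ∀ i, frame x i ∈ Submodule.span ℝ (Set.range (orthoFrame a b c x)) := by
    have e0 : frame x 0 = a • orthoFrame a b c x 0 := by simp [orthoFrame, ha]
    have e1 : frame x 1 = orthoFrame a b c x 1 := by simp [orthoFrame]
    have e2 : frame x 2 = c • orthoFrame a b c x 2 := by simp [orthoFrame, hc]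
    have e3 : frame x 3 = c • orthoFrame a b c x 3 := by simp [orthoFrame, hc]
    have e4 : frame x 4 = orthoFrame a b c x 4 + b • orthoFrame a b c x 2 := by
      simp [orthoFrame, smul_smul, div_eq_mul_inv]
    have e5 : frame x 5 = orthoFrame a b c x 5 := by simp [orthoFrame]
    intro i
    fin_cases i
    · exact e0 ▸ Submodule.smul_mem _ _ (h 0)
    · exact e1 ▸ h 1
    · exact e2 ▸ Submodule.smul_mem _ _ (h 2)
    · exact e3 ▸ Submodule.smul_mem _ _ (h 3)
    · exact e4 ▸ Submodule.add_mem _ (h 4) (Submodule.smul_mem _ _ (h 2))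
    · exact e5 ▸ h 5
  intro v _
  rw [← sum_coframe_smul_frame x v]
  exact Submodule.sum_mem _ fun i _ => Submodule.smul_mem _ _ (hf i)

theorem eq_zero_of_orthoFrame {a b c : ℝ} (ha : a ≠ 0) (hc : c ≠ 0) (x : E) {k : ℕ}
    {α : E [⋀^Fin k]→L[ℝ] ℂ}
    (h : ∀ I : Fin k → Fin 6, α (fun m => orthoFrame a b c x (I m)) = 0) : α = 0 := by
  let B := basisOfTopLeSpanOfCardEqFinrank (orthoFrame a b c x) (top_le_span_orthoFrame ha b hc x)
    (by simp)
  have hB : ∀ i, B i = orthoFrame a b c x i := fun i => by simp [B]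
  have h0 : α.toContinuousMultilinearMap.toMultilinearMap = 0 := by
    refine Module.Basis.ext_multilinear (fun _ => B) fun I => ?_
    simp only [hB]
    exact h I
  ext v
  exact congrArg (fun f : MultilinearMap ℝ (fun _ : Fin k => E) ℂ => f v) h0

theorem hermProd_self (a b c : ℝ) (x : E) {k : ℕ} (α : E [⋀^Fin k]→L[ℝ] ℂ) :
    hermProd a b c x α α = ((1 / (k.factorial : ℝ) * ∑ I : Fin k → Fin 6,
      Complex.normSq (α (fun i => orthoFrame a b c x (I i))) : ℝ) : ℂ) := by
  simp only [hermProd, Complex.mul_conj]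
  push_cast
  rfl

theorem eq_zero_of_hermProd_self {a b c : ℝ} (ha : a ≠ 0) (hc : c ≠ 0) (x : E) {k : ℕ}
    {α : E [⋀^Fin k]→L[ℝ] ℂ} (h : hermProd a b c x α α = 0) : α = 0 := by
  refine eq_zero_of_orthoFrame (b := b) ha hc x fun I => ?_
  rw [hermProd_self, Complex.ofReal_eq_zero, mul_eq_zero] at h
  have h1 := h.resolve_left (by positivity)
  rw [Finset.sum_eq_zero_iff_of_nonneg fun I _ => Complex.normSq_nonneg _] at h1
  exact Complex.normSq_eq_zero.mp (h1 I (Finset.mem_univ I))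

/-- The metric as a bilinear map. -/
def metricBilin (a b c : ℝ) (x : E) : E →ₗ[ℝ] E →ₗ[ℝ] ℝ :=
  LinearMap.mk₂ ℝ (metric a b c x)
    (fun _ _ _ => by simp only [metric, omega, wedge₂, map_add]; ring)
    (fun _ _ _ => by simp only [metric, omega, wedge₂, map_smul, smul_eq_mul]; ring)
    (fun _ _ _ => by simp only [metric, omega, wedge₂, map_add]; ring)
    (fun _ _ _ => by simp only [metric, omega, wedge₂, map_smul, smul_eq_mul]; ring)

/-- For the matrix `U` of the orthonormal frame, `Uᵀ M U = 1`, hence `det M · (det U)² = 1`. -/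
theorem volDensity_pos {a b c : ℝ} (ha : a ≠ 0) (hc : c ≠ 0) (x : E) : 0 < volDensity a b c x := by
  refine Real.sqrt_pos.mpr ?_
  set M : Matrix (Fin 6) (Fin 6) ℝ := Matrix.of fun i j : Fin 6 =>
    metric a b c x (Pi.single i 1) (Pi.single j 1) with hM
  have hM' : M = LinearMap.toMatrix₂' ℝ (metricBilin a b c x) := by
    ext i j
    rw [LinearMap.toMatrix₂'_apply]
    rfl
  let U : Matrix (Fin 6) (Fin 6) ℝ := Matrix.of fun i j => orthoFrame a b c x j i
  have hU : ∀ j, Matrix.toLin' U (Pi.single j 1) = orthoFrame a b c x j := fun j => by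
    ext i
    simp [U]
  have h1 : U.transpose * M * U = 1 := by
    have h2 := LinearMap.toMatrix₂'_compl₁₂ (R := ℝ) (metricBilin a b c x) (Matrix.toLin' U)
      (Matrix.toLin' U)
    rw [LinearMap.toMatrix'_toLin', ← hM'] at h2
    rw [← h2]
    ext i j
    rw [LinearMap.toMatrix₂'_apply, LinearMap.compl₁₂_apply, hU, hU, Matrix.one_apply]
    exact metric_orthoFrame ha hc x i j
  have h3 := congrArg Matrix.det h1
  rw [Matrix.det_mul, Matrix.det_mul, Matrix.det_transpose, Matrix.det_one] at h3
  have h4 : U.det ≠ 0 := fun h => by simp [h] at h3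
  have h5 : 0 < U.det ^ 2 := by positivity
  by_contra hneg
  nlinarith

/-! ### The fundamental domain -/

/-- A convex set with nonempty interior lies in the closure of that interior. This turns
almost-everywhere vanishing of a continuous function on the domain into vanishing at each of its
points, boundary faces included. -/
theorem LatticeData.convex_fundDomain (D : LatticeData) : Convex ℝ D.fundDomain := by
  rintro g ⟨s, hs, g0, g1, g2, g3⟩ h ⟨r, hr, h0, h1, h2, h3⟩ u v hu hv huv
  refine ⟨u • s + v • r, fun i => (convex_Ico (0 : ℝ) 1) (hs i) (hr i) hu hv huv, ?_, ?_, ?_, ?_⟩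
  · simp only [Pi.add_apply, Pi.smul_apply, smul_eq_mul, g0, h0]; ring
  · simp only [Pi.add_apply, Pi.smul_apply, smul_eq_mul, g1, h1]
  · have e : ![(u • s + v • r) 2, (u • s + v • r) 3] = u • ![s 2, s 3] + v • ![r 2, r 3] := by
      ext i; fin_cases i <;> simp
    rw [e, Matrix.mulVec_add, Matrix.mulVec_smul, Matrix.mulVec_smul, ← g2, ← h2]
    ext i; fin_cases i <;> simp
  · have e : ![(u • s + v • r) 4, (u • s + v • r) 5] = u • ![s 4, s 5] + v • ![r 4, r 5] := by
      ext i; fin_cases i <;> simp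
    rw [e, Matrix.mulVec_add, Matrix.mulVec_smul, Matrix.mulVec_smul, ← g3, ← h3]
    ext i; fin_cases i <;> simp

theorem LatticeData.interior_fundDomain_nonempty (D : LatticeData) :
    (interior D.fundDomain).Nonempty := by
  set P := (D.P : Matrix (Fin 2) (Fin 2) ℝ) with hP
  set Q := ((D.P⁻¹ : GL (Fin 2) ℝ) : Matrix (Fin 2) (Fin 2) ℝ) with hQ
  have hPQ : P * Q = 1 := by
    rw [hP, hQ, ← Units.val_mul, mul_inv_cancel, Units.val_one]
  have hQP : Q * P = 1 := by
    rw [hP, hQ, ← Units.val_mul, inv_mul_cancel, Units.val_one]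
  have eta : ∀ v : Fin 2 → ℝ, ![v 0, v 1] = v := fun v => by
    ext i; fin_cases i <;> rfl
  let s : E → E := fun g => ![g 0 / D.a₀, g 1, Q.mulVec ![g 2, g 3] 0, Q.mulVec ![g 2, g 3] 1,
    Q.mulVec ![g 4, g 5] 0, Q.mulVec ![g 4, g 5] 1]
  have hs : Continuous s := by
    refine continuous_pi fun i => ?_
    fin_cases i <;> simp [s, Matrix.mulVec, dotProduct] <;> fun_prop
  have hopen : IsOpen {g | ∀ i, s g i ∈ Set.Ioo (0 : ℝ) 1} := by
    simp only [Set.ofPred_forall]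
    exact isOpen_iInter_of_finite fun i =>
      isOpen_Ioo.preimage ((continuous_apply i).comp hs)
  have hsub : {g | ∀ i, s g i ∈ Set.Ioo (0 : ℝ) 1} ⊆ D.fundDomain := by
    intro g hg
    refine ⟨s g, fun i => Set.Ioo_subset_Ico_self (hg i), ?_, rfl, ?_, ?_⟩
    · have := D.a₀_ne_zero
      simp only [s, Matrix.cons_val_zero]
      field_simp
    · have : ![s g 2, s g 3] = Q.mulVec ![g 2, g 3] :=
        eta (Q.mulVec ![g 2, g 3])
      rw [this, ← hP, Matrix.mulVec_mulVec, hPQ, Matrix.one_mulVec]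
    · have : ![s g 4, s g 5] = Q.mulVec ![g 4, g 5] :=
        eta (Q.mulVec ![g 4, g 5])
      rw [this, ← hP, Matrix.mulVec_mulVec, hPQ, Matrix.one_mulVec]
  let w := P.mulVec ![1 / 2, 1 / 2]
  have hw : Q.mulVec ![w 0, w 1] = ![1 / 2, 1 / 2] := by
    rw [eta, Matrix.mulVec_mulVec, hQP, Matrix.one_mulVec]
  -- The centre of the domain, where all six parameters equal `1/2`.
  refine ⟨![D.a₀ / 2, 1 / 2, w 0, w 1, w 0, w 1], interior_maximal hsub hopen ?_⟩
  have e : s ![D.a₀ / 2, 1 / 2, w 0, w 1, w 0, w 1] = fun _ => 1 / 2 := by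
    have := D.a₀_ne_zero
    ext i
    fin_cases i
    · simp [s]; field_simp
    · simp [s]
    · exact congrFun hw 0
    · exact congrFun hw 1
    · exact congrFun hw 0
    · exact congrFun hw 1
  intro i
  rw [e]
  constructor <;> norm_num

/-! ### Harmonic forms of type `(p,0)` -/

theorem leftLin_J (a b c : ℝ) (g x v : E) :
    J a b c (gmul g x) (leftLin g v) = leftLin g (J a b c x v) := by
  have h : ∀ i, J a b c (gmul g x) (leftLin g (frame x i)) = leftLin g (J a b c x (frame x i)) := by
    intro i
    rw [leftLin_frame, J_frame, J_frame]
    fin_cases i <;> simp [leftLin_frame]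
  rw [← sum_coframe_smul_frame x v]
  simp only [map_sum, map_smul, h]

theorem typeProj_comp_leftLin (a b c : ℝ) (g x : E) {k : ℕ} (p q : ℕ) (α : E [⋀^Fin k]→L[ℝ] ℂ) :
    typeProj (J a b c x) p q (α.compContinuousLinearMap (leftLin g))
      = (typeProj (J a b c (gmul g x)) p q α).compContinuousLinearMap (leftLin g) := by
  ext v
  simp only [typeProj, ContinuousAlternatingMap.smul_apply, ContinuousAlternatingMap.sum_apply,
    ContinuousAlternatingMap.compContinuousLinearMap_apply]
  congr 1
  refine Finset.sum_congr rfl fun j _ => ?_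
  congr 2
  funext m
  simp [leftLin_J]

/-- The exterior derivative commutes with pull-back, and left-invariance of `J` makes the type
projection do so for left translations. -/
theorem dbar_leftTrans {D : LatticeData} {a b c : ℝ} {p q : ℕ} {ψ : Form (p + q)}
    (hψ : ψ ∈ forms D a b c p q) {γ : G} (hγ : γ ∈ D.lattice) (x : E) :
    (dbar a b c p q ψ (leftTrans γ x)).compContinuousLinearMap (leftLin γ.coords)
      = dbar a b c p q ψ x := by
  have h1 : extDeriv ψ x = (extDeriv ψ (leftTrans γ x)).compContinuousLinearMap
      (leftLin γ.coords) := by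
    have h2 := extDeriv_pullback (x := x) (hψ.1.differentiable (by simp) (leftTrans γ x))
      (contDiff_leftTrans γ).contDiffAt (r := ∞) (by
        rw [minSmoothness_of_isRCLikeNormedField]
        exact WithTop.coe_le_coe.mpr le_top)
    rw [(hasFDerivAt_leftTrans γ x).fderiv] at h2
    rw [← h2]
    congr 1
    funext y
    exact (hψ.2.1 γ hγ y).symm
  unfold dbar
  rw [h1]
  exact (typeProj_comp_leftLin a b c γ.coords x p (q + 1) (extDeriv ψ (leftTrans γ x))).symm

/-- The integrand is continuous and nonnegative, so a zero integral forces it to vanish on the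
interior of the fundamental domain, then on its closure; `Γ`-invariance of `∂̄ψ` covers the rest of
`G`. -/
theorem dbar_eq_zero_of_l2Prod {D : LatticeData} {a b c : ℝ} (ha : a ≠ 0) (hc : c ≠ 0) {p q : ℕ}
    {ψ : Form (p + q)} (hψ : ψ ∈ forms D a b c p q)
    (h : l2Prod D a b c (dbar a b c p q ψ) (dbar a b c p q ψ) = 0) : dbar a b c p q ψ = 0 := by
  set η := dbar a b c p q ψ with hη
  have hcont : EvalCont η := .dbar hψ
  let F : E → ℝ := fun x => (1 / ((p + (q + 1)).factorial : ℝ) * ∑ I : Fin (p + (q + 1)) → Fin 6,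
      Complex.normSq (η x (fun i => orthoFrame a b c x (I i)))) * volDensity a b c x
  have hF : ∀ x, hermProd a b c x (η x) (η x) * (volDensity a b c x : ℂ) = (F x : ℂ) := fun x => by
    rw [hermProd_self, ← Complex.ofReal_mul]
  have hFc : Continuous F := by
    refine Continuous.mul (continuous_const.mul (continuous_finsetSum _ fun I _ => ?_))
      (continuous_volDensity a b c)
    exact Complex.continuous_normSq.comp (hcont _ fun i => continuous_orthoFrame a b c (I i))
  have hF0 : ∀ x, 0 ≤ F x := fun x =>
    mul_nonneg (mul_nonneg (by positivity) (Finset.sum_nonneg fun I _ => Complex.normSq_nonneg _))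
      (volDensity_pos ha hc x).le
  have hint : IntegrableOn F D.fundDomain := by
    have h1 := integrable_hermProd D a b c hcont hcont
    simp only [hF] at h1
    have h2 := h1.re
    simp only [RCLike.re_to_complex, Complex.ofReal_re] at h2
    exact h2
  have h1 : ∫ x in D.fundDomain, F x = 0 := by
    unfold l2Prod at h
    simp only [hF] at h
    rw [integral_complex_ofReal] at h
    exact_mod_cast h
  have h2 : F =ᵐ[volume.restrict D.fundDomain] 0 :=
    (integral_eq_zero_iff_of_nonneg hF0 hint).mp h1
  have h3 : Set.EqOn F 0 (interior D.fundDomain) :=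
    Measure.eqOn_open_of_ae_eq (ae_restrict_of_ae_restrict_of_subset interior_subset h2)
      isOpen_interior hFc.continuousOn continuousOn_const
  have h4 : Set.EqOn F 0 (closure (interior D.fundDomain)) :=
    h3.closure hFc continuous_const
  rw [D.convex_fundDomain.closure_interior_eq_closure_of_nonempty_interior
    D.interior_fundDomain_nonempty] at h4
  have h5 : ∀ x ∈ D.fundDomain, η x = 0 := fun x hx => by
    refine eq_zero_of_hermProd_self (b := b) ha hc x ?_
    have h6 := hF x
    rw [h4 (subset_closure hx)] at h6
    have h7 : (volDensity a b c x : ℂ) ≠ 0 := by exact_mod_cast (volDensity_pos ha hc x).ne'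
    exact (mul_eq_zero.mp (h6.trans (by simp))).resolve_right h7
  funext x
  obtain ⟨γ, ⟨hγ, hx⟩, -⟩ := D.existsUnique_mem_fundDomain x
  rw [hη, ← dbar_leftTrans hψ hγ x, ← hη]
  have h8 : η (leftTrans γ x) = 0 := h5 _ hx
  rw [h8]
  ext v
  simp

/-- In bidegree `(p,0)`, `Δψ = 0` says that `∂̄ψ` is orthogonal to the image of `∂̄`. Testing
against `ψ` itself gives `‖∂̄ψ‖² = 0`. -/
theorem mem_harmonic_iff {D : LatticeData} {a b c : ℝ} (ha : a ≠ 0) (hc : c ≠ 0) {p : ℕ}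
    {ψ : Form (p + 0)} :
    ψ ∈ harmonic D a b c p 0 ↔ ψ ∈ forms D a b c p 0 ∧ ∀ x, dbar a b c p 0 ψ x = 0 := by
  constructor
  · rintro ⟨hψ, h⟩
    refine ⟨hψ, fun x => ?_⟩
    have h1 : l2Prod D a b c (dbar a b c p 0 ψ) (dbar a b c p 0 ψ) = l2Prod D a b c ψ 0 :=
      h.2 ψ hψ
    have h2 : l2Prod D a b c ψ 0 = 0 := by simp [l2Prod, hermProd]
    rw [dbar_eq_zero_of_l2Prod ha hc hψ (h1.trans h2)]
    rfl
  · rintro ⟨hψ, h⟩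
    refine ⟨hψ, Submodule.zero_mem _, fun β _ => ?_⟩
    have h0 : dbar a b c p 0 ψ = 0 := funext h
    rw [h0]
    simp [l2Prod, hermProd]

/-! ### Construction of forms of type `(p,0)` -/

/-- The wedge product of `1`-covectors. -/
def wedge {k : ℕ} (φ : Fin k → (E →L[ℝ] ℂ)) : E [⋀^Fin k]→L[ℝ] ℂ :=
  ContinuousMultilinearMap.alternatization
    ((ContinuousMultilinearMap.mkPiAlgebra ℝ (Fin k) ℂ).compContinuousLinearMap φ)

theorem wedge_apply {k : ℕ} (φ : Fin k → (E →L[ℝ] ℂ)) (v : Fin k → E) :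
    wedge φ v = Matrix.det (Matrix.of fun i j => φ i (v j)) := by
  rw [wedge, ContinuousMultilinearMap.alternatization_apply_apply, ← Matrix.det_transpose,
    Matrix.det_apply]
  simp [Function.comp_def]

/-- The coordinate differentials, as complex-valued covectors. -/
def dcoord (i : Fin 6) : E →L[ℝ] ℂ := Complex.ofRealCLM.comp (ContinuousLinearMap.proj i)

theorem eq_sum_dcoord (φ : E →L[ℝ] ℂ) (v : E) : φ v = ∑ i, φ (Pi.single i 1) * dcoord i v := by
  conv_lhs => rw [pi_eq_sum_univ' v]
  simp only [map_sum, map_smul, Complex.real_smul, dcoord, ContinuousLinearMap.comp_apply,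
    Complex.ofRealCLM_apply, ContinuousLinearMap.proj_apply]
  refine Finset.sum_congr rfl fun i _ => ?_
  rw [mul_comm]

/-- Expansion over constant covectors: it reduces smoothness of a wedge to smoothness of scalar
coefficients. -/
theorem wedge_eq_sum {k : ℕ} (φ : Fin k → (E →L[ℝ] ℂ)) :
    wedge φ = ∑ K : Fin k → Fin 6, (∏ m, φ m (Pi.single (K m) 1)) •
      wedge fun m => dcoord (K m) := by
  ext v
  rw [ContinuousAlternatingMap.sum_apply]
  simp only [ContinuousAlternatingMap.smul_apply, wedge_apply, smul_eq_mul]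
  rw [← Matrix.det_transpose, Matrix.det_apply']
  simp only [Matrix.transpose_apply, Matrix.of_apply]
  have h : ∀ σ : Equiv.Perm (Fin k), ∏ i, φ i (v (σ i))
      = ∑ K : Fin k → Fin 6, (∏ m, φ m (Pi.single (K m) 1)) * ∏ i, dcoord (K i) (v (σ i)) := by
    intro σ
    rw [Finset.prod_congr rfl fun i _ => eq_sum_dcoord (φ i) (v (σ i)), Finset.prod_univ_sum,
      Fintype.piFinset_univ]
    exact Finset.sum_congr rfl fun K _ => Finset.prod_mul_distrib
  simp only [h, Finset.mul_sum]
  rw [Finset.sum_comm]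
  refine Finset.sum_congr rfl fun K _ => ?_
  rw [← Matrix.det_transpose, Matrix.det_apply', Finset.mul_sum]
  refine Finset.sum_congr rfl fun σ _ => ?_
  simp only [Matrix.transpose_apply, Matrix.of_apply]
  ring

theorem contDiff_smul_const {V : Type*} [NormedAddCommGroup V] [NormedSpace ℝ V] [NormedSpace ℂ V]
    [IsScalarTower ℝ ℂ V] {f : E → ℂ} (hf : ContDiff ℝ ∞ f) (v : V) :
    ContDiff ℝ ∞ fun x => f x • v :=
  (((ContinuousLinearMap.id ℂ ℂ).smulRight v).restrictScalars ℝ).contDiff.comp hf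

theorem contDiff_wedge {k : ℕ} {f : E → ℂ} (hf : ContDiff ℝ ∞ f)
    {φ : Fin k → E → (E →L[ℝ] ℂ)} (hφ : ∀ m v, ContDiff ℝ ∞ fun x => φ m x v) :
    ContDiff ℝ ∞ fun x => f x • wedge fun m => φ m x := by
  have h : (fun x => f x • wedge fun m => φ m x) = fun x => ∑ K : Fin k → Fin 6,
      (f x * ∏ m, φ m x (Pi.single (K m) 1)) • wedge fun m => dcoord (K m) := by
    funext x
    rw [wedge_eq_sum, Finset.smul_sum]
    simp only [smul_smul]
  rw [h]
  refine ContDiff.sum fun K _ => contDiff_smul_const (hf.mul ?_) _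
  exact contDiff_prod fun m _ => hφ m _

/-- The coframe of type `(1,0)` dual to `Z₁, Z₂, Z₃`. -/
def Phi (a b c : ℝ) (j : Fin 3) (x : E) : E →L[ℝ] ℂ :=
  ∑ i, (![![(a : ℂ), Complex.I, 0, 0, 0, 0], ![0, 0, 1, 0, b / c, Complex.I / c],
    ![0, 0, 0, 1, Complex.I / c, 0]] : Fin 3 → Fin 6 → ℂ) j i •
      Complex.ofRealCLM.comp (coframe x i)

theorem contDiff_coframe (i : Fin 6) (v : E) : ContDiff ℝ ∞ fun x => coframe x i v := by
  have h : ∀ j : Fin 6, ContDiff ℝ ∞ fun x : E => x j := fun j => contDiff_apply ℝ ℝ j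
  have h0 := h 0
  have h1 := h 1
  fin_cases i <;> simp [coframe] <;> fun_prop

theorem contDiff_Phi (a b c : ℝ) (j : Fin 3) (v : E) : ContDiff ℝ ∞ fun x => Phi a b c j x v := by
  simp only [Phi, sum_apply, smul_apply, ContinuousLinearMap.comp_apply,
    Complex.ofRealCLM_apply, smul_eq_mul]
  exact ContDiff.sum fun i _ =>
    contDiff_const.mul (Complex.ofRealCLM.contDiff.comp (contDiff_coframe i v))

theorem coframe_leftLin (g x v : E) (i : Fin 6) :
    coframe (gmul g x) i (leftLin g v) = coframe x i v := by
  rw [← sum_coframe_smul_frame x v]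
  simp only [map_sum, map_smul, leftLin_frame, coframe_frame]

theorem Phi_leftLin (a b c : ℝ) (j : Fin 3) (g x v : E) :
    Phi a b c j (gmul g x) (leftLin g v) = Phi a b c j x v := by
  simp only [Phi, sum_apply, smul_apply, ContinuousLinearMap.comp_apply, coframe_leftLin]

theorem Phi_J {a b c : ℝ} (ha : a ≠ 0) (hc : c ≠ 0) (j : Fin 3) (x v : E) :
    Phi a b c j x (J a b c x v) = Complex.I * Phi a b c j x v := by
  have ha' : (a : ℂ) ≠ 0 := by exact_mod_cast ha
  have hc' : (c : ℂ) ≠ 0 := by exact_mod_cast hc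
  have h : ∀ i, Phi a b c j x (J a b c x (frame x i)) = Complex.I * Phi a b c j x (frame x i) := by
    intro i
    simp only [Phi, Fin.sum_univ_six, J_frame]
    fin_cases j <;> fin_cases i <;> simp [coframe_frame] <;> field_simp <;> simp
  rw [← sum_coframe_smul_frame x v]
  simp only [map_sum, map_smul, h, Finset.mul_sum]
  refine Finset.sum_congr rfl fun i _ => ?_
  rw [mul_smul_comm]

theorem ext₁_Phi {a b c : ℝ} (ha : a ≠ 0) (hc : c ≠ 0) (x : E) (j l : Fin 3) :
    ext₁ x (Phi a b c j x) (Z a b c l) = if j = l then 1 else 0 := by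
  have ha' : (a : ℂ) ≠ 0 := by exact_mod_cast ha
  have hc' : (c : ℂ) ≠ 0 := by exact_mod_cast hc
  have h : ∀ i, Phi a b c j x (frame x i) = (![![(a : ℂ), Complex.I, 0, 0, 0, 0],
      ![0, 0, 1, 0, b / c, Complex.I / c], ![0, 0, 0, 1, Complex.I / c, 0]] :
      Fin 3 → Fin 6 → ℂ) j i := by
    intro i
    simp only [Phi, sum_apply, smul_apply, ContinuousLinearMap.comp_apply,
      Complex.ofRealCLM_apply, smul_eq_mul, coframe_frame]
    simp [apply_ite (fun r : ℝ => (r : ℂ))]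
  have hI : Complex.I ^ 2 = -1 := Complex.I_sq
  simp only [ext₁, h, Fin.sum_univ_six]
  fin_cases j <;> fin_cases l <;> simp [Z] <;> field_simp <;> ring_nf <;> simp only [hI] <;> ring

/-- The form `f Φ_{I₁} ∧ ⋯ ∧ Φ_{I_p}`. -/
def monomialForm (a b c : ℝ) {p : ℕ} (f : E → ℂ) (I : Fin p → Fin 3) : Form p :=
  fun x => f x • wedge fun m => Phi a b c (I m) x

theorem monomialForm_mem (D : LatticeData) {a b c : ℝ} (ha : a ≠ 0) (hc : c ≠ 0) {p : ℕ}
    {f : E → ℂ} (hf : ContDiff ℝ ∞ f) (hinv : IsLatticeInvariant D f) (I : Fin p → Fin 3) :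
    monomialForm a b c f I ∈ forms D a b c p 0 := by
  refine ⟨contDiff_wedge hf fun m v => contDiff_Phi a b c (I m) v, fun γ hγ x => ?_, fun x => ?_⟩
  · rw [(hasFDerivAt_leftTrans γ x).fderiv]
    ext v
    simp only [monomialForm, ContinuousAlternatingMap.compContinuousLinearMap_apply]
    rw [ContinuousAlternatingMap.smul_apply, ContinuousAlternatingMap.smul_apply, hinv γ hγ,
      wedge_apply, wedge_apply]
    congr 2
    ext i j
    exact Phi_leftLin a b c (I i) γ.coords x (v j)
  · refine Submodule.smul_mem _ _ (Submodule.subset_span ⟨rfl, fun m => Phi a b c (I m) x,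
      fun i _ v => Phi_J ha hc _ x v, fun i hi => absurd i.2 (not_lt.mpr hi), fun v => ?_⟩)
    exact wedge_apply _ v

theorem coef_monomialForm {a b c : ℝ} (ha : a ≠ 0) (hc : c ≠ 0) {p : ℕ} (f : E → ℂ)
    (I K : Fin p → Fin 3) (x : E) :
    coef a b c (monomialForm a b c f I) K x
      = f x * Matrix.det (Matrix.of fun i j => if I i = K j then (1 : ℂ) else 0) := by
  rw [coef, monomialForm, cx_smul, cx_of_det x (wedge_apply _)]
  simp only [ext₁_Phi ha hc]

/-! ### The solutions of `∂̄ψ = 0` -/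

theorem coef_bound {D : LatticeData} {a b c : ℝ} {p : ℕ} {ψ : Form (p + 0)}
    (hψ : ψ ∈ forms D a b c p 0) (I : Fin p → Fin 3) :
    Differentiable ℝ (coef a b c (k := p) ψ I) ∧ ∃ M, ∀ x, ‖coef a b c (k := p) ψ I x‖ ≤ M := by
  have h : Differentiable ℝ (coef a b c (k := p) ψ I) :=
    differentiable_coef (k := p) (hψ.1.differentiable (by simp)) I
  exact ⟨h, (isLatticeInvariant_coef hψ I).exists_bound h.continuous⟩

/-- A bounded function annihilated by `Z̄₁, Z̄₂, Z̄₃` is constant. -/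
theorem const_of_holomorphic {a b c : ℝ} (ha : a ≠ 0) (hc : c ≠ 0) {f : E → ℂ}
    (hf : Differentiable ℝ f) {M : ℝ} (hM : ∀ y, ‖f y‖ ≤ M)
    (h : ∀ j q, cderiv (Zbar a b c j) f q = 0) (q : E) : f q = f 0 := by
  have h1 := base_eigenfunction (b := b) (c := c) ha hf hM
    (fun p q e0 e1 => fibre_const hc hf hM (h 1) (h 2) e0 e1) 0
    (fun q => by rw [h 0 q]; simp) q
  simpa using h1

/-! ### The system `∂̄ψ = 0` written out for `p = 1, 2, 3`. -/

theorem dbar_eq_zero_iff_one {a b c : ℝ} (ha : a ≠ 0) (hc : c ≠ 0) {ψ : Form 1} {x : E}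
    (hψ : DifferentiableAt ℝ ψ x) (hJ : ∀ y, ψ y ∈ bigraded (J a b c y) 1 1 0) :
    dbar a b c 1 0 ψ x = 0 ↔ ∀ j i : Fin 3,
      cderiv (Zbar a b c j) (coef a b c ψ ![i]) x
        = ∑ l, structZ a c j i l * coef a b c ψ ![l] x := by
  rw [dbar_eq_zero_iff (n := 0) ha hc hψ hJ]
  have e : ∀ (l : Fin 3) (I : Fin 0 → Fin 3), Matrix.vecCons l I = ![l] := fun l I => by
    rw [Subsingleton.elim I ![]]
  constructor
  · intro h j i
    have h1 := h j ![i] (Subsingleton.strictMono (α := Fin 1) _)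
    simpa [e] using h1
  · intro h j I _
    obtain ⟨i, rfl⟩ : ∃ i, I = ![i] := ⟨I 0, by ext m; fin_cases m; rfl⟩
    simpa [e] using h j i

theorem sum_removeNth_two (N : Fin 3 → Fin 3 → ℂ) (g : (Fin 2 → Fin 3) → ℂ) (u v : Fin 3) :
    ∑ m : Fin 2, (-1) ^ (m : ℕ) * ∑ l, N (![u, v] m) l * g (Matrix.vecCons l (m.removeNth ![u, v]))
      = ∑ l, N u l * g ![l, v] - ∑ l, N v l * g ![l, u] := by
  have r0 : ∀ l : Fin 3, Matrix.vecCons l (Fin.removeNth (0 : Fin 2) ![u, v]) = ![l, v] :=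
    fun l => by ext m; fin_cases m <;> rfl
  have r1 : ∀ l : Fin 3, Matrix.vecCons l (Fin.removeNth (1 : Fin 2) ![u, v]) = ![l, u] :=
    fun l => by ext m; fin_cases m <;> rfl
  rw [Fin.sum_univ_two]
  simp only [r0, r1]
  simp
  ring

theorem sum_removeNth_three (N : Fin 3 → Fin 3 → ℂ) (g : (Fin 3 → Fin 3) → ℂ) (u v w : Fin 3) :
    ∑ m : Fin 3, (-1) ^ (m : ℕ) *
        ∑ l, N (![u, v, w] m) l * g (Matrix.vecCons l (m.removeNth ![u, v, w]))
      = ∑ l, N u l * g ![l, v, w] - ∑ l, N v l * g ![l, u, w] + ∑ l, N w l * g ![l, u, v] := by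
  have r0 : ∀ l : Fin 3, Matrix.vecCons l (Fin.removeNth (0 : Fin 3) ![u, v, w]) = ![l, v, w] :=
    fun l => by ext m; fin_cases m <;> rfl
  have r1 : ∀ l : Fin 3, Matrix.vecCons l (Fin.removeNth (1 : Fin 3) ![u, v, w]) = ![l, u, w] :=
    fun l => by ext m; fin_cases m <;> rfl
  have r2 : ∀ l : Fin 3, Matrix.vecCons l (Fin.removeNth (2 : Fin 3) ![u, v, w]) = ![l, u, v] :=
    fun l => by ext m; fin_cases m <;> rfl
  rw [Fin.sum_univ_three]
  simp only [r0, r1, r2]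
  simp
  ring

theorem forall_strictMono_two (P : (Fin 2 → Fin 3) → Prop) :
    (∀ I, StrictMono I → P I) ↔ P ![0, 1] ∧ P ![0, 2] ∧ P ![1, 2] := by
  constructor
  · intro h
    refine ⟨h _ ?_, h _ ?_, h _ ?_⟩ <;> rw [Fin.strictMono_iff_lt_succ] <;> intro i <;>
      fin_cases i <;> simp
  · rintro ⟨h1, h2, h3⟩ I hI
    have h01 : I 0 < I 1 := hI (by simp)
    have hIe : I = ![I 0, I 1] := by ext m; fin_cases m <;> rfl
    rw [hIe]
    generalize I 0 = u at h01
    generalize I 1 = v at h01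
    fin_cases u <;> fin_cases v <;> first | assumption | simp at h01

theorem forall_strictMono_three (P : (Fin 3 → Fin 3) → Prop) :
    (∀ I, StrictMono I → P I) ↔ P ![0, 1, 2] := by
  constructor
  · intro h
    refine h _ ?_
    rw [Fin.strictMono_iff_lt_succ]
    intro i
    fin_cases i <;> simp
  · intro h I hI
    have h01 : I 0 < I 1 := hI (by simp)
    have h12 : I 1 < I 2 := hI (by simp)
    have hIe : I = ![0, 1, 2] := by
      ext m
      fin_cases m <;> simp <;> omega
    rwa [hIe]

theorem dbar_eq_zero_iff_two {a b c : ℝ} (ha : a ≠ 0) (hc : c ≠ 0) {ψ : Form 2} {x : E}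
    (hψ : DifferentiableAt ℝ ψ x) (hJ : ∀ y, ψ y ∈ bigraded (J a b c y) 2 2 0) :
    dbar a b c 2 0 ψ x = 0 ↔
      (cderiv (Zbar a b c 0) (coef a b c ψ ![0, 1]) x = c / 4 * coef a b c ψ ![0, 2] x ∧
        cderiv (Zbar a b c 1) (coef a b c ψ ![0, 1]) x = c / 4 * coef a b c ψ ![1, 2] x ∧
        cderiv (Zbar a b c 2) (coef a b c ψ ![0, 1]) x = -1 / (2 * a) * coef a b c ψ ![1, 2] x) ∧
      (cderiv (Zbar a b c 0) (coef a b c ψ ![0, 2]) x = c / 4 * coef a b c ψ ![0, 1] x ∧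
        cderiv (Zbar a b c 1) (coef a b c ψ ![0, 2]) x = -1 / (2 * a) * coef a b c ψ ![1, 2] x ∧
        cderiv (Zbar a b c 2) (coef a b c ψ ![0, 2]) x = -c / 4 * coef a b c ψ ![1, 2] x) ∧
      ∀ j, cderiv (Zbar a b c j) (coef a b c ψ ![1, 2]) x = 0 := by
  refine (dbar_eq_zero_iff (n := 1) ha hc hψ hJ).trans ?_
  refine (forall_congr' fun j => forall_strictMono_two _).trans ?_
  have key : ∀ j u v, _ ↔ _ := fun j u v => Eq.congr_right
    (z := cderiv (Zbar a b c j) (coef a b c ψ ![u, v]) x)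
    (sum_removeNth_two (structZ a c j) (fun I => coef a b c ψ I x) u v)
  refine (forall_congr' fun j => and_congr (key j 0 1)
    (and_congr (key j 0 2) (key j 1 2))).trans ?_
  -- Antisymmetry expresses every coefficient through those with increasing indices; most terms of
  -- the system drop out.
  have s0 : ∀ u : Fin 3, coef a b c ψ ![u, u] x = 0 := fun u =>
    coef_eq_zero a b c ψ (i := 0) (j := 1) (by simp) rfl x
  have sw : ∀ u v : Fin 3, coef a b c ψ ![v, u] x = -coef a b c ψ ![u, v] x := fun u v => by
    rw [← coef_swap a b c ψ ![u, v] (i := 0) (j := 1) (by simp)]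
    congr 1
    ext m
    fin_cases m <;> rfl
  have s10 := sw 0 1
  have s20 := sw 0 2
  have s21 := sw 1 2
  simp only [Fin.sum_univ_three, s0, s10, s20, s21, Fin.forall_fin_succ]
  simp [structZ, neg_div]
  constructor
  · rintro ⟨⟨h1, h2, h3⟩, ⟨h4, h5, h6⟩, h7, h8, h9⟩
    exact ⟨⟨h1, h4, h7⟩, ⟨h2, h5, h8⟩, h3, h6, h9⟩
  · rintro ⟨⟨h1, h4, h7⟩, ⟨h2, h5, h8⟩, h3, h6, h9⟩
    exact ⟨⟨h1, h2, h3⟩, ⟨h4, h5, h6⟩, h7, h8, h9⟩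

/-- The right-hand side would be the trace of `structZ a c j` times the coefficient, since
off-diagonal entries meet a repeated index; all diagonal entries are zero. -/
theorem dbar_eq_zero_iff_three {a b c : ℝ} (ha : a ≠ 0) (hc : c ≠ 0) {ψ : Form 3} {x : E}
    (hψ : DifferentiableAt ℝ ψ x) (hJ : ∀ y, ψ y ∈ bigraded (J a b c y) 3 3 0) :
    dbar a b c 3 0 ψ x = 0 ↔ ∀ j, cderiv (Zbar a b c j) (coef a b c ψ ![0, 1, 2]) x = 0 := by
  refine (dbar_eq_zero_iff (n := 2) ha hc hψ hJ).trans ?_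
  refine (forall_congr' fun j => forall_strictMono_three _).trans (forall_congr' fun j => ?_)
  refine (Eq.congr_right (z := cderiv (Zbar a b c j) (coef a b c ψ ![0, 1, 2]) x)
    (sum_removeNth_three (structZ a c j) (fun I => coef a b c ψ I x) 0 1 2)).trans
      (Eq.congr_right ?_)
  have s0 : ∀ u w : Fin 3, coef a b c ψ ![u, u, w] x = 0 := fun u w =>
    coef_eq_zero a b c ψ (i := 0) (j := 1) (by simp) rfl x
  have s1 : ∀ u v : Fin 3, coef a b c ψ ![u, v, u] x = 0 := fun u v =>
    coef_eq_zero a b c ψ (i := 0) (j := 2) (by simp) rfl x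
  simp only [Fin.sum_univ_three, s0, s1]
  fin_cases j <;> simp [structZ]

/-! ### The Hodge numbers -/

/-- The second and third coefficients are fibrewise holomorphic, hence constant on fibres, and they
are the sources in the equations for the first one. Liouville allows no nonzero constant source. -/
theorem coef_eq_of_mem_harmonic_one {D : LatticeData} {a b c : ℝ} (ha : a ≠ 0) (hc : c ≠ 0)
    {ψ : Form 1} (hψ : ψ ∈ harmonic D a b c 1 0) (x : E) :
    coef a b c ψ ![0] x = coef a b c ψ ![0] 0 ∧ coef a b c ψ ![1] x = 0 ∧
      coef a b c ψ ![2] x = 0 := by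
  obtain ⟨hf, hd⟩ := (mem_harmonic_iff ha hc).mp hψ
  have h := fun y => (dbar_eq_zero_iff_one ha hc (hf.1.differentiable (by simp) y) hf.2.2).mp (hd y)
  have hb := fun i => coef_bound (p := 1) hf ![i]
  choose hdiff M hM using hb
  have ha' : (a : ℂ) ≠ 0 := by exact_mod_cast ha
  have hfib : ∀ i : Fin 3, i = 1 ∨ i = 2 → ∀ p q : E, q 0 = p 0 → q 1 = p 1 →
      coef a b c ψ ![i] q = coef a b c ψ ![i] p := by
    rintro i hi p q e0 e1
    refine fibre_const (a := a) (b := b) hc (hdiff i) (hM i) (fun y => ?_) (fun y => ?_) e0 e1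
    · rw [h y 1 i]
      rcases hi with rfl | rfl <;> simp [structZ, Fin.sum_univ_three]
    · rw [h y 2 i]
      rcases hi with rfl | rfl <;> simp [structZ, Fin.sum_univ_three]
  have hzero : ∀ y, coef a b c ψ ![1] y = 0 ∧ coef a b c ψ ![2] y = 0 := by
    intro y
    have e1 := (const_of_cderiv_Zbar_one (hdiff 0) (hM 0) y
      (C := -1 / (2 * a) * coef a b c ψ ![1] y + -c / 4 * coef a b c ψ ![2] y)
      (fun q e0 e1 => by
        rw [h q 1 0, ← hfib 1 (Or.inl rfl) y q e0 e1, ← hfib 2 (Or.inr rfl) y q e0 e1]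
        simp [structZ, Fin.sum_univ_three])).1
    have e2 := (const_of_cderiv_Zbar_two (hdiff 0) (hM 0) y
      (C := -c / 4 * coef a b c ψ ![1] y + 1 / (2 * a) * coef a b c ψ ![2] y)
      (fun q e0 e1 => by
        rw [h q 2 0, ← hfib 1 (Or.inl rfl) y q e0 e1, ← hfib 2 (Or.inr rfl) y q e0 e1]
        simp [structZ, Fin.sum_univ_three])).1
    -- Minus the determinant of the `2 × 2` system formed by `e1` and `e2`; it is positive, so both
    -- unknowns vanish.
    have hdet : (1 / (4 * a ^ 2) + c ^ 2 / 16 : ℂ) ≠ 0 := by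
      have : (1 / (4 * a ^ 2) + c ^ 2 / 16 : ℝ) ≠ 0 := by positivity
      exact_mod_cast this
    constructor
    · refine (mul_eq_zero.mp ?_).resolve_left hdet
      linear_combination -1 / (2 * a) * e1 - c / 4 * e2
    · refine (mul_eq_zero.mp ?_).resolve_left hdet
      linear_combination -c / 4 * e1 + 1 / (2 * a) * e2
  refine ⟨const_of_holomorphic (b := b) ha hc (hdiff 0) (hM 0) (fun j q => ?_) x, hzero x⟩
  rw [h q j 0, Fin.sum_univ_three, (hzero q).1, (hzero q).2]
  fin_cases j <;> simp [structZ]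

theorem coef_eq_of_mem_harmonic_three {D : LatticeData} {a b c : ℝ} (ha : a ≠ 0) (hc : c ≠ 0)
    {ψ : Form 3} (hψ : ψ ∈ harmonic D a b c 3 0) (x : E) :
    coef a b c ψ ![0, 1, 2] x = coef a b c ψ ![0, 1, 2] 0 := by
  obtain ⟨hf, hd⟩ := (mem_harmonic_iff ha hc).mp hψ
  have h := fun y =>
    (dbar_eq_zero_iff_three ha hc (hf.1.differentiable (by simp) y) hf.2.2).mp (hd y)
  obtain ⟨hdiff, M, hM⟩ := coef_bound (p := 3) hf ![0, 1, 2]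
  exact const_of_holomorphic ha hc hdiff hM (fun j q => h q j) x

theorem cderiv_add {v : Fin 6 → ℂ} {f g : E → ℂ} (hf : Differentiable ℝ f)
    (hg : Differentiable ℝ g) (x : E) :
    cderiv v (fun y => f y + g y) x = cderiv v f x + cderiv v g x := by
  simp only [cderiv, fderiv_fun_add (hf x) (hg x), add_apply, mul_add, Finset.sum_add_distrib]

theorem cderiv_const_mul {v : Fin 6 → ℂ} {f : E → ℂ} (hf : Differentiable ℝ f) (r : ℂ) (x : E) :
    cderiv v (fun y => r * f y) x = r * cderiv v f x := by
  simp only [cderiv, fderiv_const_mul (hf x), smul_apply, smul_eq_mul, Finset.mul_sum]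
  exact Finset.sum_congr rfl fun i _ => by ring

/-- The coefficients of harmonic `(2,0)`-forms; `ε = ±1`. -/
theorem coef_eq_of_mem_harmonic_two {D : LatticeData} {a b c : ℝ} (ha : a ≠ 0) (hc : c ≠ 0)
    {ψ : Form 2} (hψ : ψ ∈ harmonic D a b c 2 0) :
    (∀ x, coef a b c ψ ![1, 2] x = 0) ∧ ∀ ε : ℝ, ε ^ 2 = 1 → ∀ x : E,
      coef a b c ψ ![0, 1] x + ε * coef a b c ψ ![0, 2] x
        = (coef a b c ψ ![0, 1] 0 + ε * coef a b c ψ ![0, 2] 0)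
          * Complex.exp (-(ε * c / 2 * x 1) * Complex.I) := by
  obtain ⟨hf, hd⟩ := (mem_harmonic_iff ha hc).mp hψ
  have h := fun y => (dbar_eq_zero_iff_two ha hc (hf.1.differentiable (by simp) y) hf.2.2).mp (hd y)
  obtain ⟨hdiff, M, hM⟩ := coef_bound (p := 2) hf ![0, 1]
  obtain ⟨hdiff', M', hM'⟩ := coef_bound (p := 2) hf ![0, 2]
  obtain ⟨hdiff'', M'', hM''⟩ := coef_bound (p := 2) hf ![1, 2]
  have hc' : (c : ℂ) ≠ 0 := by exact_mod_cast hc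
  have hconst := const_of_holomorphic (b := b) ha hc hdiff'' hM'' (fun j q => (h q).2.2 j)
  have hzero : ∀ x, coef a b c ψ ![1, 2] x = 0 := by
    intro x
    -- The `(1,2)` coefficient is a global constant and the source of `Z̄₂` acting on the `(0,1)`
    -- coefficient, so Liouville kills it.
    have e1 := (const_of_cderiv_Zbar_one hdiff hM 0 (C := c / 4 * coef a b c ψ ![1, 2] 0)
      (fun q _ _ => by rw [(h q).1.2.1, hconst q])).1
    rw [hconst x]
    exact (mul_eq_zero.mp e1).resolve_left (by simpa using hc')
  refine ⟨hzero, fun ε hε x => ?_⟩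
  have hε' : (ε : ℂ) ^ 2 = 1 := by exact_mod_cast hε
  have hfib : ∀ p q : E, q 0 = p 0 → q 1 = p 1 →
      coef a b c ψ ![0, 1] q = coef a b c ψ ![0, 1] p := fun p q e0 e1 =>
    fibre_const (a := a) (b := b) hc hdiff hM
      (fun y => by rw [(h y).1.2.1, hzero, mul_zero])
      (fun y => by rw [(h y).1.2.2, hzero, mul_zero]) e0 e1
  have hfib' : ∀ p q : E, q 0 = p 0 → q 1 = p 1 →
      coef a b c ψ ![0, 2] q = coef a b c ψ ![0, 2] p := fun p q e0 e1 =>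
    fibre_const (a := a) (b := b) hc hdiff' hM'
      (fun y => by rw [(h y).2.1.2.1, hzero, mul_zero])
      (fun y => by rw [(h y).2.1.2.2, hzero, mul_zero]) e0 e1
  -- `Z̄₁` exchanges the two coefficients up to the factor `c/4`. As `ε² = 1`, the combination with
  -- `ε` is an eigenfunction with eigenvalue `ε c / 4`.
  have key := base_eigenfunction (b := b) (c := c) ha
    (f := fun y => coef a b c ψ ![0, 1] y + ε * coef a b c ψ ![0, 2] y)
    (hdiff.fun_add (hdiff'.const_mul _)) (M := M + ‖(ε : ℂ)‖ * M')
    (fun y => (norm_add_le _ _).trans (add_le_add (hM y) (by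
      rw [norm_mul]
      exact mul_le_mul_of_nonneg_left (hM' y) (norm_nonneg _))))
    (fun p q e0 e1 => by simp only [hfib p q e0 e1, hfib' p q e0 e1]) (ε * c / 4)
    (fun q => by
      rw [cderiv_add hdiff (hdiff'.const_mul _), cderiv_const_mul hdiff', (h q).1.1, (h q).2.1.1]
      push_cast
      linear_combination (-c / 4 * coef a b c ψ ![0, 2] q) * hε') x
  rw [key]
  congr 2
  push_cast
  ring

/-! ### Counting dimensions by the coefficients at the origin. -/

theorem forms_bigraded {D : LatticeData} {a b c : ℝ} {p : ℕ} {ψ : Form p}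
    (hψ : ψ ∈ harmonic D a b c p 0) (x : E) : ψ x ∈ bigraded (J a b c x) p p 0 := hψ.1.2.2 x

/-- The values at the origin of given coefficients of a harmonic form. -/
def coefAtZero (D : LatticeData) (a b c : ℝ) (p : ℕ) {n : ℕ} (K : Fin n → Fin p → Fin 3) :
    harmonic D a b c p 0 →ₗ[ℂ] (Fin n → ℂ) where
  toFun ψ i := coef a b c (k := p) ψ.1 (K i) 0
  map_add' ψ χ := funext fun i => coef_add a b c (k := p) ψ.1 χ.1 (K i) 0
  map_smul' r ψ := funext fun i => coef_smul a b c (k := p) r ψ.1 (K i) 0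

theorem coefAtZero_apply (D : LatticeData) (a b c : ℝ) (p : ℕ) {n : ℕ} (K : Fin n → Fin p → Fin 3)
    (ψ : harmonic D a b c p 0) (i : Fin n) :
    coefAtZero D a b c p K ψ i = coef a b c (k := p) ψ.1 (K i) 0 := rfl

theorem hodgeNumber_eq_of_bijective {D : LatticeData} {a b c : ℝ} {p n : ℕ}
    {K : Fin n → Fin p → Fin 3} (h : Function.Bijective (coefAtZero D a b c p K)) :
    hodgeNumber D a b c p 0 = n := by
  rw [hodgeNumber, (LinearEquiv.ofBijective _ h).rank_eq, rank_fin_fun]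

theorem isLatticeInvariant_const (D : LatticeData) (r : ℂ) : IsLatticeInvariant D fun _ => r :=
  fun _ _ _ => rfl

theorem hodgeNumber_one (D : LatticeData) {a b c : ℝ} (ha : a ≠ 0) (hc : c ≠ 0) :
    hodgeNumber D a b c 1 0 = 1 := by
  rw [← Nat.cast_one]
  refine hodgeNumber_eq_of_bijective (K := fun _ => ![0]) ⟨?_, fun r => ?_⟩
  · refine (injective_iff_map_eq_zero _).mpr fun ψ h0 => Subtype.ext (funext fun x => ?_)
    have h0' := congrFun h0 0
    rw [coefAtZero_apply, Pi.zero_apply] at h0'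
    obtain ⟨h1, h2, h3⟩ := coef_eq_of_mem_harmonic_one ha hc ψ.2 x
    refine eq_zero_of_coef_eq_zero (p := 1) ha hc (forms_bigraded ψ.2 x) fun I _ => ?_
    obtain ⟨i, rfl⟩ : ∃ i, I = ![i] := ⟨I 0, by ext m; fin_cases m; rfl⟩
    fin_cases i
    · exact h1.trans h0'
    · exact h2
    · exact h3
  -- Constant multiples of the first covector of the `(1,0)`-coframe realize every value.
  · have hm := monomialForm_mem D (b := b) ha hc (p := 1) (contDiff_const (c := r 0))
      (isLatticeInvariant_const D _) ![0]
    have hcoef : ∀ i, coef a b c (monomialForm a b c (fun _ => r 0) ![0]) ![i]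
        = fun _ => if i = 0 then r 0 else 0 := fun i => by
      funext x
      rw [coef_monomialForm ha hc]
      fin_cases i <;> simp
    refine ⟨⟨monomialForm a b c (fun _ => r 0) ![0],
      (mem_harmonic_iff ha hc).mpr ⟨hm, fun x => ?_⟩⟩, ?_⟩
    · refine (dbar_eq_zero_iff_one ha hc (hm.1.differentiable (by simp) x) hm.2.2).mpr fun j i => ?_
      simp only [hcoef, cderiv_const, Fin.sum_univ_three]
      fin_cases j <;> fin_cases i <;> simp [structZ]
    · funext i
      rw [coefAtZero_apply, Subsingleton.elim i 0, hcoef, if_pos rfl]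

theorem hodgeNumber_three (D : LatticeData) {a b c : ℝ} (ha : a ≠ 0) (hc : c ≠ 0) :
    hodgeNumber D a b c 3 0 = 1 := by
  rw [← Nat.cast_one]
  refine hodgeNumber_eq_of_bijective (K := fun _ => ![0, 1, 2]) ⟨?_, fun r => ?_⟩
  · refine (injective_iff_map_eq_zero _).mpr fun ψ h0 => Subtype.ext (funext fun x => ?_)
    have h0' := congrFun h0 0
    rw [coefAtZero_apply, Pi.zero_apply] at h0'
    refine eq_zero_of_coef_eq_zero (p := 3) ha hc (forms_bigraded ψ.2 x) ?_
    rw [forall_strictMono_three]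
    exact (coef_eq_of_mem_harmonic_three ha hc ψ.2 x).trans h0'
  · have hm := monomialForm_mem D (b := b) ha hc (p := 3) (contDiff_const (c := r 0))
      (isLatticeInvariant_const D _) ![0, 1, 2]
    have hcoef : coef a b c (monomialForm a b c (fun _ => r 0) ![0, 1, 2]) ![0, 1, 2]
        = fun _ => r 0 := by
      funext x
      rw [coef_monomialForm ha hc]
      simp [Matrix.det_fin_three]
    refine ⟨⟨monomialForm a b c (fun _ => r 0) ![0, 1, 2],
      (mem_harmonic_iff ha hc).mpr ⟨hm, fun x => ?_⟩⟩, ?_⟩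
    · refine (dbar_eq_zero_iff_three ha hc (hm.1.differentiable (by simp) x) hm.2.2).mpr fun j => ?_
      rw [hcoef, cderiv_const]
    · funext i
      rw [coefAtZero_apply, Subsingleton.elim i 0, hcoef]

theorem eq_zero_of_mem_harmonic_two {D : LatticeData} {a b c : ℝ} (ha : a ≠ 0) (hc : c ≠ 0)
    {ψ : Form 2} (hψ : ψ ∈ harmonic D a b c 2 0) (h1 : coef a b c ψ ![0, 1] 0 = 0)
    (h2 : coef a b c ψ ![0, 2] 0 = 0) : ψ = 0 := by
  obtain ⟨h12, h⟩ := coef_eq_of_mem_harmonic_two ha hc hψ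
  funext x
  refine eq_zero_of_coef_eq_zero ha hc (forms_bigraded hψ x) ?_
  rw [forall_strictMono_two]
  have hp := h 1 (by norm_num) x
  have hm := h (-1) (by norm_num) x
  rw [h1, h2] at hp hm
  push_cast at hp hm
  exact ⟨by linear_combination (hp + hm) / 2, by linear_combination (hp - hm) / 2, h12 x⟩

/-- The translation `x ↦ x + 1` fixes the coefficients but multiplies each mode by `exp(-iεc/2)`, so
a nonzero amplitude would force `c ∈ 4πℤ`. -/
theorem hodgeNumber_two_of_not (D : LatticeData) {a b c : ℝ} (ha : a ≠ 0) (hc : c ≠ 0)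
    (hm : ¬ ∃ m : ℤ, c = 4 * Real.pi * m) : hodgeNumber D a b c 2 0 = 0 := by
  have key : ∀ ψ ∈ harmonic D a b c 2 0, ψ = 0 := by
    intro ψ hψ
    have hs : ∀ ε : ℝ, ε = 1 ∨ ε = -1 →
        coef a b c (k := 2) ψ ![0, 1] 0 + ε * coef a b c (k := 2) ψ ![0, 2] 0 = 0 := by
      intro ε hε
      have hε2 : ε ^ 2 = 1 := by rcases hε with rfl | rfl <;> norm_num
      have h := (coef_eq_of_mem_harmonic_two ha hc hψ).2 ε hε2 (leftTrans unitShift 0)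
      rw [isLatticeInvariant_coef (p := 2) hψ.1 ![0, 1] _ (unitShift_mem D) 0,
        isLatticeInvariant_coef (p := 2) hψ.1 ![0, 2] _ (unitShift_mem D) 0,
        leftTrans_unitShift_zero] at h
      by_contra hne
      have hexp := mul_left_cancel₀ hne ((mul_one _).trans h)
      obtain ⟨n, hn⟩ := Complex.exp_eq_one_iff.mp hexp.symm
      have h2 : -(ε * c / 2) = 2 * Real.pi * n := by
        have h3 : (-(ε * c / 2) : ℂ) = 2 * Real.pi * n := by
          apply mul_right_cancel₀ Complex.I_ne_zero
          simp only [Matrix.cons_val_one, Matrix.cons_val_zero, Complex.ofReal_one, mul_one] at hn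
          rw [hn]
          ring
        exact_mod_cast h3
      rcases hε with rfl | rfl
      · exact hm ⟨-n, by push_cast; linarith⟩
      · exact hm ⟨n, by linarith⟩
    have hp := hs 1 (Or.inl rfl)
    have hn := hs (-1) (Or.inr rfl)
    push_cast at hp hn
    exact eq_zero_of_mem_harmonic_two ha hc hψ (by linear_combination (hp + hn) / 2)
      (by linear_combination (hp - hn) / 2)
  rw [← Nat.cast_zero]
  -- No coefficients are recorded: the target is `ℂ⁰`.
  refine hodgeNumber_eq_of_bijective (K := Fin.elim0) ⟨?_, fun r => ⟨0, Subsingleton.elim _ _⟩⟩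
  exact (injective_iff_map_eq_zero _).mpr fun ψ _ => Subtype.ext (key ψ.1 ψ.2)

/-- The function `exp(-i ε c x / 2)`. -/
def wave (c : ℝ) (ε : ℤ) (x : E) : ℂ := Complex.exp (-(ε * c / 2 * x 1) * Complex.I)

theorem contDiff_wave (c : ℝ) (ε : ℤ) : ContDiff ℝ ∞ (wave c ε) := by
  have h : ContDiff ℝ ∞ fun x : E => ((x 1 : ℝ) : ℂ) :=
    Complex.ofRealCLM.contDiff.comp (contDiff_apply ℝ ℝ 1)
  exact ((contDiff_const.mul h).neg.mul contDiff_const).cexp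

theorem cderiv_wave (v : Fin 6 → ℂ) (c : ℝ) (ε : ℤ) (x : E) :
    cderiv v (wave c ε) x = v 1 * (wave c ε x * (-(ε * c / 2) * Complex.I)) := by
  have h1 : HasFDerivAt (fun y : E => ((y 1 : ℝ) : ℂ)) (Complex.ofRealCLM.comp
      (ContinuousLinearMap.proj 1 : E →L[ℝ] ℝ)) x :=
    (Complex.ofRealCLM.comp (ContinuousLinearMap.proj 1 : E →L[ℝ] ℝ)).hasFDerivAt
  have h2 := (h1.const_mul (-(ε * c / 2) * Complex.I)).cexp
  have h3 : wave c ε = fun y : E => Complex.exp (-(ε * c / 2) * Complex.I * ((y 1 : ℝ) : ℂ)) := by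
    funext y
    simp only [wave]
    congr 1
    ring
  simp only [cderiv, h3, h2.fderiv, Fin.sum_univ_six]
  simp [frame]

theorem isLatticeInvariant_wave (D : LatticeData) {c : ℝ} {m : ℤ} (hm : c = 4 * Real.pi * m)
    (ε : ℤ) : IsLatticeInvariant D (wave c ε) := by
  rintro γ ⟨_, u, _, _, _, hu, _, _⟩ x
  have h1 : leftTrans γ x 1 = u + x 1 := by
    change γ.coords 1 + x 1 = _
    rw [show γ.coords 1 = u from hu]
  simp only [wave, h1]
  rw [Complex.exp_eq_exp_iff_exists_int]
  -- Shifting `x` by `u` changes the phase by `-εcu/2 = -2πεmu`.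
  refine ⟨-(ε * m * u), ?_⟩
  rw [hm]
  push_cast
  ring

theorem hodgeNumber_two_of_exists (D : LatticeData) {a b c : ℝ} (ha : a ≠ 0) (hc : c ≠ 0)
    (hm : ∃ m : ℤ, c = 4 * Real.pi * m) : hodgeNumber D a b c 2 0 = 2 := by
  obtain ⟨m, hm⟩ := hm
  rw [← Nat.cast_ofNat]
  refine hodgeNumber_eq_of_bijective (K := ![![0, 1], ![0, 2]]) ⟨?_, fun r => ?_⟩
  · refine (injective_iff_map_eq_zero _).mpr fun ψ h0 => Subtype.ext ?_
    have h1 := congrFun h0 0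
    have h2 := congrFun h0 1
    rw [coefAtZero_apply, Pi.zero_apply] at h1 h2
    exact eq_zero_of_mem_harmonic_two ha hc ψ.2 h1 h2
  -- `f 1` and `f (-1)` are the `(0,1)` and `(0,2)` coefficients of the form to be built: their
  -- half-sum and half-difference are pure waves, and their values at the origin are `r 0` and `r
  -- 1`.
  · let f : ℂ → E → ℂ := fun s x =>
      (r 0 + r 1) / 2 * wave c 1 x + s * ((r 0 - r 1) / 2 * wave c (-1) x)
    have hd : ∀ s, ContDiff ℝ ∞ (f s) := fun s =>
      (contDiff_const.mul (contDiff_wave c 1)).add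
        (contDiff_const.mul (contDiff_const.mul (contDiff_wave c (-1))))
    have hinv : ∀ s, IsLatticeInvariant D (f s) := fun s γ hγ x => by
      simp only [f, isLatticeInvariant_wave D hm 1 γ hγ x,
        isLatticeInvariant_wave D hm (-1) γ hγ x]
    have hw : ∀ ε, Differentiable ℝ (wave c ε) := fun ε =>
      (contDiff_wave c ε).differentiable (by simp)
    -- The two waves have opposite frequencies, so differentiation flips the sign of the second term
    -- and exchanges `f s` with `f (-s)`, as the system requires.
    have hderiv : ∀ v s x, cderiv v (f s) x
        = v 1 * (-(c / 2) * Complex.I) * f (-s) x := fun v s x => by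
      have h1 := cderiv_add (v := v) ((hw 1).const_mul ((r 0 + r 1) / 2))
        (((hw (-1)).const_mul ((r 0 - r 1) / 2)).const_mul s) x
      rw [cderiv_const_mul (hw 1), cderiv_const_mul ((hw (-1)).const_mul _),
        cderiv_const_mul (hw (-1)), cderiv_wave, cderiv_wave] at h1
      refine h1.trans ?_
      simp only [f]
      push_cast
      ring
    have hm1 := monomialForm_mem D (b := b) ha hc (hd 1) (hinv 1) ![0, 1]
    have hm2 := monomialForm_mem D (b := b) ha hc (hd (-1)) (hinv (-1)) ![0, 2]
    have hmem := Submodule.add_mem _ hm1 hm2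
    set ψ : Form 2 := monomialForm a b c (f 1) ![0, 1] + monomialForm a b c (f (-1)) ![0, 2] with hψ
    have c01 : coef a b c ψ ![0, 1] = f 1 := by
      funext x
      rw [hψ, coef_add, coef_monomialForm ha hc, coef_monomialForm ha hc]
      simp [Matrix.det_fin_two]
    have c02 : coef a b c ψ ![0, 2] = f (-1) := by
      funext x
      rw [hψ, coef_add, coef_monomialForm ha hc, coef_monomialForm ha hc]
      simp [Matrix.det_fin_two]
    have c12 : coef a b c ψ ![1, 2] = fun _ => 0 := by
      funext x
      rw [hψ, coef_add, coef_monomialForm ha hc, coef_monomialForm ha hc]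
      simp [Matrix.det_fin_two]
    refine ⟨⟨ψ, (mem_harmonic_iff ha hc).mpr ⟨hmem, fun x => ?_⟩⟩, ?_⟩
    · refine (dbar_eq_zero_iff_two ha hc (hmem.1.differentiable (by simp) x) hmem.2.2).mpr ?_
      have z0 : Zbar a b c 0 1 = Complex.I / 2 := by simp [Zbar]
      have z1 : Zbar a b c 1 1 = 0 := by simp [Zbar]
      have z2 : Zbar a b c 2 1 = 0 := by simp [Zbar]
      rw [c01, c02, c12]
      simp only [hderiv, z0, z1, z2, neg_neg, cderiv_const, zero_mul, mul_zero, and_self,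
        and_true, implies_true]
      constructor
      · linear_combination -(c / 4 * f (-1) x) * Complex.I_mul_I
      · linear_combination -(c / 4 * f 1 x) * Complex.I_mul_I
    · have w0 : ∀ ε, wave c ε 0 = 1 := fun ε => by simp [wave]
      funext i
      rw [coefAtZero_apply]
      fin_cases i
      · refine (congrFun c01 0).trans ?_
        simp only [f, w0]
        simp
        ring
      · refine (congrFun c02 0).trans ?_
        simp only [f, w0]
        simp
        ring

end Solvmanifold

end

theorem mainTheorem3 (D : Solvmanifold.LatticeData) (a b c : ℝ) (ha : a ≠ 0) (hc : c ≠ 0) :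
    Solvmanifold.hodgeNumber D a b c 1 0 = 1 ∧
    ((¬ ∃ m : ℤ, c = 4 * Real.pi * m) → Solvmanifold.hodgeNumber D a b c 2 0 = 0) ∧
    ((∃ m : ℤ, c = 4 * Real.pi * m) → Solvmanifold.hodgeNumber D a b c 2 0 = 2) ∧
    Solvmanifold.hodgeNumber D a b c 3 0 = 1 :=
  ⟨Solvmanifold.hodgeNumber_one D ha hc, Solvmanifold.hodgeNumber_two_of_not D ha hc,
    Solvmanifold.hodgeNumber_two_of_exists D ha hc, Solvmanifold.hodgeNumber_three D ha hc⟩
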